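/- Let $\Delta = \mathrm{conv}\{e_1,e_2,e_3,e_4\} \subset \mathbb{R}^4$ be the standard tetrahedron, let $P = \sum_{i=1}^4 \mathrm{conv}\{e_j : j \neq i\}$ be the truncated tetrahedron (the Minkowski sum of its four facet triangles), and let $\mathcal{A}$ be the Cayley configuration of the twelve points $(e_j, e_i) \in \mathbb{R}^4 \times \mathbb{R}^4$ with $i,j \in \{1,2,3,4\}$ and $j \neq i$. Triangulations of the Cayley polytope $\mathrm{conv}(\mathcal{A})$ are understood to have all their vertices in $\mathcal{A}$, and a mixed subdivision of $P$ is understood to be fine: its maximal cells are the three-dimensional labelled Minkowski sums $\sum_{i=1}^4 \mathrm{conv}(B_i)$ with $\emptyset \neq B_i \subseteq \{e_j : j \neq i\}$ and $\sum_{i=1}^4 (|B_i| - 1) = 3$; they cover $P$, and any two of them, with labels $B$ and $C$, intersect exactly in $\sum_{i=1}^4 \mathrm{conv}(B_i \cap C_i)$. A triangulation is regular if its maximal simplices are the projections of the lower facets of a lifting of $\mathcal{A}$ by real heights. Two triangulations are in the same symmetry class if one is mapped onto the other by an element of the group $(S_3)^4 \rtimes S_4$ of those permutations of the twelve points of $\mathcal{A}$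 that preserve the partition into the four blocks $\{(e_j,e_i) : j \neq i\}$, $i = 1,\dots,4$. Then $P$ has exactly $1068$ mixed subdivisions, one for each triangulation of $\mathrm{conv}(\mathcal{A})$: the map that replaces each maximal simplex $\sigma$ of a triangulation by the Minkowski sum of the polytopes $\mathrm{conv}(B_i)$, where $B_i = \{e_j : (e_j,e_i) \in \sigma\}$, is a bijection from the triangulations of $\mathrm{conv}(\mathcal{A})$ to the mixed subdivisions of $P$. Precisely $1002$ of the $1068$ triangulations are regular. Each symmetry class consists only of regular or only of non-regular triangulations; the regular triangulations form $48$ symmetry classes, and the non-regular triangulations form $7$ symmetry classes. -/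

import Mathlib

open scoped Pointwise

noncomputable section

/-- `T` is (the set of maximal simplices of) a triangulation of the labelled point configuration
`p`: every simplex has its vertices among the points of `p` and is of the full dimension of the
configuration, the simplices cover the convex hull of `p`, and any two of them meet in
their common face. -/
structure IsTriangulation {V E : Type*} [DecidableEq V] [AddCommGroup E] [Module ℝ E]
    (p : V → E) (T : Finset (Finset V)) : Prop where
  affineIndependent : ∀ σ ∈ T, AffineIndependent ℝ (fun v : σ => p v)
  full_dim : ∀ σ ∈ T, affineSpan ℝ (p '' (σ : Set V)) = affineSpan ℝ (Set.range p)
  cover : ⋃ σ ∈ T, convexHull ℝ (p '' (σ : Set V)) = convexHull ℝ (Set.range p)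
  inter : ∀ σ ∈ T, ∀ τ ∈ T,
    convexHull ℝ (p '' (σ : Set V)) ∩ convexHull ℝ (p '' (τ : Set V)) =
      convexHull ℝ (p '' ((σ ∩ τ : Finset V) : Set V))

/-- The maximal cells of the regular subdivision of `p` induced by the height function `ω`.
Lifting the point `p v` to height `ω v`, these are the label sets of the lower facets of the lifted
configuration: an affine function agrees with `ω` on `σ` and is strictly below `ω` elsewhere. -/
def regularCells {V E : Type*} [AddCommGroup E] [Module ℝ E]
    (p : V → E) (ω : V → ℝ) : Set (Finset V) :=
  {σ | affineSpan ℝ (p '' (σ : Set V)) = affineSpan ℝ (Set.range p) ∧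
    ∃ φ : E →ᵃ[ℝ] ℝ, (∀ v ∈ σ, φ (p v) = ω v) ∧ ∀ v ∉ σ, φ (p v) < ω v}

/-- A regular triangulation is a triangulation induced by some height function. -/
def IsRegularTriangulation {V E : Type*} [DecidableEq V] [AddCommGroup E] [Module ℝ E]
    (p : V → E) (T : Finset (Finset V)) : Prop :=
  IsTriangulation p T ∧ ∃ ω : V → ℝ, (T : Set (Finset V)) = regularCells p ω

section Minkowski

variable {κ E : Type*} {ι : κ → Type*} [Fintype κ] [AddCommGroup E] [Module ℝ E]

/-- The Minkowski sum of the polytopes `conv (q i)`. -/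
def minkowskiSum (q : (i : κ) → ι i → E) : Set E :=
  ∑ i, convexHull ℝ (Set.range (q i))

/-- The Minkowski cell with labels `B`: the sum of the polytopes spanned by the subsets
`B i` of the point configurations `q i`. It is empty if some `B i` is empty. -/
def minkowskiCell (q : (i : κ) → ι i → E) (B : (i : κ) → Finset (ι i)) : Set E :=
  ∑ i, convexHull ℝ (q i '' (B i : Set (ι i)))

/-- `M` is (the set of maximal cells of) a fine mixed subdivision of the Minkowski sum of the
polytopes `conv (q i)`. Its cells are labelled Minkowski cells of full dimension; they cover;
any two of them meet in the cell of their common labels; and they are fine, that is, the dimension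
of each cell is the sum of the numbers `#(B i) - 1` (so each summand is a simplex and the cell is
affinely isomorphic to the product of these simplices). -/
structure IsFineMixedSubdivision [∀ i, DecidableEq (ι i)]
    (q : (i : κ) → ι i → E) (M : Finset ((i : κ) → Finset (ι i))) : Prop where
  nonempty : ∀ B ∈ M, ∀ i, (B i).Nonempty
  full_dim : ∀ B ∈ M, vectorSpan ℝ (minkowskiCell q B) = vectorSpan ℝ (minkowskiSum q)
  fine : ∀ B ∈ M,
    ∑ i, ((B i).card - 1) = Module.finrank ℝ (vectorSpan ℝ (minkowskiSum q))
  cover : ⋃ B ∈ M, minkowskiCell q B = minkowskiSum q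
  inter : ∀ B ∈ M, ∀ C ∈ M,
    minkowskiCell q B ∩ minkowskiCell q C = minkowskiCell q (fun i => B i ∩ C i)

/-- The Cayley configuration of the point configurations `q i`: the point `q i a` is placed over
the `i`-th unit vector. -/
def cayleyConfig [DecidableEq κ] (q : (i : κ) → ι i → E) : (Σ i, ι i) → E × (κ → ℝ) :=
  fun v => (q v.1 v.2, Pi.single v.1 1)

end Minkowski

/-- The labelled Minkowski cell that corresponds to a simplex of the Cayley configuration. -/
def cayleyCell {κ : Type*} {ι : κ → Type*} [∀ i, Fintype (ι i)] [DecidableEq (Σ i, ι i)]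
    (σ : Finset (Σ i, ι i)) : (i : κ) → Finset (ι i) :=
  fun i => {a : ι i | (⟨i, a⟩ : Σ i, ι i) ∈ σ}

/-- The Cayley correspondence, applied to all the maximal simplices of a triangulation. -/
def cayleyTrick {κ : Type*} {ι : κ → Type*} [∀ i, Fintype (ι i)] [DecidableEq (Σ i, ι i)]
    [DecidableEq ((i : κ) → Finset (ι i))]
    (T : Finset (Finset (Σ i, ι i))) : Finset ((i : κ) → Finset (ι i)) :=
  T.image cayleyCell

/-- The vertices of the facet of the standard tetrahedron `conv {e₀, e₁, e₂, e₃}` in `ℝ⁴` that is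
opposite to the vertex `eᵢ`. -/
def facetTriangle (i : Fin 4) : {j : Fin 4 // j ≠ i} → (Fin 4 → ℝ) :=
  fun j => Pi.single j.1 1

/-- The labels `(i, j)`, `j ≠ i`, of the twelve columns of the Cayley matrix. -/
abbrev Label : Type := Σ i : Fin 4, {j : Fin 4 // j ≠ i}

/-- The twelve columns `(eⱼ, eᵢ) ∈ ℝ⁴ × ℝ⁴` of the Cayley matrix. -/
def cayleyColumns : Label → (Fin 4 → ℝ) × (Fin 4 → ℝ) :=
  cayleyConfig facetTriangle

/-- The group `(S₃)⁴ ⋊ S₄` of permutations of the twelve columns that preserve the partition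
into the four blocks of three columns. -/
def blockPerms : Subgroup (Equiv.Perm Label) where
  carrier := {g | ∀ v w : Label, (g v).1 = (g w).1 ↔ v.1 = w.1}
  one_mem' := fun _ _ => Iff.rfl
  mul_mem' := fun {g h} hg hh v w => (hg (h v) (h w)).trans (hh v w)
  inv_mem' := fun {g} hg v w => by
    have h := hg (g⁻¹ v) (g⁻¹ w)
    rw [show g (g⁻¹ v) = v from g.apply_symm_apply v,
      show g (g⁻¹ w) = w from g.apply_symm_apply w] at h
    exact h.symm

/-- Two collections of simplices are equivalent if an element of `(S₃)⁴ ⋊ S₄` maps one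
onto the other. -/
def SymmetryEquivalent (T T' : Finset (Finset Label)) : Prop :=
  ∃ g ∈ blockPerms, T' = T.image (fun σ => σ.image g)

/-- The symmetry class of `T`: all the triangulations that are equivalent to `T`. -/
def symmetryClass (T : Finset (Finset Label)) : Set (Finset (Finset Label)) :=
  {T' | IsTriangulation cayleyColumns T' ∧ SymmetryEquivalent T T'}

end

/-! The columns (e_j, e_i) with j ≠ i are the edges of the bipartite graph K₄,₄ minus a perfect
matching. A linear relation between them is an edge weighting whose sums at all eight vertices
vanish. Walking along edges of alternating sign, one finds a cycle in its support, so the circuits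
of the configuration are the cycles of the graph with alternating coefficients 1 and -1. Independent
sets are forests, full-dimensional simplices are spanning trees with 7 edges, and two simplices σ, τ
meet in their common face as soon as no circuit (P, N) has P ⊆ σ and N ⊆ τ. `IsCircuitSystem`
isolates these properties; they reduce triangulations and regularity to finite statements about
circuits.

Existence. For each of 48 height vectors, take the trees that contain no positive part P of a
circuit along which the height decreases. They cover the polytope because a representation of
minimal height contains no such P (`exists_minimal`), and they form a regular triangulation by the
local criterion `regularCells_eq`. Seven non-regular triangulations arise from regular ones by
flips, which preserve covering by `exists_exchange`. Their non-regularity has a Farkas certificate: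
inequalities forced on every inducing height function add up to a contradiction. The images under
the symmetric group of the tetrahedron's vertices are 1002 and 66 distinct triangulations.

Completeness. Slicing the Cayley polytope maps triangulations injectively to mixed subdivisions.
Surjectivity is not derived from the general Cayley trick but from an exhaustive search among mixed
subdivisions. Each of finitely many sample points of P lies in some cell. The search branches over
the trees whose cell may contain the point and discards the trees that conflict with the choices
made. At every leaf, the remaining trees form one of the 1068 known triangulations. A mixed
subdivision contained in a triangulation is all of it (`eq_cayleyTrick`), so the count of mixed
subdivisions, the bijection and the count of triangulations follow together.

Symmetry classes. The group (S₃)⁴ ⋊ S₄ need not act by linear maps, so it is not clear beforehand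
that it respects regularity. A number built from incidences of pairs of labels (`invariant`) is
preserved by this group and separates the 48 + 7 representatives. As every triangulation is a
tetrahedral image of a representative, there are exactly these classes, and none mixes the two
kinds.

For the computations, a set of labels is a 12-digit binary number and a family of sets is a number
with 4096 binary digits, so that operations on families become bitwise operations. -/

/-! ### Simplices and circuits of a point configuration -/

section CircuitSystem

variable {V E : Type*} [Fintype V] [DecidableEq V] [AddCommGroup E] [Module ℝ E]

/-- Points of the convex hull of a labelled configuration are given by weights on the labels. -/
theorem mem_convexHull_image_iff (p : V → E) (σ : Finset V) (x : E) :
    x ∈ convexHull ℝ (p '' (σ : Set V)) ↔ ∃ f : V → ℝ, (∀ v, 0 ≤ f v) ∧ (∀ v ∉ σ, f v = 0) ∧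
      ∑ v, f v = 1 ∧ ∑ v, f v • p v = x := by
  constructor
  · intro hx
    let K : Set E := {x | ∃ f : V → ℝ, (∀ v, 0 ≤ f v) ∧ (∀ v ∉ σ, f v = 0) ∧
      ∑ v, f v = 1 ∧ ∑ v, f v • p v = x}
    have hK : Convex ℝ K := by
      rintro _ ⟨f, hf0, hfσ, hf1, rfl⟩ _ ⟨g, hg0, hgσ, hg1, rfl⟩ a b ha hb hab
      refine ⟨fun v => a * f v + b * g v, fun v => ?_, fun v hv => ?_, ?_, ?_⟩
      · exact add_nonneg (mul_nonneg ha (hf0 v)) (mul_nonneg hb (hg0 v))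
      · simp [hfσ v hv, hgσ v hv]
      · rw [Finset.sum_add_distrib, ← Finset.mul_sum, ← Finset.mul_sum, hf1, hg1]
        linarith
      · simp only [add_smul, mul_smul, Finset.sum_add_distrib, Finset.smul_sum]
    refine convexHull_min ?_ hK hx
    rintro _ ⟨v, hv, rfl⟩
    refine ⟨Pi.single v 1, fun w => ?_, fun w hw => ?_, ?_, ?_⟩
    · by_cases h : w = v
      · subst h; simp
      · simp [h]
    · have : w ≠ v := fun h => hw (h ▸ hv)
      simp [this]
    · simp
    · simp [Pi.single_apply, ite_smul]
  · rintro ⟨f, hf0, hfσ, hf1, rfl⟩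
    have h1 : ∑ v ∈ σ, f v = 1 := by
      rw [← hf1]; exact Finset.sum_subset (Finset.subset_univ _) fun v _ hv => hfσ v hv
    have h2 : ∑ v ∈ σ, f v • p v = ∑ v, f v • p v :=
      Finset.sum_subset (Finset.subset_univ _) fun v _ hv => by simp [hfσ v hv]
    rw [← h2]
    exact (convex_convexHull ℝ _).sum_mem (fun v _ => hf0 v) h1
      fun v hv => subset_convexHull ℝ _ ⟨v, hv, rfl⟩

theorem mem_convexHull_range_iff (p : V → E) (x : E) :
    x ∈ convexHull ℝ (Set.range p) ↔ ∃ f : V → ℝ, (∀ v, 0 ≤ f v) ∧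
      ∑ v, f v = 1 ∧ ∑ v, f v • p v = x := by
  have := mem_convexHull_image_iff p Finset.univ x
  simpa using this

/-- A set `C` of pairs of sets of labels (the positive and negative parts of signed circuits) such
that every linear relation between the points of `p` contains one of the circuits conformally, and
all coefficients of the circuits are `1` and `-1`. -/
structure IsCircuitSystem (p : V → E) (C : Finset V → Finset V → Prop) : Prop where
  sum_eq : ∀ {P N}, C P N → ∑ v ∈ P, p v = ∑ v ∈ N, p v
  disjoint : ∀ {P N}, C P N → Disjoint P N
  nonempty : ∀ {P N}, C P N → P.Nonempty
  exists_conformal : ∀ x : V → ℝ, ∑ v, x v • p v = 0 → x ≠ 0 →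
    ∃ P N, C P N ∧ (∀ v ∈ P, 0 < x v) ∧ ∀ v ∈ N, x v < 0
  height : ∃ l : E →ₗ[ℝ] ℝ, ∀ v, l (p v) = 1

/-- `σ` contains no circuit. -/
def CircuitFree (C : Finset V → Finset V → Prop) (σ : Finset V) : Prop :=
  ∀ P N, C P N → ¬ (P ⊆ σ ∧ N ⊆ σ)

namespace IsCircuitSystem

variable {p : V → E} {C : Finset V → Finset V → Prop}

theorem sum_indicator (p : V → E) (P : Finset V) :
    ∑ v, (if v ∈ P then (1 : ℝ) else 0) • p v = ∑ v ∈ P, p v := by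
  simp [ite_smul]

/-- A nonzero relation contains a circuit conformally, hence inside its support, which is contained
in σ. -/
theorem eq_zero_of_free (h : IsCircuitSystem p C) {σ : Finset V} (hσ : CircuitFree C σ)
    {x : V → ℝ} (hx : ∀ v ∉ σ, x v = 0) (hsum : ∑ v, x v • p v = 0) : x = 0 := by
  by_contra hne
  obtain ⟨P, N, hC, hP, hN⟩ := h.exists_conformal x hsum hne
  refine hσ P N hC ⟨fun v hv => ?_, fun v hv => ?_⟩
  · by_contra hv'; exact (hP v hv).ne' (hx v hv')
  · by_contra hv'; exact (hN v hv).ne (hx v hv')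

theorem eq_of_free (h : IsCircuitSystem p C) {σ : Finset V} (hσ : CircuitFree C σ)
    {f g : V → ℝ} (hf : ∀ v ∉ σ, f v = 0) (hg : ∀ v ∉ σ, g v = 0)
    (hsum : ∑ v, f v • p v = ∑ v, g v • p v) : f = g := by
  have := h.eq_zero_of_free hσ (x := f - g) (fun v hv => by simp [hf v hv, hg v hv])
    (by simp [sub_smul, Finset.sum_sub_distrib, hsum])
  exact sub_eq_zero.mp this

/-- Uniqueness is required for affine relations only. This suffices because the height functional
makes the coefficients of every linear relation add up to zero. -/
theorem free_of_unique (h : IsCircuitSystem p C) {σ : Finset V}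
    (hu : ∀ x : V → ℝ, (∀ v ∉ σ, x v = 0) → ∑ v, x v = 0 → ∑ v, x v • p v = 0 → x = 0) :
    CircuitFree C σ := by
  rintro P N hC ⟨hP, hN⟩
  obtain ⟨l, hl⟩ := h.height
  obtain ⟨v, hv⟩ := h.nonempty hC
  have hvN : v ∉ N := Finset.disjoint_left.mp (h.disjoint hC) hv
  let x : V → ℝ := fun v => (if v ∈ P then 1 else 0) - (if v ∈ N then 1 else 0)
  have hx : ∑ v, x v • p v = 0 := by
    simp only [x, sub_smul, Finset.sum_sub_distrib, sum_indicator, h.sum_eq hC, sub_self]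
  have hx1 : ∑ v, x v = 0 := by
    have := congrArg l hx
    simpa [map_sum, hl] using this
  have := hu x (fun w hw => by
    have h1 : w ∉ P := fun hh => hw (hP hh)
    have h2 : w ∉ N := fun hh => hw (hN hh)
    simp [x, h1, h2]) hx1 hx
  have := congrFun this v
  simp [x, hv, hvN] at this

theorem free_iff_affineIndependent (h : IsCircuitSystem p C) (σ : Finset V) :
    CircuitFree C σ ↔ AffineIndependent ℝ (fun v : σ => p v) := by
  constructor
  · intro hσ
    rw [affineIndependent_iff]
    intro s w hw0 hw i hi
    let x : V → ℝ := fun v => if hv : v ∈ σ then (if (⟨v, hv⟩ : σ) ∈ s then w ⟨v, hv⟩ else 0) else 0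
    have hxw : ∀ v : σ, x v = if v ∈ s then w v else 0 := fun v => by simp [x, v.2]
    have hx : x = 0 := h.eq_zero_of_free hσ (fun v hv => by simp [x, hv]) (by
      rw [← Finset.sum_subset (Finset.subset_univ σ) (fun v _ hv => by simp [x, hv]),
        ← Finset.sum_coe_sort σ]
      simp only [hxw, ite_smul, zero_smul]
      rw [Finset.sum_ite_mem, Finset.univ_inter, hw])
    have := hxw i
    rw [hx, if_pos hi] at this
    exact this.symm
  · intro hσ
    refine h.free_of_unique fun x hx hx0 hxs => ?_
    rw [affineIndependent_iff] at hσ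
    have h1 : ∑ v : σ, x v = 0 := by
      rw [Finset.sum_coe_sort σ x, ← hx0]
      exact Finset.sum_subset (Finset.subset_univ σ) fun v _ hv => hx v hv
    have h2 : ∑ v : σ, x v • p v = 0 := by
      rw [Finset.sum_coe_sort σ (fun v => x v • p v), ← hxs]
      exact Finset.sum_subset (Finset.subset_univ σ) fun v _ hv => by simp [hx v hv]
    funext v
    by_cases hv : v ∈ σ
    · exact hσ Finset.univ (fun v : σ => x v) h1 h2 ⟨v, hv⟩ (Finset.mem_univ _)
    · exact hx v hv

/-- Two simplices without a circuit separating them meet in their common face. -/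
theorem inter_eq (h : IsCircuitSystem p C) {σ τ : Finset V}
    (hστ : ∀ P N, C P N → ¬ (P ⊆ σ ∧ N ⊆ τ)) :
    convexHull ℝ (p '' (σ : Set V)) ∩ convexHull ℝ (p '' (τ : Set V)) =
      convexHull ℝ (p '' ((σ ∩ τ : Finset V) : Set V)) := by
  apply Set.Subset.antisymm
  · rintro x ⟨hx, hx'⟩
    rw [mem_convexHull_image_iff] at hx hx' ⊢
    obtain ⟨f, hf0, hfσ, hf1, hf⟩ := hx
    obtain ⟨g, hg0, hgτ, hg1, hg⟩ := hx'
    have hfg : f = g := by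
      by_contra hne
      -- The two representations of a common point differ by a relation that is positive only on σ
      -- and negative only on τ.
      obtain ⟨P, N, hC, hP, hN⟩ := h.exists_conformal (f - g)
        (by simp [sub_smul, Finset.sum_sub_distrib, hf, hg]) (sub_ne_zero.mpr hne)
      refine hστ P N hC ⟨fun v hv => ?_, fun v hv => ?_⟩
      · by_contra hv'
        have := hP v hv
        simp only [Pi.sub_apply, hfσ v hv'] at this
        linarith [hg0 v]
      · by_contra hv'
        have := hN v hv
        simp only [Pi.sub_apply, hgτ v hv'] at this
        linarith [hf0 v]
    refine ⟨f, hf0, fun v hv => ?_, hf1, hf⟩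
    rw [Finset.mem_inter, not_and_or] at hv
    rcases hv with hv | hv
    · exact hfσ v hv
    · rw [hfg]; exact hgτ v hv
  · apply Set.subset_inter <;> apply convexHull_mono <;> apply Set.image_mono
    · exact_mod_cast Finset.inter_subset_left
    · exact_mod_cast Finset.inter_subset_right

/-- Moving along a circuit until a coefficient vanishes. -/
theorem exists_push (h : IsCircuitSystem p C) {P N : Finset V} (hC : C P N) {f : V → ℝ}
    (hf0 : ∀ v, 0 ≤ f v) :
    ∃ z ∈ P, 0 ≤ f z ∧ ∃ g : V → ℝ, (∀ v, 0 ≤ g v) ∧ g z = 0 ∧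
      (∀ v, g v = f v - f z * (if v ∈ P then 1 else 0) + f z * (if v ∈ N then 1 else 0)) ∧
      ∑ v, g v = ∑ v, f v ∧ ∑ v, g v • p v = ∑ v, f v • p v := by
  -- The step length is the smallest coefficient on P: no coefficient becomes negative, and the one
  -- at z vanishes.
  obtain ⟨z, hz, hmin⟩ := P.exists_min_image f (h.nonempty hC)
  have hzN : z ∉ N := Finset.disjoint_left.mp (h.disjoint hC) hz
  let g : V → ℝ := fun v =>
    f v - f z * (if v ∈ P then 1 else 0) + f z * (if v ∈ N then 1 else 0)
  have hg : ∑ v, g v • p v = ∑ v, f v • p v := by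
    simp only [g, add_smul, sub_smul, mul_smul, Finset.sum_add_distrib, Finset.sum_sub_distrib,
      ← Finset.smul_sum, sum_indicator, h.sum_eq hC]
    abel
  obtain ⟨l, hl⟩ := h.height
  refine ⟨z, hz, hf0 z, g, fun v => ?_, by simp [g, hz, hzN], fun v => rfl, ?_, hg⟩
  · have h1 := hf0 z
    have h2 := hf0 v
    by_cases hvP : v ∈ P
    · have := hmin v hvP
      by_cases hvN : v ∈ N <;> simp [g, hvP, hvN] <;> linarith
    · by_cases hvN : v ∈ N <;> simp [g, hvP, hvN] <;> linarith
  · have := congrArg l hg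
    simpa [map_sum, hl] using this

/-- The exchange step of a flip. -/
theorem exists_exchange (h : IsCircuitSystem p C) {P N σ : Finset V} (hC : C P N) {x : E}
    (hx : x ∈ convexHull ℝ (p '' (σ : Set V))) :
    ∃ z ∈ P, x ∈ convexHull ℝ (p '' (((σ ∪ N).erase z : Finset V) : Set V)) := by
  rw [mem_convexHull_image_iff] at hx
  obtain ⟨f, hf0, hfσ, hf1, hf⟩ := hx
  obtain ⟨z, hz, -, g, hg0, hgz, hg, hg1, hgs⟩ := h.exists_push hC hf0
  refine ⟨z, hz, ?_⟩
  rw [mem_convexHull_image_iff]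
  refine ⟨g, hg0, fun v hv => ?_, hg1.trans hf1, hgs.trans hf⟩
  by_cases hvz : v = z
  · rw [hvz, hgz]
  · simp only [Finset.mem_erase, Finset.mem_union, not_and_or, not_or, ne_eq, hvz,
      not_true_eq_false, false_or, not_false_eq_true] at hv
    have h0 := hg0 v
    have h1 := hfσ v hv.1
    have := hg v
    rw [h1, if_neg hv.2] at this
    have hz0 := hf0 z
    by_cases hvP : v ∈ P
    · rw [if_pos hvP] at this; linarith
    · rw [if_neg hvP] at this; linarith

/-- Every point is a convex combination of minimal weight, whose support contains no part of a
circuit along which the weight decreases. -/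
theorem exists_minimal (h : IsCircuitSystem p C) (ω : V → ℝ) {x : E}
    (hx : x ∈ convexHull ℝ (Set.range p)) :
    ∃ S : Finset V, x ∈ convexHull ℝ (p '' (S : Set V)) ∧
      ∀ P N, C P N → ∑ v ∈ N, ω v < ∑ v ∈ P, ω v → ¬ P ⊆ S := by
  rw [mem_convexHull_range_iff] at hx
  obtain ⟨f₀, hf₀0, hf₀1, hf₀⟩ := hx
  let A : Set (V → ℝ) := {y | ∑ v, y v • p v = 0}
  -- The representations of x as a convex combination form a compact set, on which the total weight
  -- attains its minimum.
  let K : Set (V → ℝ) := stdSimplex ℝ V ∩ {f | f - f₀ ∈ A}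
  have hAc : IsClosed A := by
    let L : (V → ℝ) →ₗ[ℝ] E := ∑ v, (LinearMap.proj v).smulRight (p v)
    have : A = (LinearMap.ker L : Set (V → ℝ)) := by
      ext y; simp [A, L]
    rw [this]
    exact Submodule.closed_of_finiteDimensional _
  have hK : IsCompact K :=
    (isCompact_stdSimplex ℝ V).inter_right (hAc.preimage (by fun_prop))
  have hne : K.Nonempty := ⟨f₀, ⟨hf₀0, hf₀1⟩, by simp [A]⟩
  obtain ⟨f, hfK, hmin⟩ := hK.exists_isMinOn hne
    (f := fun f : V → ℝ => ∑ v, f v * ω v) (by fun_prop)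
  obtain ⟨⟨hf0, hf1⟩, hfA⟩ := hfK
  have hf : ∑ v, f v • p v = x := by
    have : ∑ v, (f - f₀) v • p v = 0 := hfA
    simp only [Pi.sub_apply, sub_smul, Finset.sum_sub_distrib, hf₀] at this
    exact sub_eq_zero.mp this
  refine ⟨Finset.univ.filter fun v => f v ≠ 0, ?_, ?_⟩
  · rw [mem_convexHull_image_iff]
    exact ⟨f, hf0, fun v hv => by simpa using hv, hf1, hf⟩
  · intro P N hC hlt hP
    -- If P were in the support, the push along the circuit would have positive length and would
    -- lower the minimal weight.
    obtain ⟨z, hz, -, g, hg0, -, hg, hg1, hgs⟩ := h.exists_push hC hf0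
    have hzpos : 0 < f z := by
      have := hP hz
      simp only [Finset.mem_filter, Finset.mem_univ, true_and] at this
      exact lt_of_le_of_ne (hf0 z) (Ne.symm this)
    have hgK : g ∈ K := by
      refine ⟨⟨hg0, hg1.trans hf1⟩, ?_⟩
      change ∑ v, (g - f₀) v • p v = 0
      simp only [Pi.sub_apply, sub_smul, Finset.sum_sub_distrib, hf₀, hgs, hf, sub_self]
    have hle : ∑ v, f v * ω v ≤ ∑ v, g v * ω v := hmin hgK
    have : ∑ v, g v * ω v = ∑ v, f v * ω v - f z * (∑ v ∈ P, ω v - ∑ v ∈ N, ω v) := by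
      have e : ∀ v, g v * ω v = f v * ω v - f z * ((if v ∈ P then ω v else 0) -
          (if v ∈ N then ω v else 0)) := by
        intro v; rw [hg v]; split_ifs <;> ring
      simp only [e, Finset.sum_sub_distrib, ← Finset.mul_sum, Finset.sum_ite_mem, Finset.univ_inter]
    nlinarith

end IsCircuitSystem

end CircuitSystem

/-! ### Triangulations and regularity in terms of circuits -/

namespace IsCircuitSystem

variable {V E : Type*} [Fintype V] [DecidableEq V] [AddCommGroup E] [Module ℝ E]
  {p : V → E} {C : Finset V → Finset V → Prop}

theorem linearIndependent_of_free (h : IsCircuitSystem p C) {σ : Finset V}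
    (hσ : CircuitFree C σ) : LinearIndependent ℝ (fun v : σ => p v) := by
  rw [Fintype.linearIndependent_iff]
  intro w hw i
  let x : V → ℝ := fun v => if hv : v ∈ σ then w ⟨v, hv⟩ else 0
  have hxw : ∀ v : σ, x v = w v := fun v => by simp [x, v.2]
  have hx : x = 0 := h.eq_zero_of_free hσ (fun v hv => by simp [x, hv]) (by
    rw [← Finset.sum_subset (Finset.subset_univ σ) (fun v _ hv => by simp [x, hv]),
      ← Finset.sum_coe_sort σ]
    simpa only [hxw] using hw)
  rw [← hxw i, hx]; rfl

theorem exists_functional (h : IsCircuitSystem p C) {σ : Finset V} (hσ : CircuitFree C σ)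
    (ω : V → ℝ) : ∃ φ : E →ₗ[ℝ] ℝ, ∀ v ∈ σ, φ (p v) = ω v := by
  have hli := h.linearIndependent_of_free hσ
  obtain ⟨g, hg⟩ := LinearMap.exists_extend
    ((Module.Basis.span hli).constr ℝ (fun v : σ => ω v))
  refine ⟨g, fun v hv => ?_⟩
  have h1 := LinearMap.congr_fun hg (Module.Basis.span hli ⟨v, hv⟩)
  rw [Module.Basis.constr_basis] at h1
  simpa [Module.Basis.span_apply] using h1

theorem exists_relation {σ : Finset V} {x : E} (hx : x ∈ affineSpan ℝ (p '' (σ : Set V))) :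
    ∃ f : V → ℝ, (∀ v ∉ σ, f v = 0) ∧ ∑ v, f v • p v = x := by
  have hx' := affineSpan_subset_span (k := ℝ) hx
  rw [SetLike.mem_coe, Submodule.mem_span_image_finset_iff_exists_fun] at hx'
  obtain ⟨c, hc⟩ := hx'
  refine ⟨fun v => if hv : v ∈ σ then c ⟨v, hv⟩ else 0, fun v hv => by simp [hv], ?_⟩
  rw [← hc, ← Finset.sum_subset (Finset.subset_univ σ) (fun v _ hv => by simp [hv]),
    ← Finset.sum_coe_sort σ]
  simp

/-- A label v of σ outside τ would give a point spanned by the points of τ, against the independence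
of σ. -/
theorem subset_of_affineSpan_eq (h : IsCircuitSystem p C) {σ τ : Finset V}
    (hσ : CircuitFree C σ) (hτσ : τ ⊆ σ)
    (hτ : affineSpan ℝ (p '' (τ : Set V)) = affineSpan ℝ (Set.range p)) : σ ⊆ τ := by
  intro v hv
  by_contra hvτ
  obtain ⟨f, hf, hfs⟩ := exists_relation (p := p) (σ := τ) (x := p v)
    (hτ ▸ subset_affineSpan ℝ _ ⟨v, rfl⟩)
  have := h.eq_of_free hσ (f := f) (g := Pi.single v 1) (fun w hw => hf w fun hh => hw (hτσ hh))
    (fun w hw => by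
      have : w ≠ v := fun hh => hw (hh ▸ hv)
      simp [this]) (by simp [hfs, Pi.single_apply, ite_smul])
  have := congrFun this v
  simp [hf v hvτ] at this

theorem isTriangulation (h : IsCircuitSystem p C) {T : Finset (Finset V)}
    (hfree : ∀ σ ∈ T, CircuitFree C σ)
    (hfull : ∀ σ ∈ T, affineSpan ℝ (p '' (σ : Set V)) = affineSpan ℝ (Set.range p))
    (hcompat : ∀ σ ∈ T, ∀ τ ∈ T, ∀ P N, C P N → ¬ (P ⊆ σ ∧ N ⊆ τ))
    (hcover : ∀ x ∈ convexHull ℝ (Set.range p), ∃ σ ∈ T, x ∈ convexHull ℝ (p '' (σ : Set V))) :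
    IsTriangulation p T where
  affineIndependent σ hσ := (h.free_iff_affineIndependent σ).mp (hfree σ hσ)
  full_dim := hfull
  cover := by
    apply Set.Subset.antisymm
    · exact Set.iUnion₂_subset fun σ _ => convexHull_mono (Set.image_subset_range _ _)
    · intro x hx
      obtain ⟨σ, hσ, hxσ⟩ := hcover x hx
      exact Set.mem_iUnion₂.mpr ⟨σ, hσ, hxσ⟩
  inter σ hσ τ hτ := h.inter_eq (hcompat σ hσ τ hτ)

/-- The local criterion for regularity. -/
theorem regularCells_eq [Nonempty V] (h : IsCircuitSystem p C) {T : Finset (Finset V)}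
    (hT : IsTriangulation p T) (ω : V → ℝ)
    (hω : ∀ σ ∈ T, ∀ P N, C P N → N ⊆ σ → ∑ v ∈ N, ω v < ∑ v ∈ P, ω v) :
    (T : Set (Finset V)) = regularCells p ω := by
  have hfree : ∀ σ ∈ T, CircuitFree C σ := fun σ hσ =>
    (h.free_iff_affineIndependent σ).mpr (hT.affineIndependent σ hσ)
  have key : ∀ σ ∈ T, ∃ φ : E →ₗ[ℝ] ℝ, (∀ v ∈ σ, φ (p v) = ω v) ∧ ∀ v ∉ σ, φ (p v) < ω v := by
    intro σ hσ
    obtain ⟨φ, hφ⟩ := h.exists_functional (hfree σ hσ) ω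
    refine ⟨φ, hφ, fun v hv => ?_⟩
    obtain ⟨f, hf, hfs⟩ := exists_relation (p := p) (σ := σ) (x := p v)
      (hT.full_dim σ hσ ▸ subset_affineSpan ℝ _ ⟨v, rfl⟩)
    -- This relation expresses p v by the points of σ. Outside σ it is nonzero only at v, where it
    -- is positive. So a conformal circuit has N ⊆ σ and P ⊆ σ ∪ {v}, and v ∈ P since σ is free. On
    -- this circuit φ agrees with ω except at v, so ω(N) < ω(P) becomes φ (p v) < ω v.
    let x : V → ℝ := Pi.single v 1 - f
    have hxv : x v = 1 := by simp [x, hf v hv]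
    have hx0 : ∀ w ∉ σ, w ≠ v → x w = 0 := fun w hw hwv => by simp [x, hf w hw, hwv]
    obtain ⟨P, N, hC, hP, hN⟩ := h.exists_conformal x
      (by simp [x, sub_smul, Finset.sum_sub_distrib, hfs, Pi.single_apply, ite_smul])
      (fun h0 => by simp [h0] at hxv)
    have hNσ : N ⊆ σ := by
      intro w hw
      by_contra hwσ
      by_cases hwv : w = v
      · have := hN w hw; rw [hwv, hxv] at this; linarith
      · exact (hN w hw).ne (hx0 w hwσ hwv)
    have hPσ : P.erase v ⊆ σ := by
      intro w hw
      by_contra hwσ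
      exact (hP w (Finset.mem_of_mem_erase hw)).ne' (hx0 w hwσ (Finset.ne_of_mem_erase hw))
    have hvP : v ∈ P := by
      by_contra hvP
      rw [Finset.erase_eq_of_notMem hvP] at hPσ
      exact hfree σ hσ P N hC ⟨hPσ, hNσ⟩
    have h1 := congrArg φ (h.sum_eq hC)
    simp only [map_sum] at h1
    rw [Finset.sum_congr rfl fun w hw => hφ w (hNσ hw), ← Finset.add_sum_erase _ _ hvP,
      Finset.sum_congr rfl fun w hw => hφ w (hPσ hw)] at h1
    have h2 := hω σ hσ P N hC hNσ
    rw [← Finset.add_sum_erase _ _ hvP] at h2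
    linarith
  ext τ
  constructor
  · intro hτ
    obtain ⟨φ, h1, h2⟩ := key τ hτ
    exact ⟨hT.full_dim τ hτ, φ.toAffineMap, h1, h2⟩
  · rintro ⟨hfull, ψ, hψ1, hψ2⟩
    have hne : τ.Nonempty := by
      rw [Finset.nonempty_iff_ne_empty]
      rintro rfl
      obtain ⟨v⟩ := ‹Nonempty V›
      have : p v ∈ affineSpan ℝ (p '' ((∅ : Finset V) : Set V)) :=
        hfull ▸ subset_affineSpan ℝ _ ⟨v, rfl⟩
      simp only [Finset.coe_empty, Set.image_empty, AffineSubspace.span_empty] at this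
      exact AffineSubspace.notMem_bot ℝ E _ this
    -- The barycentre of τ lies in some σ ∈ T. Both ψ and φ are bounded by ω on all points, with
    -- equality on τ and on σ respectively. Hence ∑ b ω = ∑ b ψ = ∑ f ψ ≤ ∑ f ω = ∑ f φ = ∑ b φ ≤ ∑
    -- b ω, and the last inequality would be strict if τ were not contained in σ.
    let b : V → ℝ := fun v => if v ∈ τ then (τ.card : ℝ)⁻¹ else 0
    have hcard : (0 : ℝ) < τ.card := by exact_mod_cast hne.card_pos
    have hb1 : ∑ v, b v = 1 := by
      simp only [b, Finset.sum_ite_mem, Finset.univ_inter, Finset.sum_const, nsmul_eq_mul]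
      exact mul_inv_cancel₀ hcard.ne'
    have hb0 : ∀ v, 0 ≤ b v := fun v => by
      simp only [b]; split_ifs
      · positivity
      · exact le_rfl
    have hx : ∑ v, b v • p v ∈ ⋃ σ ∈ T, convexHull ℝ (p '' (σ : Set V)) := by
      rw [hT.cover, mem_convexHull_range_iff]
      exact ⟨b, hb0, hb1, rfl⟩
    obtain ⟨σ, hσ, hxσ⟩ := Set.mem_iUnion₂.mp hx
    rw [mem_convexHull_image_iff] at hxσ
    obtain ⟨f, hf0, hfσ, hf1, hf⟩ := hxσ
    obtain ⟨φ, hφ1, hφ2⟩ := key σ hσ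
    have e1 : ∑ v, f v * φ (p v) = ∑ v, b v * φ (p v) := by
      have := congrArg φ hf
      simpa [map_sum] using this
    have e2 : ∑ v, f v * ψ (p v) = ∑ v, b v * ψ (p v) := by
      have h3 := congrArg ψ.linear hf
      simp only [map_sum, map_smul, smul_eq_mul] at h3
      have hd : ∀ v, ψ (p v) = ψ.linear (p v) + ψ 0 := fun v => by
        have := congrFun ψ.decomp (p v); simpa using this
      simp only [hd, mul_add, Finset.sum_add_distrib, ← Finset.sum_mul, h3, hf1, hb1]
    have e3 : ∑ v, f v * φ (p v) = ∑ v, f v * ω v := Finset.sum_congr rfl fun v _ => by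
      by_cases hv : v ∈ σ
      · rw [hφ1 v hv]
      · rw [hfσ v hv]; ring
    have e4 : ∑ v, b v * ψ (p v) = ∑ v, b v * ω v := Finset.sum_congr rfl fun v _ => by
      by_cases hv : v ∈ τ
      · rw [hψ1 v hv]
      · simp [b, hv]
    have e5 : ∑ v, f v * ψ (p v) ≤ ∑ v, f v * ω v := Finset.sum_le_sum fun v _ => by
      refine mul_le_mul_of_nonneg_left ?_ (hf0 v)
      by_cases hv : v ∈ τ
      · exact (hψ1 v hv).le
      · exact (hψ2 v hv).le
    have hτσ : τ ⊆ σ := by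
      intro v hv
      by_contra hvσ
      have : ∑ v, b v * φ (p v) < ∑ v, b v * ω v := by
        refine Finset.sum_lt_sum (fun w _ => mul_le_mul_of_nonneg_left ?_ (hb0 w))
          ⟨v, Finset.mem_univ v, mul_lt_mul_of_pos_left (hφ2 v hvσ) ?_⟩
        · by_cases hw : w ∈ σ
          · exact (hφ1 w hw).le
          · exact (hφ2 w hw).le
        · simp only [b, hv, if_true]; positivity
      linarith
    have : τ = σ := hτσ.antisymm (h.subset_of_affineSpan_eq (hfree σ hσ) hτσ hfull)
    rw [this]; exact hσ

/-- The height functional gives P and N equal size, so an affine function has the same sum over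
both. The function that supports σ equals ω on N and is at most ω on P, strictly so at a label of P
outside σ, which exists because σ is free. -/
theorem lt_of_regularCells (h : IsCircuitSystem p C) {ω : V → ℝ} {σ : Finset V}
    (hfree : CircuitFree C σ) (hσ : σ ∈ regularCells p ω) {P N : Finset V} (hC : C P N)
    (hN : N ⊆ σ) : ∑ v ∈ N, ω v < ∑ v ∈ P, ω v := by
  obtain ⟨-, φ, h1, h2⟩ := hσ
  obtain ⟨l, hl⟩ := h.height
  have hcard : (P.card : ℝ) = N.card := by
    have := congrArg l (h.sum_eq hC)
    simpa [map_sum, hl] using this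
  have hd : ∀ v, φ (p v) = φ.linear (p v) + φ 0 := fun v => by
    have := congrFun φ.decomp (p v); simpa using this
  have e : ∑ v ∈ P, φ (p v) = ∑ v ∈ N, φ (p v) := by
    have := congrArg φ.linear (h.sum_eq hC)
    simp only [map_sum] at this
    simp only [hd, Finset.sum_add_distrib, this, Finset.sum_const, nsmul_eq_mul, hcard]
  rw [← Finset.sum_congr rfl fun v hv => h1 v (hN hv), ← e]
  obtain ⟨v, hv, hvσ⟩ : ∃ v ∈ P, v ∉ σ := by
    by_contra! hcon
    exact hfree P N hC ⟨hcon, hN⟩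
  refine Finset.sum_lt_sum (fun w _ => ?_) ⟨v, hv, h2 v hvσ⟩
  by_cases hw : w ∈ σ
  · exact (h1 w hw).le
  · exact (h2 w hw).le

end IsCircuitSystem

/-! ### Linear symmetries of a configuration -/

section Relabel

variable {V E : Type*} [AddCommGroup E] [Module ℝ E] {p : V → E}

theorem range_relabel (g : Equiv.Perm V) (A : E ≃ₗ[ℝ] E) (hA : ∀ v, p (g v) = A (p v)) :
    Set.range p = A '' Set.range p := by
  rw [← Set.range_comp, ← g.surjective.range_comp]
  exact congrArg Set.range (funext hA)

variable [DecidableEq V]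

theorem image_relabel (g : Equiv.Perm V) (A : E ≃ₗ[ℝ] E) (hA : ∀ v, p (g v) = A (p v))
    (σ : Finset V) : p '' ((σ.image g : Finset V) : Set V) = A '' (p '' (σ : Set V)) := by
  simp only [Finset.coe_image, Set.image_image, hA]

theorem convexHull_image_linearEquiv (A : E ≃ₗ[ℝ] E) (s : Set E) :
    convexHull ℝ (A '' s) = A '' convexHull ℝ s :=
  (A.toLinearMap.image_convexHull s).symm

theorem affineSpan_image_linearEquiv (A : E ≃ₗ[ℝ] E) (s : Set E) :
    affineSpan ℝ (A '' s) = (affineSpan ℝ s).map (A.toLinearMap.toAffineMap) :=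
  (AffineSubspace.map_span A.toLinearMap.toAffineMap s).symm

theorem IsTriangulation.relabel {T : Finset (Finset V)} (hT : IsTriangulation p T)
    (g : Equiv.Perm V) (A : E ≃ₗ[ℝ] E) (hA : ∀ v, p (g v) = A (p v)) :
    IsTriangulation p (T.image fun σ => σ.image g) where
  affineIndependent := by
    intro τ hτ
    obtain ⟨σ, hσ, rfl⟩ := Finset.mem_image.mp hτ
    have h1 := (hT.affineIndependent σ hσ).map' A.toLinearMap.toAffineMap A.injective
    let e : ((σ.image g : Finset V)) → σ := fun v => ⟨g.symm v, by
      obtain ⟨w, hw, h⟩ := Finset.mem_image.mp v.2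
      rw [← h]; simpa using hw⟩
    have he : Function.Injective e := fun v w hvw => by
      have := congrArg Subtype.val hvw
      exact Subtype.ext (g.symm.injective this)
    have h2 := h1.comp_embedding ⟨e, he⟩
    convert h2 using 2 with v
    simp [e, ← hA]
  full_dim := by
    intro τ hτ
    obtain ⟨σ, hσ, rfl⟩ := Finset.mem_image.mp hτ
    rw [image_relabel g A hA, range_relabel g A hA, affineSpan_image_linearEquiv,
      affineSpan_image_linearEquiv, hT.full_dim σ hσ]
  cover := by
    rw [range_relabel g A hA, convexHull_image_linearEquiv, ← hT.cover, Set.image_iUnion₂]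
    simp only [Finset.set_biUnion_finset_image, image_relabel g A hA, convexHull_image_linearEquiv]
  inter := by
    intro σ' hσ' τ' hτ'
    obtain ⟨σ, hσ, rfl⟩ := Finset.mem_image.mp hσ'
    obtain ⟨τ, hτ, rfl⟩ := Finset.mem_image.mp hτ'
    rw [← Finset.image_inter _ _ g.injective]
    simp only [image_relabel g A hA, convexHull_image_linearEquiv]
    rw [← Set.image_inter A.injective, hT.inter σ hσ τ hτ]

theorem IsRegularTriangulation.relabel {T : Finset (Finset V)} (hT : IsRegularTriangulation p T)
    (g : Equiv.Perm V) (A : E ≃ₗ[ℝ] E) (hA : ∀ v, p (g v) = A (p v)) :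
    IsRegularTriangulation p (T.image fun σ => σ.image g) := by
  obtain ⟨h1, ω, hω⟩ := hT
  refine ⟨h1.relabel g A hA, fun v => ω (g.symm v), ?_⟩
  have hA' : ∀ v, A.symm (p v) = p (g.symm v) := fun v => by
    rw [LinearEquiv.symm_apply_eq, ← hA, Equiv.apply_symm_apply]
  have hg : ∀ σ : Finset V, (σ.image g).image g.symm = σ := fun σ => by
    simp [Finset.image_image]
  have hg' : ∀ σ : Finset V, (σ.image g.symm).image g = σ := fun σ => by
    simp [Finset.image_image]
  have hmem : ∀ (σ : Finset V) v, v ∈ σ.image g ↔ g.symm v ∈ σ := fun σ v => by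
    constructor
    · intro hv
      obtain ⟨w, hw, rfl⟩ := Finset.mem_image.mp hv
      simpa using hw
    · intro hv; exact Finset.mem_image.mpr ⟨_, hv, by simp⟩
  have key : ∀ σ, σ ∈ regularCells p ω → σ.image g ∈ regularCells p fun v => ω (g.symm v) := by
    rintro σ ⟨ha, φ, h1, h2⟩
    refine ⟨?_, φ.comp A.symm.toLinearMap.toAffineMap, fun v hv => ?_, fun v hv => ?_⟩
    · rw [image_relabel g A hA, range_relabel g A hA, affineSpan_image_linearEquiv,
        affineSpan_image_linearEquiv, ha]
    · rw [hmem] at hv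
      simpa [hA'] using h1 _ hv
    · rw [hmem] at hv
      simpa [hA'] using h2 _ hv
  ext τ
  constructor
  · intro hτ
    obtain ⟨σ, hσ, rfl⟩ := Finset.mem_image.mp (Finset.mem_coe.mp hτ)
    exact key σ (hω ▸ Finset.mem_coe.mpr hσ)
  · rintro ⟨ha, φ, h1, h2⟩
    have : τ.image g.symm ∈ regularCells p ω := by
      refine ⟨?_, φ.comp A.toLinearMap.toAffineMap, fun v hv => ?_, fun v hv => ?_⟩
      · rw [image_relabel g.symm A.symm (fun v => (hA' v).symm),
          range_relabel g.symm A.symm (fun v => (hA' v).symm), affineSpan_image_linearEquiv,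
          affineSpan_image_linearEquiv, ha]
      · have : g v ∈ τ := by
          obtain ⟨w, hw, rfl⟩ := Finset.mem_image.mp hv
          simpa using hw
        simpa [hA] using h1 _ this
      · have : g v ∉ τ := fun hh => hv (Finset.mem_image.mpr ⟨_, hh, by simp⟩)
        simpa [hA] using h2 _ this
    rw [← hω] at this
    exact Finset.mem_coe.mpr (Finset.mem_image.mpr ⟨_, Finset.mem_coe.mp this, hg' τ⟩)

end Relabel

namespace TruncatedTetrahedron

/-! ### Sets of labels as binary numbers -/

/-- Evaluate `x` to a numeral before passing it on. -/
def force {α : Type} (x : ℕ) (f : ℕ → α) : α := Nat.rec (f 0) (fun n _ => f (n + 1)) x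

theorem force_eq {α : Type} (x : ℕ) (f : ℕ → α) : force x f = f x := by
  cases x <;> rfl

/-- The fold is the bare recursor, which unfolds directly in the kernel evaluations below. -/
def foldR {α β : Type} (f : α → β → β) (b : β) (l : List α) : β :=
  List.rec b (fun a _ ih => f a ih) l

@[simp] theorem foldR_nil {α β : Type} (f : α → β → β) (b : β) : foldR f b [] = b := rfl

@[simp] theorem foldR_cons {α β : Type} (f : α → β → β) (b : β) (a : α) (l : List α) :
    foldR f b (a :: l) = f a (foldR f b l) := rfl

def allR {α : Type} (p : α → Bool) (l : List α) : Bool :=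
  foldR (fun a b => bif p a then b else false) true l

theorem allR_eq_true {α : Type} {p : α → Bool} {l : List α} :
    allR p l = true ↔ ∀ a ∈ l, p a = true := by
  induction l with
  | nil => simp [allR]
  | cons a l ih =>
    have : allR p (a :: l) = (bif p a then allR p l else false) := rfl
    rw [this]
    cases h : p a <;> simp [h, ih]

def bit (m k : ℕ) : Bool := Nat.beq (Nat.land (Nat.shiftRight m k) 1) 1

theorem bit_eq (m k : ℕ) : bit m k = m.testBit k := by
  have h : Nat.land (Nat.shiftRight m k) 1 = (m >>> k) % 2 := Nat.and_one_is_mod _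
  rw [bit, h, Nat.testBit_eq_decide_div_mod_eq, Nat.shiftRight_eq_div_pow]
  by_cases h2 : m / 2 ^ k % 2 = 1
  · simp [h2]
  · have : m / 2 ^ k % 2 = 0 := by omega
    simp [this]; rfl

theorem testBit_lor (x y m : ℕ) : (Nat.lor x y).testBit m = (x.testBit m || y.testBit m) :=
  Nat.testBit_or x y m

theorem testBit_land (x y m : ℕ) : (Nat.land x y).testBit m = (x.testBit m && y.testBit m) :=
  Nat.testBit_and x y m

theorem testBit_one_shiftLeft (k m : ℕ) : (Nat.shiftLeft 1 k).testBit m = decide (m = k) := by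
  change (1 <<< k).testBit m = _
  rw [Nat.one_shiftLeft, Nat.testBit_two_pow]
  simp [eq_comm]

/-- The difference of two sets of binary digits, formed without a complement, which would not be a
natural number. -/
def diff (x y : ℕ) : ℕ := Nat.xor x (Nat.land x y)

theorem testBit_diff (x y m : ℕ) : (diff x y).testBit m = (x.testBit m && !y.testBit m) := by
  have : (diff x y).testBit m = (x ^^^ (x &&& y)).testBit m := rfl
  rw [this, Nat.testBit_xor, Nat.testBit_and]
  cases x.testBit m <;> cases y.testBit m <;> rfl

/-- the number whose binary digits at the positions `< 2 ^ d` are `1` -/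
def allCode : ℕ → ℕ
  | 0 => 1
  | d + 1 => force (allCode d) fun a => Nat.lor a (Nat.shiftLeft a (2 ^ d))

theorem testBit_allCode (d m : ℕ) : (allCode d).testBit m = decide (m < 2 ^ d) := by
  induction d generalizing m with
  | zero => cases m <;> simp [allCode, Nat.testBit_succ]
  | succ d ih =>
    rw [allCode, force_eq, testBit_lor]
    change ((allCode d).testBit m || (allCode d <<< 2 ^ d).testBit m) = _
    rw [Nat.testBit_shiftLeft, ih, ih, Bool.eq_iff_iff]
    simp only [Bool.or_eq_true, Bool.and_eq_true, decide_eq_true_eq, pow_succ]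
    omega

/-- the number whose binary digits `1` are at the positions `m < 2 ^ d` with `m.testBit k` -/
def hasCode (k : ℕ) : ℕ → ℕ
  | 0 => 0
  | d + 1 => bif Nat.beq d k then Nat.shiftLeft (allCode d) (2 ^ d)
    else force (hasCode k d) fun a => Nat.lor a (Nat.shiftLeft a (2 ^ d))

theorem testBit_hasCode (k d m : ℕ) :
    (hasCode k d).testBit m = decide (m < 2 ^ d ∧ k < d ∧ m.testBit k = true) := by
  induction d generalizing m with
  | zero => simp [hasCode]
  | succ d ih =>
    rw [hasCode]
    by_cases hk : d = k
    · subst hk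
      have : Nat.beq d d = true := by simp
      rw [this, cond_true]
      change (allCode d <<< 2 ^ d).testBit m = _
      rw [Nat.testBit_shiftLeft, testBit_allCode, Bool.eq_iff_iff]
      simp only [Bool.and_eq_true, decide_eq_true_eq, lt_add_iff_pos_right, zero_lt_one, true_and]
      constructor
      · rintro ⟨h1, h2⟩
        obtain ⟨r, rfl⟩ := Nat.exists_eq_add_of_le h1
        refine ⟨by rw [pow_succ]; omega, ?_⟩
        rw [Nat.testBit_two_pow_add_eq, Nat.testBit_lt_two_pow (by omega)]; rfl
      · rintro ⟨h1, h2⟩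
        have h3 := Nat.ge_two_pow_of_testBit h2
        rw [pow_succ] at h1
        exact ⟨h3, by omega⟩
    · have : Nat.beq d k = false := by
        rw [Bool.eq_false_iff]; intro h; exact hk (Nat.eq_of_beq_eq_true h)
      rw [this, cond_false, force_eq, testBit_lor]
      change ((hasCode k d).testBit m || (hasCode k d <<< 2 ^ d).testBit m) = _
      rw [Nat.testBit_shiftLeft, ih, ih, Bool.eq_iff_iff]
      simp only [Bool.or_eq_true, Bool.and_eq_true, decide_eq_true_eq]
      by_cases hm : m < 2 ^ d
      · have h1 : ¬ m ≥ 2 ^ d := by omega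
        have h2 : m < 2 ^ (d + 1) := by rw [pow_succ]; omega
        simp only [hm, h1, h2, false_and, or_false, true_and]
        constructor
        · rintro ⟨h3, h4⟩; exact ⟨by omega, h4⟩
        · rintro ⟨h3, h4⟩; exact ⟨by omega, h4⟩
      · obtain ⟨r, rfl⟩ := Nat.exists_eq_add_of_le (not_lt.mp hm)
        simp only [hm, false_and, false_or, Nat.add_sub_cancel_left, ge_iff_le,
          Nat.le_add_right, true_and, pow_succ]
        constructor
        · rintro ⟨h3, h4, h5⟩
          exact ⟨by omega, by omega, by rwa [Nat.testBit_two_pow_add_gt h4]⟩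
        · rintro ⟨h3, h4, h5⟩
          have h6 : k < d := by omega
          exact ⟨by omega, h6, by rwa [Nat.testBit_two_pow_add_gt h6] at h5⟩

/-- From here on, digit m of a code of a family stands for the set of labels with binary code m.
Families are numbers below 2 ^ 4096; unions and intersections of families are bitwise. -/
def allMasks : ℕ := allCode 12

def indices : List ℕ := [0, 1, 2, 3, 4, 5, 6, 7, 8, 9, 10, 11]

def hasTable : List ℕ := indices.map fun k => hasCode k 12

/-- the code of the family of all sets that contain `P` -/
def supersets : List ℕ → ℕ → ℕ
  | [], _ => allMasks
  | h :: hs, P => bif bit P 0 then Nat.land h (supersets hs (Nat.shiftRight P 1))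
    else supersets hs (Nat.shiftRight P 1)

/-- the code of the family of all sets that meet `P` -/
def hitting : List ℕ → ℕ → ℕ
  | [], _ => 0
  | h :: hs, P => bif bit P 0 then Nat.lor h (hitting hs (Nat.shiftRight P 1))
    else hitting hs (Nat.shiftRight P 1)

/-- the code of the family of all sets with at least `j` elements -/
def atLeast : List ℕ → ℕ → ℕ
  | _, 0 => allMasks
  | [], _ + 1 => 0
  | h :: hs, j + 1 => Nat.lor (atLeast hs (j + 1)) (Nat.land h (atLeast hs j))

theorem forall_lt_succ_testBit {n P : ℕ} {Q : ℕ → Prop} :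
    (∀ i < n + 1, P.testBit i = true → Q i) ↔
      (P.testBit 0 = true → Q 0) ∧ ∀ i < n, (Nat.shiftRight P 1).testBit i = true → Q (i + 1) := by
  have e : ∀ i, (Nat.shiftRight P 1).testBit i = P.testBit (i + 1) := fun i => by
    change (P >>> 1).testBit i = _
    rw [Nat.testBit_shiftRight, Nat.add_comm]
  simp only [e]
  constructor
  · intro h
    exact ⟨h 0 (by omega), fun i hi => h (i + 1) (by omega)⟩
  · rintro ⟨h1, h2⟩ i hi
    cases i with
    | zero => exact h1
    | succ i => exact h2 i (by omega)

/-- The recursion consumes the table from the front and shifts P at the same time, while m stays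
fixed; the offset o records how far it has come. -/
theorem testBit_supersets_range (n o P m : ℕ) (ho : o + n ≤ 12) :
    (supersets ((List.range' o n).map fun k => hasCode k 12) P).testBit m = true ↔
      m < 2 ^ 12 ∧ ∀ i < n, P.testBit i = true → m.testBit (o + i) = true := by
  induction n generalizing o P with
  | zero => simp [supersets, allMasks, testBit_allCode]
  | succ n ih =>
    rw [List.range'_succ, List.map_cons, supersets, forall_lt_succ_testBit, bit_eq]
    have e : ∀ i, o + 1 + i = o + (i + 1) := fun i => by omega
    have := ih (o + 1) (Nat.shiftRight P 1) (by omega)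
    simp only [e] at this
    simp only [Nat.add_zero]
    have ho' : o < 12 := by omega
    cases h0 : P.testBit 0
    · rw [cond_false, this]; simp
    · rw [cond_true, testBit_land, Bool.and_eq_true, this, testBit_hasCode]
      simp only [ho', true_and, decide_eq_true_eq, forall_const]
      tauto

theorem testBit_hitting_range (n o P m : ℕ) (ho : o + n ≤ 12) :
    (hitting ((List.range' o n).map fun k => hasCode k 12) P).testBit m = true ↔
      m < 2 ^ 12 ∧ ∃ i < n, P.testBit i = true ∧ m.testBit (o + i) = true := by
  induction n generalizing o P with
  | zero => simp [hitting]
  | succ n ih =>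
    rw [List.range'_succ, List.map_cons, hitting, bit_eq]
    have e : (∃ i < n + 1, P.testBit i = true ∧ m.testBit (o + i) = true) ↔
        (P.testBit 0 = true ∧ m.testBit o = true) ∨
          ∃ i < n, (Nat.shiftRight P 1).testBit i = true ∧ m.testBit (o + 1 + i) = true := by
      have := forall_lt_succ_testBit (n := n) (P := P) (Q := fun i => ¬ m.testBit (o + i) = true)
      have h2 := not_congr this
      push Not at h2
      have e : ∀ i, o + 1 + i = o + (i + 1) := fun i => by omega
      simp only [Nat.add_zero] at h2
      simp only [e]
      rw [h2]
      tauto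
    rw [e]
    have := ih (o + 1) (Nat.shiftRight P 1) (by omega)
    have ho' : o < 12 := by omega
    cases h0 : P.testBit 0
    · rw [cond_false, this]; simp
    · rw [cond_true, testBit_lor, Bool.or_eq_true, this, testBit_hasCode]
      simp only [ho', true_and, decide_eq_true_eq]
      tauto

theorem testBit_atLeast_map (ks : List ℕ) (hks : ∀ k ∈ ks, k < 12) (j m : ℕ) :
    (atLeast (ks.map fun k => hasCode k 12) j).testBit m = true ↔
      m < 2 ^ 12 ∧ j ≤ ks.countP (fun k => m.testBit k) := by
  induction ks generalizing j with
  | nil => cases j <;> simp [atLeast, allMasks, testBit_allCode]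
  | cons k ks ih =>
    cases j with
    | zero => simp [atLeast, allMasks, testBit_allCode]
    | succ j =>
      have ih' := ih fun k hk => hks k (List.mem_cons_of_mem _ hk)
      rw [List.map_cons, atLeast, testBit_lor, testBit_land, Bool.or_eq_true, Bool.and_eq_true,
        ih', ih', testBit_hasCode, List.countP_cons]
      have hk : k < 12 := hks k List.mem_cons_self
      cases h : m.testBit k <;> simp [hk]; omega

/-! ### The labels -/

/-- the position of a label in the list of all labels -/
def code (v : Label) : ℕ := 3 * v.1.1 + if v.2.1.1 < v.1.1 then v.2.1.1 else v.2.1.1 - 1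

def rowOf (k : ℕ) : ℕ := k / 3

/-- Row i has no label in column i, so its positions from i onwards are shifted by one. -/
def colOf (k : ℕ) : ℕ := bif Nat.blt (k % 3) (k / 3) then k % 3 else k % 3 + 1

theorem code_lt : ∀ v : Label, code v < 12 := by decide

theorem rowOf_code : ∀ v : Label, rowOf (code v) = v.1.1 := by decide

theorem colOf_code : ∀ v : Label, colOf (code v) = v.2.1.1 := by decide

theorem code_injective : Function.Injective code := by
  rintro ⟨i, j, hj⟩ ⟨i', j', hj'⟩ h
  have h1 := rowOf_code ⟨i, j, hj⟩
  have h2 := colOf_code ⟨i, j, hj⟩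
  rw [h, rowOf_code] at h1
  rw [h, colOf_code] at h2
  obtain rfl : i = i' := Fin.ext h1.symm
  obtain rfl : j = j' := Fin.ext h2.symm
  rfl

theorem exists_code_eq {k : ℕ} (hk : k < 12) : ∃ v : Label, code v = k := by
  have h : Function.Bijective (fun v : Label => (⟨code v, code_lt v⟩ : Fin 12)) := by
    rw [Fintype.bijective_iff_injective_and_card]
    exact ⟨fun v w h => code_injective (congrArg Fin.val h), by simp⟩
  obtain ⟨v, hv⟩ := h.2 ⟨k, hk⟩
  exact ⟨v, congrArg Fin.val hv⟩

theorem code_mem_indices (v : Label) : code v ∈ indices := by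
  have := code_lt v
  simp only [indices, List.mem_cons, List.not_mem_nil, or_false]
  omega

/-- the set of labels with the binary code `m` -/
def maskSet (m : ℕ) : Finset Label := Finset.univ.filter fun v => m.testBit (code v) = true

theorem mem_maskSet {m : ℕ} {v : Label} : v ∈ maskSet m ↔ m.testBit (code v) = true := by
  simp [maskSet]

open scoped Classical in
/-- the binary code of a set of labels -/
noncomputable def mask (σ : Finset Label) : ℕ :=
  Nat.ofBits fun k : Fin 12 => decide (∃ v ∈ σ, code v = k)

theorem mask_lt (σ : Finset Label) : mask σ < 2 ^ 12 := Nat.ofBits_lt_two_pow _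

theorem testBit_mask (σ : Finset Label) (v : Label) :
    (mask σ).testBit (code v) = true ↔ v ∈ σ := by
  rw [mask, Nat.testBit_ofBits_lt _ _ (code_lt v), decide_eq_true_eq]
  constructor
  · rintro ⟨w, hw, h⟩; exact code_injective h ▸ hw
  · exact fun h => ⟨v, h, rfl⟩

theorem maskSet_mask (σ : Finset Label) : maskSet (mask σ) = σ := by
  ext v; rw [mem_maskSet, testBit_mask]

theorem mask_maskSet {m : ℕ} (hm : m < 2 ^ 12) : mask (maskSet m) = m := by
  apply Nat.eq_of_testBit_eq
  intro k
  by_cases hk : k < 12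
  · obtain ⟨v, rfl⟩ := exists_code_eq hk
    rw [Bool.eq_iff_iff, testBit_mask, mem_maskSet]
  · rw [Nat.testBit_lt_two_pow ((mask_lt _).trans_le (Nat.pow_le_pow_right (by omega) (not_lt.mp hk))),
      Nat.testBit_lt_two_pow (hm.trans_le (Nat.pow_le_pow_right (by omega) (not_lt.mp hk)))]

theorem mask_injective : Function.Injective mask := fun σ τ h => by
  rw [← maskSet_mask σ, h, maskSet_mask]

theorem forall_lt_twelve {Q : ℕ → Prop} : (∀ k < 12, Q k) ↔ ∀ v : Label, Q (code v) := by
  constructor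
  · exact fun h v => h _ (code_lt v)
  · intro h k hk
    obtain ⟨v, rfl⟩ := exists_code_eq hk
    exact h v

theorem testBit_allMasks (σ : Finset Label) : allMasks.testBit (mask σ) = true := by
  rw [allMasks, testBit_allCode, decide_eq_true_eq]; exact mask_lt σ

theorem testBit_supersets (P : ℕ) (σ : Finset Label) :
    (supersets hasTable P).testBit (mask σ) = true ↔ maskSet P ⊆ σ := by
  have : hasTable = (List.range' 0 12).map fun k => hasCode k 12 := rfl
  rw [this, testBit_supersets_range 12 0 P _ le_rfl]
  simp only [mask_lt, true_and, Nat.zero_add]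
  rw [forall_lt_twelve (Q := fun k => P.testBit k = true → (mask σ).testBit k = true)]
  simp only [testBit_mask, Finset.subset_iff, mem_maskSet]

theorem testBit_hitting (P : ℕ) (σ : Finset Label) :
    (hitting hasTable P).testBit (mask σ) = true ↔ ∃ v ∈ σ, P.testBit (code v) = true := by
  have : hasTable = (List.range' 0 12).map fun k => hasCode k 12 := rfl
  rw [this, testBit_hitting_range 12 0 P _ le_rfl]
  simp only [mask_lt, true_and, Nat.zero_add]
  constructor
  · rintro ⟨k, hk, h1, h2⟩
    obtain ⟨v, rfl⟩ := exists_code_eq hk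
    exact ⟨v, (testBit_mask σ v).mp h2, h1⟩
  · rintro ⟨v, hv, h1⟩
    exact ⟨code v, code_lt v, h1, (testBit_mask σ v).mpr hv⟩

theorem countP_mask (σ : Finset Label) :
    indices.countP (fun k => (mask σ).testBit k) = σ.card := by
  have h1 : (indices.filter fun k => (mask σ).testBit k).toFinset = σ.image code := by
    ext k
    simp only [List.mem_toFinset, List.mem_filter, Finset.mem_image]
    constructor
    · rintro ⟨hk, h⟩
      have hk' : k < 12 := by
        simp only [indices, List.mem_cons, List.not_mem_nil, or_false] at hk; omega
      obtain ⟨v, rfl⟩ := exists_code_eq hk'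
      exact ⟨v, (testBit_mask σ v).mp h, rfl⟩
    · rintro ⟨v, hv, rfl⟩
      exact ⟨code_mem_indices v, (testBit_mask σ v).mpr hv⟩
  rw [List.countP_eq_length_filter, ← List.toFinset_card_of_nodup
    ((by decide : indices.Nodup).filter _), h1, Finset.card_image_of_injective _ code_injective]

theorem testBit_atLeast (j : ℕ) (σ : Finset Label) :
    (atLeast hasTable j).testBit (mask σ) = true ↔ j ≤ σ.card := by
  rw [hasTable, testBit_atLeast_map _ (by decide), countP_mask, and_iff_right (mask_lt σ)]

/-! ### The circuits of the Cayley configuration -/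

/-- The cycles of the graph `K₄,₄` minus a perfect matching, each with one of its two
orientations: the masks of the even and of the odd edges. -/
def circuitPairs : List (ℕ × ℕ) :=
  [(20, 34), (81, 138), (84, 266), (96, 264), (97, 140), (132, 257), (162, 273), (528, 2056),
    (529, 1034), (545, 1036), (546, 2060), (640, 1088), (642, 2113), (660, 1290), (660, 2145),
    (672, 1288), (674, 2313), (769, 1092), (770, 2116), (784, 2144), (785, 1122), (1026, 2049),
    (1044, 2081), (1104, 2184), (1108, 2313), (1122, 2188), (1282, 2180), (1296, 2208)]

def circuits : List (ℕ × ℕ) := circuitPairs ++ circuitPairs.map Prod.swap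

theorem swap_mem_circuits {z : ℕ × ℕ} (hz : z ∈ circuits) : z.swap ∈ circuits := by
  rw [circuits, List.mem_append] at hz ⊢
  rcases hz with hz | hz
  · exact Or.inr (List.mem_map_of_mem hz)
  · obtain ⟨y, hy, rfl⟩ := List.mem_map.mp hz
    exact Or.inl (by simpa using hy)

def Circuit (P N : Finset Label) : Prop :=
  ∃ z ∈ circuits, P = maskSet z.1 ∧ N = maskSet z.2

theorem circuit_disjoint : ∀ z ∈ circuits, Disjoint (maskSet z.1) (maskSet z.2) := by
  decide +kernel

theorem circuit_nonempty : ∀ z ∈ circuits, (maskSet z.1).Nonempty := by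
  decide +kernel

theorem circuit_column : ∀ z ∈ circuits, ∀ j : Fin 4,
    ((maskSet z.1).filter fun v => v.2.1 = j).card =
      ((maskSet z.2).filter fun v => v.2.1 = j).card := by
  decide +kernel

/-- A cycle passes a row at most once, through one even and one odd edge. The bound by one allows a
circuit to be completed to a point with all row sums one in `conflicts_eq_false`. -/
theorem circuit_row : ∀ z ∈ circuits, ∀ i : Fin 4,
    ((maskSet z.1).filter fun v => v.1 = i).card =
      ((maskSet z.2).filter fun v => v.1 = i).card ∧
    ((maskSet z.1).filter fun v => v.1 = i).card ≤ 1 := by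
  decide +kernel

theorem sum_smul_fst (f : Label → ℝ) (j : Fin 4) :
    (∑ v, f v • cayleyColumns v).1 j = ∑ v, if v.2.1 = j then f v else 0 := by
  rw [Prod.fst_sum, Finset.sum_apply]
  refine Finset.sum_congr rfl fun v _ => ?_
  simp [cayleyColumns, cayleyConfig, facetTriangle, Pi.single_apply, eq_comm]

theorem sum_smul_snd (f : Label → ℝ) (i : Fin 4) :
    (∑ v, f v • cayleyColumns v).2 i = ∑ v, if v.1 = i then f v else 0 := by
  rw [Prod.snd_sum, Finset.sum_apply]
  refine Finset.sum_congr rfl fun v _ => ?_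
  simp [cayleyColumns, cayleyConfig, Pi.single_apply, eq_comm]

theorem sum_smul_eq_iff (f g : Label → ℝ) :
    ∑ v, f v • cayleyColumns v = ∑ v, g v • cayleyColumns v ↔
      (∀ j : Fin 4, (∑ v, if v.2.1 = j then f v else 0) = ∑ v, if v.2.1 = j then g v else 0) ∧
      ∀ i : Fin 4, (∑ v, if v.1 = i then f v else 0) = ∑ v, if v.1 = i then g v else 0 := by
  simp only [← sum_smul_fst, ← sum_smul_snd]
  constructor
  · intro h; simp [h]
  · rintro ⟨h1, h2⟩
    exact Prod.ext (funext h1) (funext h2)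

theorem sum_ite_indicator (P : Finset Label) (q : Label → Prop) [DecidablePred q] :
    (∑ v, if q v then (if v ∈ P then (1 : ℝ) else 0) else 0) = (P.filter q).card := by
  rw [Finset.card_eq_sum_ones, Nat.cast_sum, Finset.sum_filter]
  simp only [Nat.cast_one]
  rw [← Finset.sum_subset (Finset.subset_univ P) (fun v _ hv => by simp [hv])]
  exact Finset.sum_congr rfl fun v hv => by simp [hv]

/-- Does one of the circuits have its even edges in `P` and its odd edges in `N`? -/
def hasCircuit (P N : ℕ) : Bool :=
  foldR (fun z acc => bif Nat.beq (Nat.land z.1 P) z.1 && Nat.beq (Nat.land z.2 N) z.2 then true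
    else acc) false circuits

/-- Walk along edges of alternating signs until a cycle is found. The positive edges in `P` and
the negative edges in `N` have been visited, the last one is `k`. -/
def walk : ℕ → ℕ → ℕ → Bool → ℕ → Bool
  | 0, P, N, _, _ => hasCircuit P N
  | n + 1, P, N, true, k => hasCircuit P N || allR (fun l =>
      bif Nat.beq (colOf l) (colOf k) && !bit P l then walk n P (Nat.lor N (Nat.shiftLeft 1 l)) false l
      else true) indices
  | n + 1, P, N, false, k => hasCircuit P N || allR (fun l =>
      bif Nat.beq (rowOf l) (rowOf k) && !bit N l then walk n (Nat.lor P (Nat.shiftLeft 1 l)) N true l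
      else true) indices

/-- Consecutive edges of the walk differ, and on eight vertices some vertex is met twice within
eight edges. The cycle closed in this way alternates in sign, because positive edges are traversed
from row to column and negative ones from column to row. So fuel 9 is enough. -/
theorem walk_check : allR (fun k => walk 9 (Nat.shiftLeft 1 k) 0 true k) indices = true := by
  decide +kernel

theorem maskSet_subset_of_land {z P : ℕ} (h : Nat.beq (Nat.land z P) z = true) :
    maskSet z ⊆ maskSet P := by
  intro v hv
  rw [mem_maskSet] at hv ⊢
  rw [← Nat.eq_of_beq_eq_true h, testBit_land, Bool.and_eq_true] at hv
  exact hv.2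

theorem exists_of_hasCircuit {P N : ℕ} (h : hasCircuit P N = true) :
    ∃ z ∈ circuits, maskSet z.1 ⊆ maskSet P ∧ maskSet z.2 ⊆ maskSet N := by
  unfold hasCircuit at h
  generalize circuits = l at h ⊢
  induction l with
  | nil => exact absurd h (by simp)
  | cons z l ih =>
    rw [foldR_cons] at h
    cases h1 : Nat.beq (Nat.land z.1 P) z.1 && Nat.beq (Nat.land z.2 N) z.2
    · rw [h1, cond_false] at h
      obtain ⟨y, hy, h⟩ := ih h
      exact ⟨y, List.mem_cons_of_mem _ hy, h⟩
    · rw [Bool.and_eq_true] at h1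
      exact ⟨z, List.mem_cons_self, maskSet_subset_of_land h1.1, maskSet_subset_of_land h1.2⟩

theorem maskSet_lor_single (m : ℕ) (v : Label) :
    maskSet (Nat.lor m (Nat.shiftLeft 1 (code v))) = insert v (maskSet m) := by
  ext w
  rw [mem_maskSet, testBit_lor, testBit_one_shiftLeft, Finset.mem_insert, mem_maskSet,
    Bool.or_eq_true, decide_eq_true_eq, or_comm, code_injective.eq_iff]

theorem exists_neg_of_sum {ι : Type*} [Fintype ι] {x : ι → ℝ} {q : ι → Prop} [DecidablePred q]
    (hx : (∑ v, if q v then x v else 0) = 0) {v : ι} (hv : q v) (hpos : 0 < x v) :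
    ∃ w, q w ∧ x w < 0 := by
  by_contra! h
  have : 0 < ∑ v, if q v then x v else 0 := by
    refine Finset.sum_pos' (fun w _ => ?_) ⟨v, Finset.mem_univ v, by simpa [hv] using hpos⟩
    split_ifs with hw
    · exact h w hw
    · exact le_rfl
  linarith

theorem exists_pos_of_sum {ι : Type*} [Fintype ι] {x : ι → ℝ} {q : ι → Prop} [DecidablePred q]
    (hx : (∑ v, if q v then x v else 0) = 0) {v : ι} (hv : q v) (hneg : x v < 0) :
    ∃ w, q w ∧ 0 < x w := by
  have h : (∑ v, if q v then (-x) v else 0) = -∑ v, if q v then x v else 0 := by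
    rw [← Finset.sum_neg_distrib]
    exact Finset.sum_congr rfl fun v _ => by split_ifs <;> simp
  obtain ⟨w, hw, h⟩ := exists_neg_of_sum (x := -x) (by rw [h, hx, neg_zero]) hv
    (by simpa using hneg)
  exact ⟨w, hw, by simpa using h⟩

/-- The relation x steers one of the walks: at a positive edge the vanishing column sum supplies a
negative edge of that column, and at a negative edge the vanishing row sum supplies a positive edge
of that row. -/
theorem exists_circuit_of_walk {x : Label → ℝ}
    (hcol : ∀ j : Fin 4, (∑ v, if v.2.1 = j then x v else 0) = 0)
    (hrow : ∀ i : Fin 4, (∑ v, if v.1 = i then x v else 0) = 0) (n P N : ℕ) (s : Bool) (k : Label)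
    (hP : ∀ v ∈ maskSet P, 0 < x v) (hN : ∀ v ∈ maskSet N, x v < 0)
    (hk : if s then 0 < x k else x k < 0) (hw : walk n P N s (code k) = true) :
    ∃ z ∈ circuits, (∀ v ∈ maskSet z.1, 0 < x v) ∧ ∀ v ∈ maskSet z.2, x v < 0 := by
  have found : ∀ {P N : ℕ}, (∀ v ∈ maskSet P, 0 < x v) → (∀ v ∈ maskSet N, x v < 0) →
      hasCircuit P N = true →
      ∃ z ∈ circuits, (∀ v ∈ maskSet z.1, 0 < x v) ∧ ∀ v ∈ maskSet z.2, x v < 0 := by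
    intro P N hP hN h
    obtain ⟨z, hz, h1, h2⟩ := exists_of_hasCircuit h
    exact ⟨z, hz, fun v hv => hP v (h1 hv), fun v hv => hN v (h2 hv)⟩
  induction n generalizing P N s k with
  | zero => exact found hP hN hw
  | succ n ih =>
    cases s
    · rw [walk, Bool.or_eq_true] at hw
      rcases hw with hw | hw
      · exact found hP hN hw
      · rw [if_neg (by simp)] at hk
        obtain ⟨l, hl, hxl⟩ := exists_pos_of_sum (q := fun v : Label => v.1 = k.1) (hrow k.1) rfl
          (by simpa using hk)
        have h1 := allR_eq_true.mp hw (code l) (code_mem_indices l)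
        have h2 : Nat.beq (rowOf (code l)) (rowOf (code k)) = true := by
          rw [rowOf_code, rowOf_code, hl]; simp
        have h3 : bit N (code l) = false := by
          rw [bit_eq, Bool.eq_false_iff]
          intro h
          exact absurd (hN l (mem_maskSet.mpr h)) (not_lt.mpr hxl.le)
        rw [h2, h3] at h1
        refine ih _ N true l (fun v hv => ?_) hN (by simpa using hxl) h1
        rw [maskSet_lor_single, Finset.mem_insert] at hv
        rcases hv with rfl | hv
        · exact hxl
        · exact hP v hv
    · rw [walk, Bool.or_eq_true] at hw
      rcases hw with hw | hw
      · exact found hP hN hw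
      · rw [if_pos rfl] at hk
        obtain ⟨l, hl, hxl⟩ := exists_neg_of_sum (q := fun v => v.2.1 = k.2.1) (hcol k.2.1) rfl hk
        have h1 := allR_eq_true.mp hw (code l) (code_mem_indices l)
        have h2 : Nat.beq (colOf (code l)) (colOf (code k)) = true := by
          rw [colOf_code, colOf_code, hl]; simp
        have h3 : bit P (code l) = false := by
          rw [bit_eq, Bool.eq_false_iff]
          intro h
          exact absurd (hP l (mem_maskSet.mpr h)) (not_lt.mpr hxl.le)
        rw [h2, h3] at h1
        refine ih P _ false l hP (fun v hv => ?_) (by simpa using hxl) h1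
        rw [maskSet_lor_single, Finset.mem_insert] at hv
        rcases hv with rfl | hv
        · exact hxl
        · exact hN v hv

theorem isCircuitSystem : IsCircuitSystem cayleyColumns Circuit where
  sum_eq := by
    rintro _ _ ⟨z, hz, rfl, rfl⟩
    rw [← IsCircuitSystem.sum_indicator _ (maskSet z.1), ← IsCircuitSystem.sum_indicator _ (maskSet z.2),
      sum_smul_eq_iff]
    refine ⟨fun j => ?_, fun i => ?_⟩
    · rw [sum_ite_indicator, sum_ite_indicator, circuit_column z hz]
    · rw [sum_ite_indicator, sum_ite_indicator, (circuit_row z hz i).1]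
  disjoint := by
    rintro _ _ ⟨z, hz, rfl, rfl⟩
    exact circuit_disjoint z hz
  nonempty := by
    rintro _ _ ⟨z, hz, rfl, rfl⟩
    exact circuit_nonempty z hz
  exists_conformal := by
    intro x hx hne
    have h0 := (sum_smul_eq_iff x 0).mp (by simpa using hx)
    simp only [Pi.zero_apply, ite_self, Finset.sum_const_zero] at h0
    obtain ⟨hcol, hrow⟩ := h0
    obtain ⟨v, hv⟩ : ∃ v, 0 < x v := by
      obtain ⟨v, hv⟩ := Function.ne_iff.mp hne
      rcases lt_or_gt_of_ne hv with h | h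
      · obtain ⟨w, -, hw⟩ := exists_pos_of_sum (q := fun w : Label => w.1 = v.1) (hrow v.1) rfl h
        exact ⟨w, hw⟩
      · exact ⟨v, h⟩
    have hs : maskSet (Nat.shiftLeft 1 (code v)) = {v} := by
      ext w
      rw [mem_maskSet, testBit_one_shiftLeft, decide_eq_true_eq, code_injective.eq_iff,
        Finset.mem_singleton]
    obtain ⟨z, hz, h⟩ := exists_circuit_of_walk hcol hrow 9 _ 0 true v
      (by rw [hs]; simpa using hv) (by simp [maskSet]) (by simpa using hv)
      (allR_eq_true.mp walk_check _ (code_mem_indices v))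
    exact ⟨_, _, ⟨z, hz, rfl, rfl⟩, h⟩
  height := by
    refine ⟨(∑ i, LinearMap.proj i) ∘ₗ LinearMap.snd ℝ (Fin 4 → ℝ) (Fin 4 → ℝ), fun v => ?_⟩
    simp [cayleyColumns, cayleyConfig]

/-! ### Trees -/

/-- the code of the family of all spanning trees -/
def treeCode (hs : List ℕ) : ℕ :=
  foldR (fun z acc => diff acc (supersets hs (Nat.lor z.1 z.2))) (atLeast hs 7) circuits

theorem testBit_foldR_diff (l : List (ℕ × ℕ)) (x m : ℕ) (F : ℕ × ℕ → ℕ) :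
    (foldR (fun z acc => diff acc (F z)) x l).testBit m = true ↔
      x.testBit m = true ∧ ∀ z ∈ l, (F z).testBit m = false := by
  induction l with
  | nil => simp
  | cons z l ih =>
    rw [foldR_cons, testBit_diff, Bool.and_eq_true, ih]
    simp only [Bool.not_eq_true', List.mem_cons, forall_eq_or_imp]
    tauto

theorem maskSet_lor (a b : ℕ) : maskSet (Nat.lor a b) = maskSet a ∪ maskSet b := by
  ext v; rw [Finset.mem_union, mem_maskSet, mem_maskSet, mem_maskSet, testBit_lor, Bool.or_eq_true]

theorem testBit_treeCode (σ : Finset Label) :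
    (treeCode hasTable).testBit (mask σ) = true ↔ 7 ≤ σ.card ∧ CircuitFree Circuit σ := by
  rw [treeCode, testBit_foldR_diff _ _ _ fun z => supersets hasTable (Nat.lor z.1 z.2),
    testBit_atLeast]
  refine and_congr_right fun _ => ?_
  simp only [← Bool.not_eq_true, testBit_supersets, maskSet_lor, Finset.union_subset_iff]
  constructor
  · rintro h _ _ ⟨z, hz, rfl, rfl⟩
    exact h z hz
  · exact fun h z hz => h _ _ ⟨z, hz, rfl, rfl⟩

end TruncatedTetrahedron

/-! ### The Cayley trick: Minkowski cells as slices of Cayley simplices -/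

section CayleyTrick

variable {κ E : Type*} {ι : κ → Type*} [Fintype κ] [∀ i, Fintype (ι i)]
  [DecidableEq (Σ i, ι i)] [AddCommGroup E] [Module ℝ E]

omit [Fintype κ] in
theorem mem_cayleyCell {σ : Finset (Σ i, ι i)} {i : κ} {a : ι i} :
    a ∈ cayleyCell σ i ↔ (⟨i, a⟩ : Σ i, ι i) ∈ σ := by
  simp [cayleyCell]

omit [Fintype κ] in
theorem cayleyCell_injective :
    Function.Injective (cayleyCell : Finset (Σ i, ι i) → (i : κ) → Finset (ι i)) := by
  intro σ τ h
  ext ⟨i, a⟩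
  rw [← mem_cayleyCell, h, mem_cayleyCell]

theorem cayleyCell_surjective :
    Function.Surjective (cayleyCell : Finset (Σ i, ι i) → (i : κ) → Finset (ι i)) := by
  intro B
  classical
  refine ⟨Finset.univ.filter fun v => v.2 ∈ B v.1, ?_⟩
  funext i
  ext a
  rw [mem_cayleyCell]
  simp

omit [Fintype κ] in
theorem cayleyCell_inter [∀ i, DecidableEq (ι i)] (σ τ : Finset (Σ i, ι i)) :
    (fun i => cayleyCell σ i ∩ cayleyCell τ i) = cayleyCell (σ ∩ τ) := by
  funext i
  ext a
  simp [mem_cayleyCell]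

theorem sum_card_cayleyCell (σ : Finset (Σ i, ι i)) :
    ∑ i, (cayleyCell σ i).card = σ.card := by
  classical
  rw [← Finset.card_sigma]
  congr 1
  ext ⟨i, a⟩
  simp [mem_cayleyCell]

/-- Points of a Minkowski cell are given by weights on the labels. -/
theorem mem_minkowskiCell_iff (q : (i : κ) → ι i → E) (σ : Finset (Σ i, ι i)) (x : E) :
    x ∈ minkowskiCell q (cayleyCell σ) ↔ ∃ f : (Σ i, ι i) → ℝ, (∀ v, 0 ≤ f v) ∧
      (∀ v ∉ σ, f v = 0) ∧ (∀ i, ∑ a, f ⟨i, a⟩ = 1) ∧ ∑ v : Σ i, ι i, f v • q v.1 v.2 = x := by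
  classical
  rw [minkowskiCell, Set.mem_fintype_sum]
  simp only [mem_convexHull_image_iff]
  constructor
  · rintro ⟨g, hg, rfl⟩
    choose f hf0 hfσ hf1 hfs using hg
    refine ⟨fun v => f v.1 v.2, fun v => hf0 _ _, ?_, hf1, ?_⟩
    · rintro ⟨i, a⟩ hv
      exact hfσ i a fun h => hv (mem_cayleyCell.mp h)
    · rw [Fintype.sum_sigma]
      exact Finset.sum_congr rfl fun i _ => hfs i
  · rintro ⟨f, hf0, hfσ, hf1, rfl⟩
    refine ⟨fun i => ∑ a, f ⟨i, a⟩ • q i a, fun i => ⟨fun a => f ⟨i, a⟩, fun a => hf0 _,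
      fun a ha => hfσ _ fun h => ha (mem_cayleyCell.mpr h), hf1 i, rfl⟩, ?_⟩
    rw [Fintype.sum_sigma]

theorem minkowskiSum_eq (q : (i : κ) → ι i → E) :
    minkowskiSum q = minkowskiCell q (cayleyCell Finset.univ) := by
  have : ∀ i, ((cayleyCell (Finset.univ : Finset (Σ i, ι i)) i : Finset (ι i)) : Set (ι i)) =
      Set.univ := fun i => by ext a; simp [mem_cayleyCell]
  simp only [minkowskiSum, minkowskiCell, this, Set.image_univ]

variable [DecidableEq κ]

omit [DecidableEq (Σ i, ι i)] in
theorem sum_smul_cayleyConfig (q : (i : κ) → ι i → E) (f : (Σ i, ι i) → ℝ) :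
    ∑ v, f v • cayleyConfig q v = (∑ v, f v • q v.1 v.2, fun i => ∑ a, f ⟨i, a⟩) := by
  refine Prod.ext ?_ (funext fun i => ?_)
  · rw [Prod.fst_sum]; rfl
  · rw [Prod.snd_sum, Finset.sum_apply, Fintype.sum_sigma,
      Finset.sum_eq_single i _ (fun h => absurd (Finset.mem_univ i) h)]
    · exact Finset.sum_congr rfl fun a _ => by simp [cayleyConfig]
    · intro j _ hj
      refine Finset.sum_eq_zero fun a _ => ?_
      simp [cayleyConfig, Ne.symm hj]

/-- A Minkowski cell is a slice of the cone over the corresponding set of the Cayley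
configuration. -/
theorem mem_minkowskiCell_iff_sum (q : (i : κ) → ι i → E) (σ : Finset (Σ i, ι i)) (x : E) :
    x ∈ minkowskiCell q (cayleyCell σ) ↔ ∃ f : (Σ i, ι i) → ℝ, (∀ v, 0 ≤ f v) ∧
      (∀ v ∉ σ, f v = 0) ∧ ∑ v, f v • cayleyConfig q v = (x, fun _ => 1) := by
  rw [mem_minkowskiCell_iff]
  refine exists_congr fun f => and_congr_right fun _ => and_congr_right fun _ => ?_
  rw [sum_smul_cayleyConfig, Prod.mk.injEq, funext_iff, and_comm]

/-- Dividing by the number of summands turns weights with sum one in every summand into weights with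
total sum one. -/
theorem mem_minkowskiCell_iff_slice [Nonempty κ] (q : (i : κ) → ι i → E)
    (σ : Finset (Σ i, ι i)) (x : E) :
    x ∈ minkowskiCell q (cayleyCell σ) ↔ (Fintype.card κ : ℝ)⁻¹ • ((x, fun _ => 1) : E × (κ → ℝ)) ∈
      convexHull ℝ (cayleyConfig q '' (σ : Set (Σ i, ι i))) := by
  rw [mem_minkowskiCell_iff_sum, mem_convexHull_image_iff]
  have hn : (0 : ℝ) < Fintype.card κ := by exact_mod_cast Fintype.card_pos
  constructor
  · rintro ⟨f, hf0, hfσ, hf⟩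
    refine ⟨fun v => (Fintype.card κ : ℝ)⁻¹ * f v, fun v => mul_nonneg (by positivity) (hf0 v),
      fun v hv => by simp [hfσ v hv], ?_, ?_⟩
    · rw [sum_smul_cayleyConfig, Prod.mk.injEq, funext_iff] at hf
      rw [← Finset.mul_sum, Fintype.sum_sigma, Finset.sum_congr rfl fun i _ => hf.2 i]
      simp [hn.ne']
    · simp only [mul_smul, ← Finset.smul_sum, hf]
  · rintro ⟨f, hf0, hfσ, -, hf⟩
    refine ⟨fun v => (Fintype.card κ : ℝ) * f v, fun v => mul_nonneg hn.le (hf0 v),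
      fun v hv => by simp [hfσ v hv], ?_⟩
    simp only [mul_smul, ← Finset.smul_sum, hf, smul_inv_smul₀ hn.ne']

/-- The span of the differences of points of `σ` with the same summand. -/
def edgeSpan (q : (i : κ) → ι i → E) (σ : Finset (Σ i, ι i)) : Submodule ℝ E :=
  Submodule.span ℝ {y | ∃ v ∈ σ, ∃ w ∈ σ, v.1 = w.1 ∧ y = q v.1 v.2 - q w.1 w.2}

omit [DecidableEq κ] in
theorem sum_sub_mem_edgeSpan (q : (i : κ) → ι i → E) {σ : Finset (Σ i, ι i)} {b : (i : κ) → ι i}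
    (hb : ∀ i, (⟨i, b i⟩ : Σ i, ι i) ∈ σ) {f : (Σ i, ι i) → ℝ} (hf : ∀ v ∉ σ, f v = 0) :
    ∑ v : Σ i, ι i, f v • q v.1 v.2 - ∑ i, (∑ a, f ⟨i, a⟩) • q i (b i) ∈ edgeSpan q σ := by
  have : ∑ v : Σ i, ι i, f v • q v.1 v.2 - ∑ i, (∑ a, f ⟨i, a⟩) • q i (b i) =
      ∑ v : Σ i, ι i, f v • (q v.1 v.2 - q v.1 (b v.1)) := by
    simp only [smul_sub, Finset.sum_sub_distrib, Fintype.sum_sigma, Finset.sum_smul]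
  rw [this]
  refine Submodule.sum_mem _ fun v _ => ?_
  by_cases hv : v ∈ σ
  · exact Submodule.smul_mem _ _ (Submodule.subset_span ⟨v, hv, ⟨v.1, b v.1⟩, hb _, rfl, rfl⟩)
  · rw [hf v hv, zero_smul]; exact Submodule.zero_mem _

/-- Together with `affineSpan_cayleyConfig_eq_iff` this makes full dimension of a Minkowski cell and
of its Cayley simplex the same condition on `edgeSpan`. -/
theorem vectorSpan_minkowskiCell (q : (i : κ) → ι i → E) {σ : Finset (Σ i, ι i)}
    (hne : ∀ i, (cayleyCell σ i).Nonempty) :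
    vectorSpan ℝ (minkowskiCell q (cayleyCell σ)) = edgeSpan q σ := by
  choose b hb' using hne
  have hb : ∀ i, (⟨i, b i⟩ : Σ i, ι i) ∈ σ := fun i => mem_cayleyCell.mp (hb' i)
  apply le_antisymm
  · rw [vectorSpan_def, Submodule.span_le]
    rintro _ ⟨x, hx, y, hy, rfl⟩
    rw [mem_minkowskiCell_iff] at hx hy
    obtain ⟨f, -, hfσ, hf1, rfl⟩ := hx
    obtain ⟨g, -, hgσ, hg1, rfl⟩ := hy
    have h1 := sum_sub_mem_edgeSpan q hb hfσ
    have h2 := sum_sub_mem_edgeSpan q hb hgσ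
    simp only [hf1, hg1] at h1 h2
    have := Submodule.sub_mem _ h1 h2
    rw [sub_sub_sub_cancel_right] at this
    exact this
  · rw [edgeSpan, Submodule.span_le]
    rintro _ ⟨⟨i, a⟩, hv, ⟨j, c⟩, hw, h, rfl⟩
    obtain rfl : i = j := h
    -- A difference within summand i is the difference of two points of the cell that agree in all
    -- other summands.
    have key : ∀ a : ι i, (⟨i, a⟩ : Σ i, ι i) ∈ σ →
        ∑ j, Function.update (fun j => q j (b j)) i (q i a) j ∈ minkowskiCell q (cayleyCell σ) := by
      intro a ha
      rw [minkowskiCell, Set.mem_fintype_sum]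
      refine ⟨_, fun j => ?_, rfl⟩
      apply subset_convexHull
      by_cases hj : j = i
      · subst hj
        rw [Function.update_self]
        exact ⟨a, mem_cayleyCell.mpr ha, rfl⟩
      · rw [Function.update_of_ne hj]
        exact ⟨b j, hb' j, rfl⟩
    have := vsub_mem_vectorSpan ℝ (key a hv) (key c hw)
    rw [Finset.sum_update_of_mem (Finset.mem_univ i),
      Finset.sum_update_of_mem (Finset.mem_univ i), vsub_eq_sub, add_sub_add_right_eq_sub] at this
    exact this

theorem affineSpan_cayleyConfig_eq_iff (q : (i : κ) → ι i → E) {σ : Finset (Σ i, ι i)}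
    (hne : ∀ i, (cayleyCell σ i).Nonempty) :
    affineSpan ℝ (cayleyConfig q '' (σ : Set (Σ i, ι i))) =
        affineSpan ℝ (Set.range (cayleyConfig q)) ↔
      edgeSpan q σ = edgeSpan q Finset.univ := by
  choose b hb' using hne
  have hb : ∀ i, (⟨i, b i⟩ : Σ i, ι i) ∈ σ := fun i => mem_cayleyCell.mp (hb' i)
  have hmono : edgeSpan q σ ≤ edgeSpan q Finset.univ :=
    Submodule.span_mono fun _ ⟨v, _, w, _, h⟩ => ⟨v, Finset.mem_univ v, w, Finset.mem_univ w, h⟩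
  constructor
  · intro h
    refine le_antisymm hmono ?_
    rw [edgeSpan, Submodule.span_le]
    rintro _ ⟨v, -, w, -, hvw, rfl⟩
    obtain ⟨f, hfσ, hf⟩ := IsCircuitSystem.exists_relation (p := cayleyConfig q) (σ := σ)
      (x := cayleyConfig q v) (h ▸ subset_affineSpan ℝ _ ⟨v, rfl⟩)
    obtain ⟨g, hgσ, hg⟩ := IsCircuitSystem.exists_relation (p := cayleyConfig q) (σ := σ)
      (x := cayleyConfig q w) (h ▸ subset_affineSpan ℝ _ ⟨w, rfl⟩)
    rw [sum_smul_cayleyConfig, cayleyConfig, Prod.mk.injEq] at hf hg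
    have h1 := sum_sub_mem_edgeSpan q hb hfσ
    have h2 := sum_sub_mem_edgeSpan q hb hgσ
    have h3 : ∀ i, ∑ a, f ⟨i, a⟩ = ∑ a, g ⟨i, a⟩ := congrFun (by rw [hf.2, hg.2, hvw])
    simp only [h3] at h1
    have := Submodule.sub_mem _ h1 h2
    rw [sub_sub_sub_cancel_right, hf.1, hg.1] at this
    exact this
  · intro h
    refine le_antisymm (affineSpan_mono ℝ (Set.image_subset_range _ _)) ?_
    rw [affineSpan_le]
    rintro _ ⟨v, rfl⟩
    have hdir : ∀ y ∈ edgeSpan q σ, ((y, 0) : E × (κ → ℝ)) ∈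
        (affineSpan ℝ (cayleyConfig q '' (σ : Set (Σ i, ι i)))).direction := by
      intro y hy
      have hle : edgeSpan q σ ≤ Submodule.comap (LinearMap.inl ℝ E (κ → ℝ))
          (affineSpan ℝ (cayleyConfig q '' (σ : Set (Σ i, ι i)))).direction := by
        rw [edgeSpan, Submodule.span_le]
        rintro _ ⟨v, hv, w, hw, hvw, rfl⟩
        have : ((q v.1 v.2 - q w.1 w.2, 0) : E × (κ → ℝ)) =
            cayleyConfig q v -ᵥ cayleyConfig q w := by
          simp [cayleyConfig, hvw]
        rw [SetLike.mem_coe, Submodule.mem_comap, LinearMap.inl_apply, this, direction_affineSpan]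
        exact vsub_mem_vectorSpan ℝ ⟨v, hv, rfl⟩ ⟨w, hw, rfl⟩
      exact hle hy
    have h1 := hdir (q v.1 v.2 - q v.1 (b v.1)) (h ▸ Submodule.subset_span
      ⟨v, Finset.mem_univ v, ⟨v.1, b v.1⟩, Finset.mem_univ _, rfl, rfl⟩)
    have h2 := AffineSubspace.vadd_mem_of_mem_direction h1
      (mem_affineSpan ℝ ⟨(⟨v.1, b v.1⟩ : Σ i, ι i), hb v.1, rfl⟩)
    convert h2 using 1
    simp [cayleyConfig]

/-- If summand i had no label in σ, coordinate i of the second factor would vanish on the span of σ.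
-/
theorem nonempty_of_affineSpan_eq (q : (i : κ) → ι i → E) [∀ i, Nonempty (ι i)]
    {σ : Finset (Σ i, ι i)}
    (h : affineSpan ℝ (cayleyConfig q '' (σ : Set (Σ i, ι i))) =
      affineSpan ℝ (Set.range (cayleyConfig q))) (i : κ) : (cayleyCell σ i).Nonempty := by
  by_contra hne
  rw [Finset.not_nonempty_iff_eq_empty] at hne
  obtain ⟨a⟩ := ‹∀ i, Nonempty (ι i)› i
  obtain ⟨f, hfσ, hf⟩ := IsCircuitSystem.exists_relation (p := cayleyConfig q) (σ := σ)
    (x := cayleyConfig q ⟨i, a⟩) (h ▸ subset_affineSpan ℝ _ ⟨_, rfl⟩)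
  rw [sum_smul_cayleyConfig, cayleyConfig, Prod.mk.injEq] at hf
  have := congrFun hf.2 i
  rw [Finset.sum_eq_zero fun c _ => hfσ _ fun hc => by
    have := mem_cayleyCell.mpr hc
    rw [hne] at this
    simp at this] at this
  simp at this

end CayleyTrick

namespace TruncatedTetrahedron

/-! ### Dimensions -/

theorem finrank_ker_sum :
    Module.finrank ℝ (LinearMap.ker (∑ i, LinearMap.proj i : (Fin 4 → ℝ) →ₗ[ℝ] ℝ)) = 3 := by
  have hne : (∑ i, LinearMap.proj i : (Fin 4 → ℝ) →ₗ[ℝ] ℝ) ≠ 0 := by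
    intro h
    have := LinearMap.congr_fun h (fun _ => 1)
    simp at this
  have := Module.Dual.finrank_ker_add_one_of_ne_zero hne
  rw [Module.finrank_fintype_fun_eq_card, Fintype.card_fin] at this
  omega

theorem edgeSpan_facetTriangle : edgeSpan facetTriangle Finset.univ =
    LinearMap.ker (∑ i, LinearMap.proj i : (Fin 4 → ℝ) →ₗ[ℝ] ℝ) := by
  apply le_antisymm
  · rw [edgeSpan, Submodule.span_le]
    rintro _ ⟨v, -, w, -, -, rfl⟩
    simp [facetTriangle]
  · intro x hx
    have h0 : ∑ i, x i = 0 := by simpa using hx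
    have key : x = ∑ j, x j • (Pi.single j 1 - Pi.single 0 1 : Fin 4 → ℝ) := by
      simp only [smul_sub, Finset.sum_sub_distrib, ← Finset.sum_smul, h0, zero_smul, sub_zero]
      simp [← Pi.single_smul, Finset.univ_sum_single]
    rw [key]
    refine Submodule.sum_mem _ fun j _ => Submodule.smul_mem _ _ (Submodule.subset_span ?_)
    -- Some facet contains both vertices j and 0, so their difference occurs within a single
    -- summand.
    have h2 : ∀ j : Fin 4, ∃ i : Fin 4, j ≠ i ∧ 0 ≠ i := by decide
    obtain ⟨i, hj, hi⟩ := h2 j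
    exact ⟨⟨i, j, hj⟩, Finset.mem_univ _, ⟨i, 0, hi⟩, Finset.mem_univ _, rfl, rfl⟩

theorem finrank_edgeSpan : Module.finrank ℝ (edgeSpan facetTriangle Finset.univ) = 3 := by
  rw [edgeSpan_facetTriangle, finrank_ker_sum]

instance nonempty_facet (i : Fin 4) : Nonempty {j : Fin 4 // j ≠ i} := by
  have : ∀ i : Fin 4, ∃ j : Fin 4, j ≠ i := by decide
  obtain ⟨j, hj⟩ := this i
  exact ⟨⟨j, hj⟩⟩

theorem cayleyCell_univ_nonempty (i : Fin 4) :
    (cayleyCell (Finset.univ : Finset Label) i).Nonempty := by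
  obtain ⟨a⟩ := nonempty_facet i
  exact ⟨a, by rw [mem_cayleyCell]; exact Finset.mem_univ _⟩

theorem vectorSpan_minkowskiSum :
    vectorSpan ℝ (minkowskiSum facetTriangle) = edgeSpan facetTriangle Finset.univ := by
  rw [minkowskiSum_eq, vectorSpan_minkowskiCell _ cayleyCell_univ_nonempty]

theorem finrank_minkowskiSum :
    Module.finrank ℝ (vectorSpan ℝ (minkowskiSum facetTriangle)) = 3 := by
  rw [vectorSpan_minkowskiSum, finrank_edgeSpan]

/-- The coordinate sums of both factors are constant on the points, so differences lie in a product
of two three-dimensional kernels. -/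
theorem finrank_vectorSpan_le : Module.finrank ℝ (vectorSpan ℝ (Set.range cayleyColumns)) ≤ 6 := by
  let s : (Fin 4 → ℝ) →ₗ[ℝ] ℝ := ∑ i, LinearMap.proj i
  let F : LinearMap.ker s × LinearMap.ker s →ₗ[ℝ] (Fin 4 → ℝ) × (Fin 4 → ℝ) :=
    (LinearMap.ker s).subtype.prodMap (LinearMap.ker s).subtype
  have hle : vectorSpan ℝ (Set.range cayleyColumns) ≤ LinearMap.range F := by
    rw [vectorSpan_def, Submodule.span_le]
    rintro _ ⟨_, ⟨v, rfl⟩, _, ⟨w, rfl⟩, rfl⟩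
    have hs : ∀ i j : Fin 4, (Pi.single i 1 - Pi.single j 1 : Fin 4 → ℝ) ∈ LinearMap.ker s := by
      simp [s]
    exact ⟨(⟨_, hs v.2.1 w.2.1⟩, ⟨_, hs v.1 w.1⟩), rfl⟩
  refine (Submodule.finrank_mono hle).trans ((LinearMap.finrank_range_le F).trans ?_)
  rw [Module.finrank_prod, finrank_ker_sum]

/-- the spanning trees of the graph, which are the maximal simplices -/
def IsTree (σ : Finset Label) : Prop := σ.card = 7 ∧ CircuitFree Circuit σ

theorem finrank_of_free {σ : Finset Label} (hσ : CircuitFree Circuit σ) (hne : σ.Nonempty) :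
    Module.finrank ℝ (vectorSpan ℝ (cayleyColumns '' (σ : Set Label))) + 1 = σ.card := by
  have h := (isCircuitSystem.free_iff_affineIndependent σ).mp hσ
  have h1 : Fintype.card σ = (σ.card - 1) + 1 := by
    have := hne.card_pos
    rw [Fintype.card_coe]; omega
  have h2 := h.finrank_vectorSpan h1
  have h3 : Set.range (fun v : σ => cayleyColumns v) = cayleyColumns '' (σ : Set Label) := by
    rw [Set.image_eq_range]; rfl
  rw [h3] at h2
  have := hne.card_pos
  omega

theorem card_le_of_free {σ : Finset Label} (hσ : CircuitFree Circuit σ) : σ.card ≤ 7 := by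
  rcases σ.eq_empty_or_nonempty with rfl | hne
  · simp
  · rw [← finrank_of_free hσ hne]
    have := Submodule.finrank_mono (vectorSpan_mono ℝ (Set.image_subset_range cayleyColumns σ))
    have := finrank_vectorSpan_le
    omega

theorem testBit_treeCode_mask (σ : Finset Label) :
    (treeCode hasTable).testBit (mask σ) = true ↔ IsTree σ := by
  rw [testBit_treeCode, IsTree]
  exact and_congr_left fun h => ⟨fun h7 => (card_le_of_free h).antisymm h7, fun h7 => h7.ge⟩

/-- One explicit spanning tree, with the labels at positions 0 to 4, 6 and 9, bounds the dimension
from below. -/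
theorem treeCode_example : bit (treeCode hasTable) 607 = true := by decide +kernel

theorem finrank_vectorSpan : Module.finrank ℝ (vectorSpan ℝ (Set.range cayleyColumns)) = 6 := by
  refine le_antisymm finrank_vectorSpan_le ?_
  have h := treeCode_example
  rw [bit_eq, ← mask_maskSet (m := 607) (by norm_num), testBit_treeCode_mask] at h
  have hne : (maskSet 607).Nonempty := by rw [← Finset.card_pos, h.1]; norm_num
  have h1 := finrank_of_free h.2 hne
  rw [h.1] at h1
  have := Submodule.finrank_mono
    (vectorSpan_mono ℝ (Set.image_subset_range cayleyColumns (maskSet 607 : Set Label)))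
  omega

theorem IsTree.affineSpan_eq {σ : Finset Label} (hσ : IsTree σ) :
    affineSpan ℝ (cayleyColumns '' (σ : Set Label)) = affineSpan ℝ (Set.range cayleyColumns) := by
  have h := (isCircuitSystem.free_iff_affineIndependent σ).mp hσ.2
  have h3 : Set.range (fun v : σ => cayleyColumns v) = cayleyColumns '' (σ : Set Label) := by
    rw [Set.image_eq_range]; rfl
  have := h.affineSpan_eq_of_le_of_card_eq_finrank_add_one
    (sp := affineSpan ℝ (Set.range cayleyColumns))
    (by rw [h3]; exact affineSpan_mono ℝ (Set.image_subset_range _ _))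
    (by rw [direction_affineSpan, finrank_vectorSpan, Fintype.card_coe, hσ.1])
  rwa [h3] at this

/-- Cells of triangulations come with independence, cells of mixed subdivisions with the number of
labels; as the span has dimension 6, each implies the other. -/
theorem isTree_of_affineSpan_eq {σ : Finset Label}
    (h : affineSpan ℝ (cayleyColumns '' (σ : Set Label)) = affineSpan ℝ (Set.range cayleyColumns))
    (h' : σ.card = 7 ∨ CircuitFree Circuit σ) : IsTree σ := by
  have hd : Module.finrank ℝ (vectorSpan ℝ (cayleyColumns '' (σ : Set Label))) = 6 := by
    rw [← direction_affineSpan, h, direction_affineSpan, finrank_vectorSpan]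
  rcases h' with h7 | hfree
  · refine ⟨h7, ?_⟩
    rw [isCircuitSystem.free_iff_affineIndependent, affineIndependent_iff_finrank_vectorSpan_eq ℝ _
      (n := 6) (by rw [Fintype.card_coe, h7])]
    have h3 : Set.range (fun v : σ => cayleyColumns v) = cayleyColumns '' (σ : Set Label) := by
      rw [Set.image_eq_range]; rfl
    rw [h3, hd]
  · have hne : σ.Nonempty := by
      rw [Finset.nonempty_iff_ne_empty]
      intro h0
      rw [h0, Finset.coe_empty, Set.image_empty, vectorSpan_empty, finrank_bot] at hd
      omega
    exact ⟨by rw [← finrank_of_free hfree hne, hd], hfree⟩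

theorem IsTree.nonempty {σ : Finset Label} (hσ : IsTree σ) (i : Fin 4) :
    (cayleyCell σ i).Nonempty :=
  nonempty_of_affineSpan_eq facetTriangle hσ.affineSpan_eq i

theorem isTree_of_mem {T : Finset (Finset Label)} (hT : IsTriangulation cayleyColumns T)
    {σ : Finset Label} (hσ : σ ∈ T) : IsTree σ :=
  isTree_of_affineSpan_eq (hT.full_dim σ hσ)
    (Or.inr ((isCircuitSystem.free_iff_affineIndependent σ).mpr (hT.affineIndependent σ hσ)))

theorem mem_cayleyTrick {T : Finset (Finset Label)} {σ : Finset Label} :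
    cayleyCell σ ∈ cayleyTrick T ↔ σ ∈ T := by
  rw [cayleyTrick, cayleyCell_injective.mem_finset_image]

theorem minkowskiCell_eq_slice (σ : Finset Label) :
    minkowskiCell facetTriangle (cayleyCell σ) =
      {x | (4 : ℝ)⁻¹ • ((x, fun _ => 1) : (Fin 4 → ℝ) × (Fin 4 → ℝ)) ∈
        convexHull ℝ (cayleyColumns '' (σ : Set Label))} := by
  ext x
  have := mem_minkowskiCell_iff_slice facetTriangle σ x
  rw [Fintype.card_fin] at this
  exact_mod_cast this

/-- Covering and intersections are inherited by the slice. Fineness is the count 7 - 4 = 3 for seven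
labels in four nonempty summands. -/
theorem isFineMixedSubdivision_cayleyTrick {T : Finset (Finset Label)}
    (hT : IsTriangulation cayleyColumns T) :
    IsFineMixedSubdivision facetTriangle (cayleyTrick T) where
  nonempty := by
    intro B hB i
    obtain ⟨σ, hσ, rfl⟩ := Finset.mem_image.mp hB
    exact (isTree_of_mem hT hσ).nonempty i
  full_dim := by
    intro B hB
    obtain ⟨σ, hσ, rfl⟩ := Finset.mem_image.mp hB
    have hne := (isTree_of_mem hT hσ).nonempty
    rw [vectorSpan_minkowskiCell _ hne, vectorSpan_minkowskiSum,
      (affineSpan_cayleyConfig_eq_iff facetTriangle hne).mp (hT.full_dim σ hσ)]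
  fine := by
    intro B hB
    obtain ⟨σ, hσ, rfl⟩ := Finset.mem_image.mp hB
    have ht := isTree_of_mem hT hσ
    rw [finrank_minkowskiSum]
    have h1 := sum_card_cayleyCell σ
    have h2 := fun i => (ht.nonempty i).card_pos
    rw [ht.1, Fin.sum_univ_four] at h1
    rw [Fin.sum_univ_four]
    have := h2 0; have := h2 1; have := h2 2; have := h2 3
    omega
  cover := by
    have h1 : minkowskiSum facetTriangle = {x | (4 : ℝ)⁻¹ • ((x, fun _ => 1) :
        (Fin 4 → ℝ) × (Fin 4 → ℝ)) ∈ convexHull ℝ (Set.range cayleyColumns)} := by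
      rw [minkowskiSum_eq, minkowskiCell_eq_slice]; simp
    rw [h1, ← hT.cover]
    ext x
    simp only [Set.mem_iUnion, cayleyTrick, Finset.mem_image, exists_prop, Set.mem_ofPred_eq,
      exists_exists_and_eq_and, minkowskiCell_eq_slice]
  inter := by
    intro B hB C hC
    obtain ⟨σ, hσ, rfl⟩ := Finset.mem_image.mp hB
    obtain ⟨τ, hτ, rfl⟩ := Finset.mem_image.mp hC
    rw [cayleyCell_inter, minkowskiCell_eq_slice, minkowskiCell_eq_slice, minkowskiCell_eq_slice,
      ← hT.inter σ hσ τ hτ]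
    rfl

theorem isTree_of_mem_mixed {M : Finset ((i : Fin 4) → Finset {j : Fin 4 // j ≠ i})}
    (hM : IsFineMixedSubdivision facetTriangle M) {σ : Finset Label} (hσ : cayleyCell σ ∈ M) :
    IsTree σ := by
  have hne := hM.nonempty _ hσ
  refine isTree_of_affineSpan_eq ((affineSpan_cayleyConfig_eq_iff facetTriangle hne).mpr ?_)
    (Or.inl ?_)
  · rw [← vectorSpan_minkowskiCell _ hne, hM.full_dim _ hσ, vectorSpan_minkowskiSum]
  · have h1 := hM.fine _ hσ
    rw [finrank_minkowskiSum, Fin.sum_univ_four] at h1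
    have h2 := fun i => (hne i).card_pos
    have := h2 0; have := h2 1; have := h2 2; have := h2 3
    rw [← sum_card_cayleyCell, Fin.sum_univ_four]
    omega

/-! ### Families of trees as binary numbers -/

theorem foldR_induction {α β : Type} (motive : List α → β → Prop) {f : α → β → β} {b : β}
    (nil : motive [] b) (cons : ∀ a l x, motive l x → motive (a :: l) (f a x)) (l : List α) :
    motive l (foldR f b l) := by
  induction l with
  | nil => exact nil
  | cons a l ih => exact cons a l _ ih

def forceList {α : Type} : List ℕ → (List ℕ → α) → α
  | [], f => f []
  | x :: l, f => force x fun y => forceList l fun l' => f (y :: l')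

theorem forceList_eq {α : Type} (l : List ℕ) (f : List ℕ → α) : forceList l f = f l := by
  induction l generalizing f with
  | nil => rfl
  | cons x l ih => rw [forceList, force_eq, ih]

/-- `x` with its lowest 61 binary digits filled by a fingerprint of `x`. No tree has a code
less than 64, so these digits carry no information; but they keep the hash values apart that the
kernel uses, which depend on the lowest digits only. -/
def marked (x : ℕ) : ℕ := Nat.lor x (Nat.mod x 2305843009213693951)

def mark {α : Type} (x : ℕ) (f : ℕ → α) : α :=
  force (Nat.lor x (Nat.mod x 2305843009213693951)) f

theorem mark_eq {α : Type} (x : ℕ) (f : ℕ → α) : mark x f = f (marked x) := force_eq _ _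

theorem testBit_marked {x m : ℕ} (hm : 64 ≤ m) : (marked x).testBit m = x.testBit m := by
  have h : (Nat.mod x 2305843009213693951).testBit m = false := by
    apply Nat.testBit_lt_two_pow
    calc Nat.mod x 2305843009213693951 < 2305843009213693951 := Nat.mod_lt _ (by norm_num)
      _ ≤ 2 ^ 64 := by norm_num
      _ ≤ 2 ^ m := Nat.pow_le_pow_right (by norm_num) hm
  rw [marked, testBit_lor, h, Bool.or_false]

theorem testBit_marked_of_testBit {x m : ℕ} (h : x.testBit m = true) :
    (marked x).testBit m = true := by
  rw [marked, testBit_lor, h, Bool.true_or]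

def clearLow (x : ℕ) : ℕ := Nat.shiftLeft (Nat.shiftRight x 64) 64

theorem testBit_clearLow (x m : ℕ) : (clearLow x).testBit m = (decide (64 ≤ m) && x.testBit m) := by
  change ((x >>> 64) <<< 64).testBit m = _
  rw [Nat.testBit_shiftLeft, Nat.testBit_shiftRight]
  by_cases h : 64 ≤ m
  · simp [h, Nat.add_sub_cancel' h]
  · simp [h]

/-- A spanning tree has an edge in the last row, whose labels are at the positions 9, 10 and 11, so
its code is not below 64. -/
theorem clearLow_treeCode : Nat.beq (clearLow (treeCode hasTable)) (treeCode hasTable) = true := by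
  decide +kernel

theorem IsTree.le_mask {σ : Finset Label} (hσ : IsTree σ) : 64 ≤ mask σ := by
  have h := (testBit_treeCode_mask σ).mpr hσ
  rw [← Nat.eq_of_beq_eq_true clearLow_treeCode, testBit_clearLow, Bool.and_eq_true,
    decide_eq_true_eq] at h
  exact h.1

open scoped Classical in
/-- the family of trees with the code `c` -/
noncomputable def family (c : ℕ) : Finset (Finset Label) :=
  Finset.univ.filter fun σ => IsTree σ ∧ c.testBit (mask σ) = true

theorem mem_family {c : ℕ} {σ : Finset Label} :
    σ ∈ family c ↔ IsTree σ ∧ c.testBit (mask σ) = true := by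
  simp [family]

theorem family_marked (c : ℕ) : family (marked c) = family c := by
  ext σ
  rw [mem_family, mem_family]
  exact and_congr_right fun h => by rw [testBit_marked h.le_mask]

theorem family_clearLow (c : ℕ) : family (clearLow c) = family c := by
  ext σ
  rw [mem_family, mem_family]
  exact and_congr_right fun h => by rw [testBit_clearLow]; simp [h.le_mask]

theorem testBit_treeCode_of_le {m : ℕ} (hm : 2 ^ 12 ≤ m) :
    (treeCode hasTable).testBit m = false := by
  rw [← Bool.not_eq_true, treeCode,
    testBit_foldR_diff _ _ _ fun z => supersets hasTable (Nat.lor z.1 z.2), hasTable,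
    testBit_atLeast_map _ (by decide)]
  omega

theorem family_eq_iff {c d : ℕ} :
    family c = family d ↔ Nat.land (treeCode hasTable) c = Nat.land (treeCode hasTable) d := by
  constructor
  · intro h
    apply Nat.eq_of_testBit_eq
    intro m
    rw [testBit_land, testBit_land]
    by_cases hm : m < 2 ^ 12
    · rw [← mask_maskSet hm]
      have := Finset.ext_iff.mp h (maskSet m)
      rw [mem_family, mem_family, ← testBit_treeCode_mask] at this
      rw [Bool.eq_iff_iff, Bool.and_eq_true, Bool.and_eq_true, this]
    · rw [testBit_treeCode_of_le (not_lt.mp hm)]; rfl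
  · intro h
    ext σ
    rw [mem_family, mem_family, ← testBit_treeCode_mask, ← Bool.and_eq_true, ← testBit_land, h,
      testBit_land, Bool.and_eq_true]

/-- Append to `l` the positions of the digits `1` of the binary number `x < 2 ^ 2 ^ d`, shifted
by `o`. -/
def ones (d : ℕ) : ℕ → ℕ → List ℕ → List ℕ :=
  Nat.rec (fun x o l => bif bit x 0 then o :: l else l) (fun d ih x o l =>
    bif Nat.beq x 0 then l else
    force (Nat.shiftRight x (2 ^ d)) fun y => force (Nat.mod x (2 ^ (2 ^ d))) fun z =>
      ih z o (ih y (o + 2 ^ d) l)) d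

theorem mem_ones (d x o : ℕ) (l : List ℕ) (m : ℕ) :
    m ∈ ones d x o l ↔ m ∈ l ∨ ∃ i < 2 ^ d, x.testBit i = true ∧ m = o + i := by
  induction d generalizing x o l with
  | zero =>
    have : ones 0 x o l = bif bit x 0 then o :: l else l := rfl
    rw [this, bit_eq]
    cases h : x.testBit 0 <;> simp [h, or_comm]
  | succ d ih =>
    have : ones (d + 1) x o l = bif Nat.beq x 0 then l else
      force (Nat.shiftRight x (2 ^ d)) fun y => force (Nat.mod x (2 ^ (2 ^ d))) fun z =>
        ones d z o (ones d y (o + 2 ^ d) l) := rfl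
    rw [this]
    cases h : Nat.beq x 0
    · have e1 : ∀ i, (Nat.shiftRight x (2 ^ d)).testBit i = x.testBit (2 ^ d + i) := fun i =>
        Nat.testBit_shiftRight x
      have e2 : ∀ i, (Nat.mod x (2 ^ 2 ^ d)).testBit i = (decide (i < 2 ^ d) && x.testBit i) :=
        fun i => Nat.testBit_mod_two_pow x (2 ^ d) i
      rw [cond_false, force_eq, force_eq, ih, ih]
      simp only [e1, e2, or_assoc]
      refine or_congr_right ?_
      constructor
      · rintro (⟨i, hi, h1, rfl⟩ | ⟨i, hi, h1, rfl⟩)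
        · exact ⟨2 ^ d + i, by rw [pow_succ]; omega, h1, by omega⟩
        · refine ⟨i, by rw [pow_succ]; omega, ?_, rfl⟩
          simpa [hi] using h1
      · rintro ⟨i, hi, h1, rfl⟩
        by_cases hlt : i < 2 ^ d
        · exact Or.inr ⟨i, hlt, by simp [hlt, h1], rfl⟩
        · rw [pow_succ] at hi
          exact Or.inl ⟨i - 2 ^ d, by omega, by rwa [Nat.add_sub_cancel' (by omega)], by omega⟩
    · obtain rfl : x = 0 := Nat.eq_of_beq_eq_true h
      simp

/-! ### Weights -/

def digit (w k : ℕ) : ℕ := Nat.land (Nat.shiftRight w (4 * k)) 15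

/-- the total weight of the elements of `P`, where the weights are the hexadecimal digits
of `w` -/
def weight (w P : ℕ) : ℕ :=
  foldR (fun k acc => bif bit P k then Nat.land (Nat.shiftRight w (4 * k)) 15 + acc else acc) 0
    indices

theorem sum_code {M : Type*} [AddCommMonoid M] (G : ℕ → M) :
    ∑ v : Label, G (code v) = (indices.map G).sum := by
  rw [← List.sum_toFinset G (by decide : indices.Nodup),
    show indices.toFinset = Finset.univ.image code by decide,
    Finset.sum_image fun v _ w _ h => code_injective h]

theorem foldR_indices (b : ℕ → Bool) (G : ℕ → ℕ) :
    foldR (fun k acc => bif b k then G k + acc else acc) 0 indices =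
      ∑ v : Label, if b (code v) = true then G (code v) else 0 := by
  rw [sum_code fun k => if b k = true then G k else 0]
  generalize indices = l
  induction l with
  | nil => rfl
  | cons k l ih =>
    rw [foldR_cons, ih, List.map_cons, List.sum_cons]
    cases b k <;> simp

theorem weight_eq (w P : ℕ) : weight w P = ∑ v ∈ maskSet P, digit w (code v) := by
  have := foldR_indices (fun k => bit P k) (digit w)
  rw [weight, maskSet, Finset.sum_filter]
  simpa only [bit_eq, digit] using this

/-! ### The search for fine mixed subdivisions -/

def block (i : ℕ) : ℕ := Nat.shiftLeft 7 (3 * i)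

theorem testBit_block : ∀ (i : Fin 4) (v : Label), (block i).testBit (code v) = decide (v.1 = i) := by
  decide

/-- the trees that share with `m` an edge at each row that is not touched by `P` -/
def linked (hs : List ℕ) (P m : ℕ) : ℕ :=
  foldR (fun i acc => bif Nat.beq (Nat.land P (block i)) 0 then
    Nat.land acc (hitting hs (Nat.land m (block i))) else acc) allMasks [0, 1, 2, 3]

/-- the trees that cannot occur together with `m` in a fine mixed subdivision -/
def conflicts (hs : List ℕ) (m : ℕ) : ℕ :=
  foldR (fun z acc => bif Nat.beq (Nat.land z.1 m) z.1 then
    Nat.lor acc (Nat.land (supersets hs z.2) (linked hs z.1 m)) else acc) 0 circuits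

theorem testBit_linked {P m : ℕ} {τ : Finset Label}
    (h : (linked hasTable P m).testBit (mask τ) = true) (i : Fin 4)
    (hi : ∀ v ∈ maskSet P, v.1 ≠ i) : ∃ v ∈ τ, v ∈ maskSet m ∧ v.1 = i := by
  have key : ∀ l : List ℕ, (foldR (fun i acc => bif Nat.beq (Nat.land P (block i)) 0 then
      Nat.land acc (hitting hasTable (Nat.land m (block i))) else acc) allMasks l).testBit
      (mask τ) = true → i.1 ∈ l → Nat.land P (block i) = 0 →
      (hitting hasTable (Nat.land m (block i))).testBit (mask τ) = true := by
    intro l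
    induction l with
    | nil => intro _ h; simp at h
    | cons a l ih =>
      rw [foldR_cons]
      intro h1 h2 h3
      cases h4 : Nat.beq (Nat.land P (block a)) 0
      · rw [h4, cond_false] at h1
        rcases List.mem_cons.mp h2 with rfl | h2
        · rw [h3] at h4; simp at h4
        · exact ih h1 h2 h3
      · rw [h4, cond_true, testBit_land, Bool.and_eq_true] at h1
        rcases List.mem_cons.mp h2 with rfl | h2
        · exact h1.2
        · exact ih h1.1 h2 h3
  have h0 : Nat.land P (block i) = 0 := by
    apply Nat.eq_of_testBit_eq
    intro k
    rw [testBit_land, Nat.zero_testBit]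
    by_cases hk : k < 12
    · obtain ⟨v, rfl⟩ := exists_code_eq hk
      rw [testBit_block]
      cases h : P.testBit (code v)
      · rfl
      · simpa using hi v (mem_maskSet.mpr h)
    · have h5 : (block i).testBit k = false := by
        apply Nat.testBit_lt_two_pow
        have h6 : ∀ i : Fin 4, block i < 2 ^ 12 := by decide
        exact (h6 i).trans_le (Nat.pow_le_pow_right (by omega) (not_lt.mp hk))
      rw [h5, Bool.and_false]
  obtain ⟨v, hv, h⟩ := (testBit_hitting _ τ).mp (key _ h (by fin_cases i <;> simp) h0)
  rw [testBit_land, Bool.and_eq_true, testBit_block, decide_eq_true_eq] at h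
  exact ⟨v, hv, mem_maskSet.mpr h.1, h.2⟩

theorem testBit_conflicts {σ τ : Finset Label}
    (h : (conflicts hasTable (mask σ)).testBit (mask τ) = true) :
    ∃ z ∈ circuits, maskSet z.1 ⊆ σ ∧ maskSet z.2 ⊆ τ ∧
      ∀ i : Fin 4, (∀ v ∈ maskSet z.1, v.1 ≠ i) → ∃ v ∈ σ ∩ τ, v.1 = i := by
  unfold conflicts at h
  generalize circuits = l at h ⊢
  induction l with
  | nil => simp at h
  | cons z l ih =>
    have aux : (∃ y ∈ l, maskSet y.1 ⊆ σ ∧ maskSet y.2 ⊆ τ ∧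
        ∀ i : Fin 4, (∀ v ∈ maskSet y.1, v.1 ≠ i) → ∃ v ∈ σ ∩ τ, v.1 = i) →
        ∃ y ∈ z :: l, maskSet y.1 ⊆ σ ∧ maskSet y.2 ⊆ τ ∧
        ∀ i : Fin 4, (∀ v ∈ maskSet y.1, v.1 ≠ i) → ∃ v ∈ σ ∩ τ, v.1 = i := by
      rintro ⟨y, hy, h⟩
      exact ⟨y, List.mem_cons_of_mem _ hy, h⟩
    rw [foldR_cons] at h
    cases h1 : Nat.beq (Nat.land z.1 (mask σ)) z.1
    · rw [h1, cond_false] at h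
      exact aux (ih h)
    · rw [h1, cond_true, testBit_lor, Bool.or_eq_true] at h
      rcases h with h | h
      · exact aux (ih h)
      · rw [testBit_land, Bool.and_eq_true, testBit_supersets] at h
        refine ⟨z, List.mem_cons_self, ?_, h.1, fun i hi => ?_⟩
        · have := maskSet_subset_of_land h1
          rwa [maskSet_mask] at this
        · obtain ⟨v, hv, hv', hi⟩ := testBit_linked h.2 i hi
          rw [maskSet_mask] at hv'
          exact ⟨v, Finset.mem_inter.mpr ⟨hv', hv⟩, hi⟩

/-- Flows with `10` units at each row, whose column sums are ten times the coordinates of a point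
of the truncated tetrahedron. -/
def sampleFlows : List ℕ :=
  [0x352a00a00910, 0x262a00820820, 0x424a00910640, 0x028a00910253, 0x00a802a00361,
    0x091820730901, 0x451a00370910, 0x604a00424019, 0x109802901064, 0x00a703a00136,
    0x505a00541037, 0x325a00550262, 0x40691063100a, 0x082550640802, 0x622a00280235,
    0x712a00280190, 0x505a00541091, 0xa005140a0091, 0xa004510a0082, 0xa00604073091,
    0xa00901046019, 0xa00307091064, 0xa003520a0019, 0xa00307028091, 0xa00406028073,
    0x703604307064, 0x307802703064, 0x00a00a406271, 0x00a00a505226, 0x50513650500a,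
    0x61302830700a, 0x00a109a00127, 0x5410a016300a, 0xa0011804600a, 0x0640a072100a]

theorem weight_sampleFlows : ∀ w ∈ sampleFlows, ∀ i : Fin 4, weight w (block i) = 10 := by
  decide +kernel

def rowsMask (A : ℕ) : ℕ :=
  foldR (fun k acc => bif bit A (rowOf k) then Nat.lor (Nat.shiftLeft 1 k) acc else acc) 0 indices

def colsMask (B : ℕ) : ℕ :=
  foldR (fun k acc => bif bit B (colOf k) then Nat.lor (Nat.shiftLeft 1 k) acc else acc) 0 indices

theorem testBit_foldR_indices (b : ℕ → Bool) (v : Label) :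
    (foldR (fun k acc => bif b k then Nat.lor (Nat.shiftLeft 1 k) acc else acc) 0
      indices).testBit (code v) = b (code v) := by
  have key : ∀ l : List ℕ, (foldR (fun k acc => bif b k then Nat.lor (Nat.shiftLeft 1 k) acc
      else acc) 0 l).testBit (code v) = true ↔ code v ∈ l ∧ b (code v) = true := by
    intro l
    induction l with
    | nil => simp
    | cons k l ih =>
      rw [foldR_cons, List.mem_cons]
      cases h : b k
      · rw [cond_false, ih]
        constructor
        · exact fun hh => ⟨Or.inr hh.1, hh.2⟩
        · rintro ⟨rfl | h1, h2⟩
          · rw [h] at h2; simp at h2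
          · exact ⟨h1, h2⟩
      · rw [cond_true, testBit_lor, testBit_one_shiftLeft, Bool.or_eq_true, decide_eq_true_eq, ih]
        constructor
        · rintro (h1 | h1)
          · exact ⟨Or.inl h1, h1 ▸ h⟩
          · exact ⟨Or.inr h1.1, h1.2⟩
        · rintro ⟨h1 | h1, h2⟩
          · exact Or.inl h1
          · exact Or.inr ⟨h1, h2⟩
  rw [Bool.eq_iff_iff, key, and_iff_right (code_mem_indices v)]

theorem mem_maskSet_rowsMask {A : ℕ} {v : Label} :
    v ∈ maskSet (rowsMask A) ↔ A.testBit v.1 = true := by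
  have := testBit_foldR_indices (fun k => bit A (rowOf k)) v
  rw [mem_maskSet, rowsMask, this, bit_eq, rowOf_code]

theorem mem_maskSet_colsMask {B : ℕ} {v : Label} :
    v ∈ maskSet (colsMask B) ↔ B.testBit v.2.1 = true := by
  have := testBit_foldR_indices (fun k => bit B (colOf k)) v
  rw [mem_maskSet, colsMask, this, bit_eq, colOf_code]

def range16 : List ℕ := [0, 1, 2, 3, 4, 5, 6, 7, 8, 9, 10, 11, 12, 13, 14, 15]

/-- for every set of rows and every set of columns, the trees without an edge from one of these
rows to a column outside of the set -/
def cutTable {α : Type} (hs : List ℕ) (f : List (ℕ × ℕ × ℕ) → α) : α :=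
  foldR (fun A K => foldR (fun B K' => fun t => force (rowsMask A) fun a => force (colsMask B) fun b =>
    force (diff allMasks (hitting hs (diff a b))) fun u => K' ((a, b, u) :: t)) K range16)
    f range16 []

/-- the trees that do not carry a flow with the same row and column sums as `w` -/
def cutOff (tb : List (ℕ × ℕ × ℕ)) (w : ℕ) : ℕ :=
  foldR (fun z acc => bif Nat.blt (weight w z.2.1) (weight w z.1) then Nat.lor acc z.2.2 else acc)
    0 tb

/-- the trees in `S` (among those in `l`), together with the trees that go with each of them -/
def candidates {α : Type} (hs : List ℕ) (trees S : ℕ) (f : List (ℕ × ℕ) → α) (l : List ℕ) : α :=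
  foldR (fun m K => fun r => bif bit S m then force m fun m' =>
    mark (diff trees (conflicts hs m')) fun c => K ((m', c) :: r) else K r) f l []

def branch (S : ℕ) (c : List (ℕ × ℕ)) (next : ℕ → ℕ → Bool) (ch al : ℕ) : Bool :=
  bif Nat.beq (Nat.land S ch) 0 then
    allR (fun mc => bif bit al mc.1 then
        mark (Nat.lor ch (Nat.shiftLeft 1 mc.1)) fun ch' => mark (Nat.land al mc.2) fun al' =>
          next ch' al' else true) c
  else next ch al

def branchTable {α : Type} (hs : List ℕ) (trees : ℕ) (ts : List ℕ) (tb : List (ℕ × ℕ × ℕ))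
    (ws : List ℕ) (f : List (ℕ × List (ℕ × ℕ)) → α) : α :=
  foldR (fun w K t => force (diff trees (cutOff tb w)) fun S =>
    candidates hs trees S (fun c => K ((S, c) :: t)) ts) (fun t => f (List.reverse t)) ws []

def search (accept : ℕ → Bool) (t : List (ℕ × List (ℕ × ℕ))) : ℕ → ℕ → Bool :=
  foldR (fun x => branch x.1 x.2) (fun _ al => accept al) t

/-- Every sample point lies in some cell. Choose such cells one after the other; when every sample
point is in a chosen cell, the trees that go with all of them have to be one of the accepted
families. -/
def searchCheck (hs : List ℕ) (trees : ℕ) (ws : List ℕ) (accept : ℕ → Bool) : Bool :=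
  forceList (ones 12 trees 0 []) fun ts => cutTable hs fun tb =>
    branchTable hs trees ts tb ws fun t => search accept t 0 trees

/-! ### Soundness of the search -/

section Soundness

variable {T : Finset (Finset Label)}

/-- Only the form of the entries is recorded, not that all cuts are present: a missing cut would
merely leave more trees to be searched. -/
theorem exists_of_cutTable {f : List (ℕ × ℕ × ℕ) → Bool} (h : cutTable hasTable f = true) :
    ∃ tb, f tb = true ∧ ∀ z ∈ tb, ∃ A B : ℕ, z = (rowsMask A, colsMask B,
      diff allMasks (hitting hasTable (diff (rowsMask A) (colsMask B)))) := by
  let good : List (ℕ × ℕ × ℕ) → Prop := fun tb => ∀ z ∈ tb, ∃ A B : ℕ, z = (rowsMask A, colsMask B,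
      diff allMasks (hitting hasTable (diff (rowsMask A) (colsMask B))))
  let sound : (List (ℕ × ℕ × ℕ) → Bool) → Prop := fun g =>
    ∀ t, good t → g t = true → ∃ tb, f tb = true ∧ good tb
  have : sound (foldR (fun A K => foldR (fun B K' => fun t => force (rowsMask A) fun a =>
      force (colsMask B) fun b => force (diff allMasks (hitting hasTable (diff a b))) fun u =>
      K' ((a, b, u) :: t)) K range16) f range16) := by
    refine foldR_induction (fun _ g => sound g) (fun t ht h => ⟨t, h, ht⟩) (fun A _ K hK => ?_) _
    refine foldR_induction (fun _ g => sound g) hK (fun B _ K' hK' t ht h => ?_) _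
    rw [force_eq, force_eq, force_eq] at h
    refine hK' _ (fun z hz => ?_) h
    rcases List.mem_cons.mp hz with rfl | hz
    · exact ⟨A, B, rfl⟩
    · exact ht z hz
  exact this [] (by simp [good]) h

/-- This is the easy direction of max-flow min-cut: a tree with an edge across every cut that w
requires is never removed. Trees kept needlessly do no harm to the search. -/
theorem testBit_cutOff {tb : List (ℕ × ℕ × ℕ)} {w : ℕ} {σ : Finset Label}
    (htb : ∀ z ∈ tb, ∃ A B : ℕ, z = (rowsMask A, colsMask B,
      diff allMasks (hitting hasTable (diff (rowsMask A) (colsMask B)))))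
    (hσ : ∀ A B, weight w (colsMask B) < weight w (rowsMask A) →
      ∃ v ∈ σ, A.testBit v.1 = true ∧ B.testBit v.2.1 = false) :
    (cutOff tb w).testBit (mask σ) = false := by
  unfold cutOff
  induction tb with
  | nil => simp
  | cons z tb ih =>
    have ih := ih fun y hy => htb y (List.mem_cons_of_mem _ hy)
    rw [foldR_cons]
    cases h : Nat.blt (weight w z.2.1) (weight w z.1)
    · exact ih
    · rw [cond_true, testBit_lor, ih, Bool.false_or]
      obtain ⟨A, B, rfl⟩ := htb z List.mem_cons_self
      obtain ⟨v, hv, hA, hB⟩ := hσ A B (by simpa using h)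
      have : (hitting hasTable (diff (rowsMask A) (colsMask B))).testBit (mask σ) = true := by
        refine (testBit_hitting _ _).mpr ⟨v, hv, ?_⟩
        rw [testBit_diff, mem_maskSet.mp (mem_maskSet_rowsMask.mpr hA)]
        cases h2 : (colsMask B).testBit (code v)
        · rfl
        · rw [mem_maskSet_colsMask.mp (mem_maskSet.mpr h2)] at hB
          exact absurd hB (by simp)
      rw [testBit_diff, this]
      simp

/-- the family `T` is contained in the family with code `x` -/
def Below (T : Finset (Finset Label)) (x : ℕ) : Prop := ∀ σ ∈ T, x.testBit (mask σ) = true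

theorem Below.marked {x : ℕ} (h : Below T x) : Below T (marked x) :=
  fun σ hσ => testBit_marked_of_testBit (h σ hσ)

/-- `c` lists the members of `T` that are in `S`, each with a family that contains `T` -/
def Lists (T : Finset (Finset Label)) (S : ℕ) (c : List (ℕ × ℕ)) : Prop :=
  ∀ σ ∈ T, S.testBit (mask σ) = true → ∃ x ∈ c, x.1 = mask σ ∧ Below T x.2

theorem exists_of_candidates (hT : ∀ σ ∈ T, IsTree σ)
    (hc : ∀ σ ∈ T, ∀ τ ∈ T, (conflicts hasTable (mask σ)).testBit (mask τ) = false)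
    {S : ℕ} {f : List (ℕ × ℕ) → Bool} {l : List ℕ} (hl : ∀ σ ∈ T, mask σ ∈ l)
    (h : candidates hasTable (treeCode hasTable) S f l = true) :
    ∃ c, f c = true ∧ Lists T S c := by
  have key : ∀ (l : List ℕ) (r : List (ℕ × ℕ)), foldR (fun m K => fun r => bif bit S m then
      force m fun m' => mark (diff (treeCode hasTable) (conflicts hasTable m')) fun c =>
      K ((m', c) :: r) else K r) f l r = true → ∃ c, f c = true ∧ (∀ x ∈ r, x ∈ c) ∧
      ∀ σ ∈ T, mask σ ∈ l → S.testBit (mask σ) = true → ∃ x ∈ c, x.1 = mask σ ∧ Below T x.2 := by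
    intro l
    induction l with
    | nil => exact fun r h => ⟨r, h, fun x hx => hx, fun σ _ h => absurd h (by simp)⟩
    | cons m l ih =>
      intro r h
      rw [foldR_cons] at h
      cases hm : bit S m
      · rw [hm, cond_false] at h
        obtain ⟨c, h1, h2, h3⟩ := ih r h
        refine ⟨c, h1, h2, fun σ hσ hl hS => ?_⟩
        rcases List.mem_cons.mp hl with rfl | hl
        · rw [bit_eq, hS] at hm; simp at hm
        · exact h3 σ hσ hl hS
      · rw [hm, cond_true, force_eq, mark_eq] at h
        obtain ⟨c, h1, h2, h3⟩ := ih _ h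
        refine ⟨c, h1, fun x hx => h2 x (List.mem_cons_of_mem _ hx), fun σ hσ hl hS => ?_⟩
        rcases List.mem_cons.mp hl with rfl | hl
        · refine ⟨_, h2 _ List.mem_cons_self, rfl, Below.marked fun τ hτ => ?_⟩
          rw [testBit_diff, (testBit_treeCode_mask τ).mpr (hT τ hτ), hc σ hσ τ hτ]
          rfl
        · exact h3 σ hσ hl hS
  obtain ⟨c, h1, -, h3⟩ := key l [] h
  exact ⟨c, h1, fun σ hσ hS => h3 σ hσ (hl σ hσ) hS⟩

theorem exists_of_branchTable (hT : ∀ σ ∈ T, IsTree σ)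
    (hc : ∀ σ ∈ T, ∀ τ ∈ T, (conflicts hasTable (mask σ)).testBit (mask τ) = false)
    {tb : List (ℕ × ℕ × ℕ)} {ws : List ℕ}
    (hs : ∀ w ∈ ws, ∃ σ ∈ T, (cutOff tb w).testBit (mask σ) = false)
    {f : List (ℕ × List (ℕ × ℕ)) → Bool} {ts : List ℕ} (hl : ∀ σ ∈ T, mask σ ∈ ts)
    (h : branchTable hasTable (treeCode hasTable) ts tb ws f = true) :
    ∃ t, f t = true ∧ ∀ x ∈ t, (∃ σ ∈ T, x.1.testBit (mask σ) = true) ∧ Lists T x.1 x.2 := by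
  let good : List (ℕ × List (ℕ × ℕ)) → Prop := fun t => ∀ x ∈ t,
    (∃ σ ∈ T, x.1.testBit (mask σ) = true) ∧ Lists T x.1 x.2
  have key : ∀ (ws : List ℕ), (∀ w ∈ ws, ∃ σ ∈ T, (cutOff tb w).testBit (mask σ) = false) →
      ∀ t, good t → foldR (fun w K t => force (diff (treeCode hasTable) (cutOff tb w)) fun S =>
        candidates hasTable (treeCode hasTable) S (fun c => K ((S, c) :: t)) ts)
        (fun t => f (List.reverse t)) ws t = true → ∃ t, f t = true ∧ good t := by
    intro ws
    induction ws with
    | nil => exact fun _ t ht h => ⟨_, h, fun x hx => ht x (List.mem_reverse.mp hx)⟩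
    | cons w ws ih =>
      intro hs t ht h
      rw [foldR_cons, force_eq] at h
      obtain ⟨c, h1, h2⟩ := exists_of_candidates hT hc hl h
      refine ih (fun w hw => hs w (List.mem_cons_of_mem _ hw)) _ (fun x hx => ?_) h1
      rcases List.mem_cons.mp hx with rfl | hx
      · obtain ⟨σ, hσ, h3⟩ := hs w List.mem_cons_self
        refine ⟨⟨σ, hσ, ?_⟩, h2⟩
        rw [testBit_diff, (testBit_treeCode_mask σ).mpr (hT σ hσ), h3]
        rfl
      · exact ht x hx
  exact key ws hs [] (by simp [good]) h

/-- The family T selects a path through the search. At a sample point not yet covered it has a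
member among the candidates, and after this choice the allowed trees still include all of T. A
branch without candidates passes the check vacuously, but T never leads into one. -/
theorem exists_of_search {accept : ℕ → Bool} {t : List (ℕ × List (ℕ × ℕ))}
    (ht : ∀ x ∈ t, (∃ σ ∈ T, x.1.testBit (mask σ) = true) ∧ Lists T x.1 x.2) {ch al : ℕ}
    (hal : Below T al) (h : search accept t ch al = true) :
    ∃ al', accept al' = true ∧ Below T al' := by
  induction t generalizing ch al with
  | nil => exact ⟨al, h, hal⟩
  | cons x t ih =>
    have ih := @ih fun y hy => ht y (List.mem_cons_of_mem _ hy)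
    have h' : branch x.1 x.2 (search accept t) ch al = true := h
    unfold branch at h'
    cases hb : Nat.beq (Nat.land x.1 ch) 0
    · rw [hb, cond_false] at h'
      exact ih hal h'
    · rw [hb, cond_true] at h'
      obtain ⟨⟨σ, hσ, hx⟩, hL⟩ := ht x List.mem_cons_self
      obtain ⟨y, hy, hyσ, hyT⟩ := hL σ hσ hx
      have h2 := allR_eq_true.mp h' y hy
      rw [hyσ, bit_eq, hal σ hσ, cond_true, mark_eq, mark_eq] at h2
      refine ih (Below.marked fun τ hτ => ?_) h2
      rw [testBit_land, hal τ hτ, hyT τ hτ]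
      rfl

theorem exists_of_searchCheck (hT : ∀ σ ∈ T, IsTree σ)
    (hc : ∀ σ ∈ T, ∀ τ ∈ T, (conflicts hasTable (mask σ)).testBit (mask τ) = false)
    {ws : List ℕ} (hs : ∀ w ∈ ws, ∃ σ ∈ T, ∀ A B,
      weight w (colsMask B) < weight w (rowsMask A) →
      ∃ v ∈ σ, A.testBit v.1 = true ∧ B.testBit v.2.1 = false)
    {accept : ℕ → Bool} (h : searchCheck hasTable (treeCode hasTable) ws accept = true) :
    ∃ al, accept al = true ∧ Below T al := by
  have hT' : Below T (treeCode hasTable) := fun σ hσ => (testBit_treeCode_mask σ).mpr (hT σ hσ)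
  rw [searchCheck, forceList_eq] at h
  obtain ⟨tb, h, htb⟩ := exists_of_cutTable h
  obtain ⟨t, h, ht⟩ := exists_of_branchTable hT hc (fun w hw => by
    obtain ⟨σ, hσ, h⟩ := hs w hw
    exact ⟨σ, hσ, testBit_cutOff htb h⟩) (fun σ hσ => by
    rw [mem_ones]
    exact Or.inr ⟨mask σ, mask_lt σ, hT' σ hσ, by simp⟩) h
  exact exists_of_search ht hT' h

end Soundness

/-! ### Cells of fine mixed subdivisions -/

section Cells

variable {M : Finset ((i : Fin 4) → Finset {j : Fin 4 // j ≠ i})}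

theorem mem_cell_iff (σ : Finset Label) (x : Fin 4 → ℝ) :
    x ∈ minkowskiCell facetTriangle (cayleyCell σ) ↔ ∃ f : Label → ℝ, (∀ v, 0 ≤ f v) ∧
      (∀ v ∉ σ, f v = 0) ∧ ∑ v, f v • cayleyColumns v = (x, fun _ => 1) :=
  mem_minkowskiCell_iff_sum facetTriangle σ x

theorem exists_eq_prod {f : Label → ℝ} (hf : ∀ i : Fin 4, (∑ v, if v.1 = i then f v else 0) = 1) :
    ∃ x : Fin 4 → ℝ, ∑ v, f v • cayleyColumns v = (x, fun _ => 1) :=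
  ⟨(∑ v, f v • cayleyColumns v).1, Prod.ext rfl (funext fun i => by rw [sum_smul_snd, hf])⟩

theorem exists_cell (hM : IsFineMixedSubdivision facetTriangle M) {f : Label → ℝ}
    (hf0 : ∀ v, 0 ≤ f v) (hf : ∀ i : Fin 4, (∑ v, if v.1 = i then f v else 0) = 1) :
    ∃ σ, cayleyCell σ ∈ M ∧ ∃ g : Label → ℝ, (∀ v, 0 ≤ g v) ∧ (∀ v ∉ σ, g v = 0) ∧
      ∑ v, g v • cayleyColumns v = ∑ v, f v • cayleyColumns v := by
  obtain ⟨x, hx⟩ := exists_eq_prod hf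
  have h1 : x ∈ minkowskiSum facetTriangle := by
    rw [minkowskiSum_eq, mem_cell_iff]
    exact ⟨f, hf0, fun v hv => absurd (Finset.mem_univ v) hv, hx⟩
  rw [← hM.cover] at h1
  obtain ⟨B, hB, hxB⟩ := Set.mem_iUnion₂.mp h1
  obtain ⟨σ, rfl⟩ := cayleyCell_surjective B
  obtain ⟨g, hg0, hgσ, hg⟩ := (mem_cell_iff σ x).mp hxB
  exact ⟨σ, hB, g, hg0, hgσ, hg.trans hx.symm⟩

/-- A point of two cells lies in the cell of the common labels. -/
theorem eq_zero_of_mem_cells (hM : IsFineMixedSubdivision facetTriangle M) {σ τ : Finset Label}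
    (hσ : cayleyCell σ ∈ M) (hτ : cayleyCell τ ∈ M) {f g : Label → ℝ}
    (hf0 : ∀ v, 0 ≤ f v) (hfσ : ∀ v ∉ σ, f v = 0)
    (hf : ∀ i : Fin 4, (∑ v, if v.1 = i then f v else 0) = 1)
    (hg0 : ∀ v, 0 ≤ g v) (hgτ : ∀ v ∉ τ, g v = 0)
    (hfg : ∑ v, f v • cayleyColumns v = ∑ v, g v • cayleyColumns v) :
    ∀ v ∉ τ, f v = 0 := by
  obtain ⟨x, hx⟩ := exists_eq_prod hf
  have h1 : x ∈ minkowskiCell facetTriangle (cayleyCell (σ ∩ τ)) := by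
    rw [← cayleyCell_inter, ← hM.inter _ hσ _ hτ]
    exact ⟨(mem_cell_iff σ x).mpr ⟨f, hf0, hfσ, hx⟩,
      (mem_cell_iff τ x).mpr ⟨g, hg0, hgτ, hfg.symm.trans hx⟩⟩
  obtain ⟨h, -, hh, hsum⟩ := (mem_cell_iff _ x).mp h1
  have : f = h := isCircuitSystem.eq_of_free (isTree_of_mem_mixed hM hσ).2 hfσ
    (fun v hv => hh v fun hv' => hv (Finset.mem_inter.mp hv').1) (hx.trans hsum.symm)
  intro v hv
  rw [this]
  exact hh v fun hv' => hv (Finset.mem_inter.mp hv').2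

/-- The indicators of P ⊆ σ and N ⊆ τ represent the same vector, with row sums one at the rows that
the circuit touches. Adding one common label of σ and τ in every other row gives a point of both
cells. By the intersection axiom and uniqueness of weights on σ it follows that P ⊆ τ, so the tree τ
would contain the whole circuit. The common labels are needed because the axiom speaks only of
points whose row sums are all one. -/
theorem conflicts_eq_false (hM : IsFineMixedSubdivision facetTriangle M) {σ τ : Finset Label}
    (hσ : cayleyCell σ ∈ M) (hτ : cayleyCell τ ∈ M) :
    (conflicts hasTable (mask σ)).testBit (mask τ) = false := by
  rw [← Bool.not_eq_true]
  intro hcon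
  obtain ⟨z, hz, hP, hN, hl⟩ := testBit_conflicts hcon
  have hl' : ∀ i : Fin 4, ∃ b : Label, b.1 = i ∧ ((∀ v ∈ maskSet z.1, v.1 ≠ i) → b ∈ σ ∩ τ) := by
    intro i
    by_cases h : ∀ v ∈ maskSet z.1, v.1 ≠ i
    · obtain ⟨v, hv, hi⟩ := hl i h
      exact ⟨v, hi, fun _ => hv⟩
    · push Not at h
      obtain ⟨v, hv, hi⟩ := h
      exact ⟨v, hi, fun h' => absurd hi (h' v hv)⟩
  choose b hb1 hb2 using hl'
  let Q : Finset Label := Finset.univ.filter fun v => v = b v.1 ∧ ∀ w ∈ maskSet z.1, w.1 ≠ v.1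
  have hQ : ∀ v ∈ Q, v ∈ σ ∩ τ := by
    intro v hv
    have hv := (Finset.mem_filter.mp hv).2
    rw [hv.1]
    exact hb2 v.1 hv.2
  let ind : Finset Label → Label → ℝ := fun S v => if v ∈ S then 1 else 0
  have hrow : ∀ i : Fin 4, (∑ v, if v.1 = i then (ind (maskSet z.1) + ind Q) v else 0) = 1 := by
    intro i
    have e : ∀ v : Label, (if v.1 = i then (ind (maskSet z.1) + ind Q) v else 0) =
        (if v.1 = i then ind (maskSet z.1) v else 0) + if v.1 = i then ind Q v else 0 := by
      intro v; split_ifs <;> simp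
    simp only [e, Finset.sum_add_distrib]
    rw [sum_ite_indicator (maskSet z.1) fun v => v.1 = i, sum_ite_indicator Q fun v => v.1 = i]
    by_cases h : ∀ v ∈ maskSet z.1, v.1 ≠ i
    · have h1 : (maskSet z.1).filter (fun v => v.1 = i) = ∅ :=
        Finset.filter_eq_empty_iff.mpr h
      have h2 : Q.filter (fun v => v.1 = i) = {b i} := by
        ext v
        simp only [Q, Finset.mem_filter, Finset.mem_univ, true_and, Finset.mem_singleton]
        constructor
        · rintro ⟨⟨h3, -⟩, rfl⟩; exact h3
        · rintro rfl
          exact ⟨⟨by rw [hb1 i], by rw [hb1 i]; exact h⟩, hb1 i⟩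
      rw [h1, h2]; simp
    · have h1 : ((maskSet z.1).filter fun v => v.1 = i).card = 1 := by
        refine le_antisymm (circuit_row z hz i).2 (Finset.card_pos.mpr ?_)
        push Not at h
        obtain ⟨v, hv, hi⟩ := h
        exact ⟨v, Finset.mem_filter.mpr ⟨hv, hi⟩⟩
      have h2 : Q.filter (fun v => v.1 = i) = ∅ := by
        rw [Finset.filter_eq_empty_iff]
        rintro v hv rfl
        exact h (Finset.mem_filter.mp hv).2.2
      rw [h1, h2]; simp
  have hnn : ∀ (S : Finset Label) v, 0 ≤ ind S v := fun S v => by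
    simp only [ind]; split_ifs <;> norm_num
  have hzero : ∀ (S : Finset Label) v, v ∉ S → ind S v = 0 := fun S v hv => by simp [ind, hv]
  have hsum : ∑ v, (ind (maskSet z.1) + ind Q) v • cayleyColumns v =
      ∑ v, (ind (maskSet z.2) + ind Q) v • cayleyColumns v := by
    simp only [Pi.add_apply, add_smul, Finset.sum_add_distrib]
    congr 1
    rw [IsCircuitSystem.sum_indicator, IsCircuitSystem.sum_indicator]
    exact isCircuitSystem.sum_eq ⟨z, hz, rfl, rfl⟩
  have h0 := eq_zero_of_mem_cells hM hσ hτ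
    (fun v => add_nonneg (hnn (maskSet z.1) v) (hnn Q v))
    (fun v hv => by
      rw [hzero _ v fun h => hv (hP h),
        hzero _ v fun h => hv (Finset.mem_inter.mp (hQ v h)).1, add_zero]) hrow
    (fun v => add_nonneg (hnn (maskSet z.2) v) (hnn Q v))
    (fun v hv => by
      rw [hzero _ v fun h => hv (hN h),
        hzero _ v fun h => hv (Finset.mem_inter.mp (hQ v h)).2, add_zero]) hsum
  refine (isTree_of_mem_mixed hM hτ).2 _ _ ⟨z, hz, rfl, rfl⟩ ⟨fun v hv => ?_, hN⟩
  by_contra hvτ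
  have h1 := h0 v hvτ
  have h2 : ind (maskSet z.1) v = 1 := by simp [ind, hv]
  have h3 := hnn Q v
  linarith

theorem sum_ite_testBit_row (f : Label → ℝ) (A : ℕ) :
    ∑ v ∈ maskSet (rowsMask A), f v =
      ∑ i : Fin 4, if A.testBit i = true then (∑ v, if v.1 = i then f v else 0) else 0 := by
  have : ∀ i : Fin 4, (if A.testBit i = true then (∑ v, if v.1 = i then f v else 0) else 0) =
      ∑ v, if v.1 = i then (if A.testBit v.1 = true then f v else 0) else 0 := by
    intro i
    split_ifs with h
    · refine Finset.sum_congr rfl fun v _ => ?_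
      split_ifs with h1 h2
      · rfl
      · exact absurd (h1 ▸ h) h2
      · rfl
    · refine (Finset.sum_eq_zero fun v _ => ?_).symm
      split_ifs with h1 h2
      · exact absurd (h1 ▸ h2) h
      · rfl
      · rfl
  rw [Finset.sum_congr rfl fun i _ => this i, Finset.sum_comm,
    show maskSet (rowsMask A) = Finset.univ.filter (fun v : Label => A.testBit v.1 = true) from
      Finset.ext fun v => by rw [mem_maskSet_rowsMask]; simp, Finset.sum_filter]
  simp

theorem sum_ite_testBit_col (f : Label → ℝ) (B : ℕ) :
    ∑ v ∈ maskSet (colsMask B), f v =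
      ∑ j : Fin 4, if B.testBit j = true then (∑ v, if v.2.1 = j then f v else 0) else 0 := by
  have : ∀ j : Fin 4, (if B.testBit j = true then (∑ v, if v.2.1 = j then f v else 0) else 0) =
      ∑ v, if v.2.1 = j then (if B.testBit v.2.1 = true then f v else 0) else 0 := by
    intro j
    split_ifs with h
    · refine Finset.sum_congr rfl fun v _ => ?_
      split_ifs with h1 h2
      · rfl
      · exact absurd (h1 ▸ h) h2
      · rfl
    · refine (Finset.sum_eq_zero fun v _ => ?_).symm
      split_ifs with h1 h2
      · exact absurd (h1 ▸ h2) h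
      · rfl
      · rfl
  rw [Finset.sum_congr rfl fun i _ => this i, Finset.sum_comm,
    show maskSet (colsMask B) = Finset.univ.filter (fun v : Label => B.testBit v.2.1 = true) from
      Finset.ext fun v => by rw [mem_maskSet_colsMask]; simp, Finset.sum_filter]
  simp

/-- A representation of the sample point in its cell has the same row and column sums as w. Without
a label from a row in A to a column outside B, all weight of the rows in A would lie in the columns
in B, which is too little. -/
theorem exists_cell_of_flow (hM : IsFineMixedSubdivision facetTriangle M) {w : ℕ}
    (hw : ∀ i : Fin 4, weight w (block i) = 10) :
    ∃ σ, cayleyCell σ ∈ M ∧ ∀ A B, weight w (colsMask B) < weight w (rowsMask A) →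
      ∃ v ∈ σ, A.testBit v.1 = true ∧ B.testBit v.2.1 = false := by
  let f : Label → ℝ := fun v => (digit w (code v) : ℝ) / 10
  have hfw : ∀ P, ∑ v ∈ maskSet P, f v = (weight w P : ℝ) / 10 := by
    intro P
    rw [weight_eq, Nat.cast_sum, Finset.sum_div]
  obtain ⟨σ, hσ, g, hg0, hgσ, hg⟩ := exists_cell hM (f := f) (fun v => by positivity) (by
    intro i
    have h : (maskSet (block i)) = Finset.univ.filter (fun v : Label => v.1 = i) := by
      ext v; rw [mem_maskSet, testBit_block]; simp
    rw [← Finset.sum_filter, ← h, hfw, hw]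
    norm_num)
  obtain ⟨hcol, hrow⟩ := (sum_smul_eq_iff g f).mp hg
  refine ⟨σ, hσ, fun A B hAB => ?_⟩
  by_contra! hno
  have h1 : ∑ v ∈ maskSet (rowsMask A), g v ≤ ∑ v ∈ maskSet (colsMask B), g v := by
    rw [← Finset.sum_filter_add_sum_filter_not (maskSet (rowsMask A)) fun v => v ∈ σ,
      Finset.sum_eq_zero (s := (maskSet (rowsMask A)).filter fun v => v ∉ σ)
        fun v hv => hgσ v (Finset.mem_filter.mp hv).2, add_zero]
    refine Finset.sum_le_sum_of_subset_of_nonneg (fun v hv => ?_) fun v _ _ => hg0 v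
    obtain ⟨hv, hvσ⟩ := Finset.mem_filter.mp hv
    have := hno v hvσ (mem_maskSet_rowsMask.mp hv)
    rw [mem_maskSet_colsMask]
    simpa using this
  rw [sum_ite_testBit_row, sum_ite_testBit_col] at h1
  simp only [hrow, hcol] at h1
  rw [← sum_ite_testBit_row, ← sum_ite_testBit_col, hfw, hfw] at h1
  have : (weight w (colsMask B) : ℝ) < weight w (rowsMask A) := by exact_mod_cast hAB
  linarith

/-- A fine mixed subdivision that is contained in a triangulation is all of it. -/
theorem eq_cayleyTrick (hM : IsFineMixedSubdivision facetTriangle M) {T : Finset (Finset Label)}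
    (hT : IsTriangulation cayleyColumns T) (hMT : ∀ σ, cayleyCell σ ∈ M → σ ∈ T) :
    M = cayleyTrick T := by
  ext B
  obtain ⟨σ, rfl⟩ := cayleyCell_surjective B
  rw [mem_cayleyTrick]
  refine ⟨hMT σ, fun hσ => ?_⟩
  have hne := (isTree_of_mem hT hσ).nonempty
  -- A point inside the cell of σ: within each row, the labels of σ have equal positive weight. A
  -- cell τ of M that contains it also belongs to T, and the intersection axiom for T forces σ ⊆ τ.
  let f : Label → ℝ := fun v => if v ∈ σ then ((σ.filter fun w => w.1 = v.1).card : ℝ)⁻¹ else 0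
  have hpos : ∀ v ∈ σ, 0 < ((σ.filter fun w => w.1 = v.1).card : ℝ) := by
    intro v hv
    have : 0 < (σ.filter fun w => w.1 = v.1).card :=
      Finset.card_pos.mpr ⟨v, Finset.mem_filter.mpr ⟨hv, rfl⟩⟩
    exact_mod_cast this
  have hf0 : ∀ v, 0 ≤ f v := fun v => by simp only [f]; split_ifs <;> positivity
  have hrow : ∀ i : Fin 4, (∑ v, if v.1 = i then f v else 0) = 1 := by
    intro i
    obtain ⟨a, ha⟩ := hne i
    rw [mem_cayleyCell] at ha
    have hc := hpos _ ha
    have e : ∀ v : Label, (if v.1 = i then f v else 0) = ((σ.filter fun w => w.1 = i).card : ℝ)⁻¹ *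
        (if v.1 = i then (if v ∈ σ then 1 else 0) else 0) := by
      intro v
      by_cases h1 : v.1 = i
      · by_cases h2 : v ∈ σ
        · simp [f, h1, h2]
        · simp [f, h2]
      · simp [h1]
    rw [Finset.sum_congr rfl fun v _ => e v, ← Finset.mul_sum,
      sum_ite_indicator σ fun v => v.1 = i, inv_mul_cancel₀ hc.ne']
  obtain ⟨τ, hτ, g, hg0, hgτ, hg⟩ := exists_cell hM hf0 hrow
  have hM' := isFineMixedSubdivision_cayleyTrick hT
  have h0 := eq_zero_of_mem_cells hM' (mem_cayleyTrick.mpr hσ) (mem_cayleyTrick.mpr (hMT τ hτ)) hf0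
    (fun v hv => by simp [f, hv]) hrow hg0 hgτ hg.symm
  have hsub : σ ⊆ τ := by
    intro v hv
    by_contra hvτ
    have h1 := h0 v hvτ
    simp only [f, hv, if_true, inv_eq_zero] at h1
    exact (hpos v hv).ne' h1
  rwa [Finset.eq_of_subset_of_card_le hsub
    (by rw [(isTree_of_mem hT hσ).1, (isTree_of_mem_mixed hM hτ).1])]

/-- Every fine mixed subdivision comes from one of the families of trees in an exhaustive list. -/
theorem exists_eq_cayleyTrick (hM : IsFineMixedSubdivision facetTriangle M) {accept : ℕ → Bool}
    (h : searchCheck hasTable (treeCode hasTable) sampleFlows accept = true)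
    (haccept : ∀ c, accept c = true → IsTriangulation cayleyColumns (family c)) :
    ∃ c, accept c = true ∧ M = cayleyTrick (family c) := by
  let T : Finset (Finset Label) := Finset.univ.filter fun σ => cayleyCell σ ∈ M
  have hT : ∀ σ, σ ∈ T ↔ cayleyCell σ ∈ M := fun σ => by simp [T]
  obtain ⟨c, hc, hTc⟩ := exists_of_searchCheck (T := T)
    (fun σ hσ => isTree_of_mem_mixed hM ((hT σ).mp hσ))
    (fun σ hσ τ hτ => conflicts_eq_false hM ((hT σ).mp hσ) ((hT τ).mp hτ))
    (fun w hw => by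
      obtain ⟨σ, hσ, h⟩ := exists_cell_of_flow hM (weight_sampleFlows w hw)
      exact ⟨σ, (hT σ).mpr hσ, h⟩) h
  refine ⟨c, hc, eq_cayleyTrick hM (haccept c hc) fun σ hσ => ?_⟩
  exact mem_family.mpr ⟨isTree_of_mem_mixed hM hσ, hTc σ ((hT σ).mpr hσ)⟩

end Cells

/-! ### Certificates for triangulations -/

/-- the sets that contain the positive part of a circuit along which the weight decreases -/
def reducible (hs : List ℕ) (w : ℕ) : ℕ :=
  foldR (fun z acc => bif Nat.blt (weight w z.2) (weight w z.1) then
    Nat.lor acc (supersets hs z.1) else acc) 0 circuits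

/-- the family of all subsets of the sets in the family `c` -/
def downset (hs : List ℕ) (c : ℕ) : ℕ :=
  foldR (fun k K hs d => List.rec d (fun h hs _ =>
    K hs (Nat.lor d (Nat.shiftRight (Nat.land d h) (2 ^ k)))) hs) (fun _ d => d) indices hs c

/-- For the trees in `regularCode` the reverse strict inequality is already impossible; what the
check excludes is a tie. -/
def heightCheck (hs : List ℕ) (c w : ℕ) : Bool :=
  allR (fun z => bif Nat.beq (Nat.land c (supersets hs z.2)) 0 then true
    else Nat.blt (weight w z.2) (weight w z.1)) circuits

/-- the code of the regular triangulation with the weights `w` -/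
def regularCode (hs : List ℕ) (trees w : ℕ) : ℕ := diff trees (reducible hs w)

/-- The last equality says that every set of labels is contained in a member of the family or
contains the positive part of a weight-decreasing circuit. Supports of minimal representations are
not of the second kind, hence the family covers. -/
def regularCheck (hs : List ℕ) (trees w : ℕ) : Bool :=
  force (reducible hs w) fun b => force (diff trees b) fun c =>
    bif heightCheck hs c w then Nat.beq (Nat.lor (downset hs c) b) allMasks else false

theorem testBit_reducible {w : ℕ} {S : Finset Label}
    (h : (reducible hasTable w).testBit (mask S) = true) :
    ∃ z ∈ circuits, weight w z.2 < weight w z.1 ∧ maskSet z.1 ⊆ S := by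
  unfold reducible at h
  generalize circuits = l at h ⊢
  induction l with
  | nil => simp at h
  | cons z l ih =>
    rw [foldR_cons] at h
    have aux : (∃ y ∈ l, weight w y.2 < weight w y.1 ∧ maskSet y.1 ⊆ S) →
        ∃ y ∈ z :: l, weight w y.2 < weight w y.1 ∧ maskSet y.1 ⊆ S := by
      rintro ⟨y, hy, h⟩
      exact ⟨y, List.mem_cons_of_mem _ hy, h⟩
    cases h1 : Nat.blt (weight w z.2) (weight w z.1)
    · rw [h1, cond_false] at h
      exact aux (ih h)
    · rw [h1, cond_true, testBit_lor, Bool.or_eq_true] at h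
      rcases h with h | h
      · exact aux (ih h)
      · exact ⟨z, List.mem_cons_self, by simpa using h1, (testBit_supersets _ _).mp h⟩

/-- Digit k of 2 ^ k + m is 1 only if digit k of m is 0. Then the addition has no carry and just
inserts one label. -/
theorem subset_of_testBit_two_pow_add {k m n : ℕ} (hn : n = 2 ^ k + m) (hk : n.testBit k = true) :
    maskSet m ⊆ maskSet n := by
  subst hn
  rw [Nat.testBit_two_pow_add_eq, Bool.not_eq_true'] at hk
  intro v hv
  rw [mem_maskSet] at hv ⊢
  rcases lt_trichotomy (code v) k with h | h | h
  · rwa [Nat.testBit_two_pow_add_gt h]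
  · rw [h, hk] at hv
    exact absurd hv (by simp)
  · obtain ⟨j, hj⟩ := Nat.exists_eq_add_of_le (Nat.succ_le_of_lt h)
    have e : ∀ x : ℕ, x.testBit (code v) = (x / 2 ^ k / 2).testBit j := fun x => by
      rw [hj, Nat.div_div_eq_div_mul, ← pow_succ, ← Nat.shiftRight_eq_div_pow,
        Nat.testBit_shiftRight]
    have hk' : m / 2 ^ k % 2 = 0 := by
      rw [Nat.testBit_eq_decide_div_mod_eq, decide_eq_false_iff_not] at hk
      omega
    rw [e] at hv ⊢
    rw [Nat.add_div_left _ (by positivity)]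
    rwa [show (m / 2 ^ k).succ / 2 = m / 2 ^ k / 2 by omega]

/-- Deleting label k from the sets that contain it moves digit m to m - 2 ^ k, a right shift of the
family code by 2 ^ k. Treating the labels one after the other reaches all subsets. -/
theorem testBit_downset {c : ℕ} {S : Finset Label}
    (h : (downset hasTable c).testBit (mask S) = true) :
    ∃ σ, c.testBit (mask σ) = true ∧ S ⊆ σ := by
  have key : ∀ (n o d : ℕ), o + n ≤ 12 →
      (foldR (fun k K hs d => List.rec d (fun h hs _ =>
        K hs (Nat.lor d (Nat.shiftRight (Nat.land d h) (2 ^ k)))) hs) (fun _ d => d)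
        (List.range' o n) ((List.range' o n).map fun k => hasCode k 12) d : ℕ).testBit
        (mask S) = true → ∃ σ, d.testBit (mask σ) = true ∧ S ⊆ σ := by
    intro n
    induction n with
    | zero => exact fun o d _ h => ⟨S, h, subset_rfl⟩
    | succ n ih =>
      intro o d ho h
      rw [List.range'_succ, List.map_cons, foldR_cons] at h
      obtain ⟨σ, hσ, hS⟩ := ih (o + 1) _ (by omega) h
      rw [testBit_lor, Bool.or_eq_true] at hσ
      rcases hσ with hσ | hσ
      · exact ⟨σ, hσ, hS⟩
      · change ((Nat.land d (hasCode o 12)) >>> 2 ^ o).testBit (mask σ) = true at hσ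
        rw [Nat.testBit_shiftRight, testBit_land, Bool.and_eq_true, testBit_hasCode,
          decide_eq_true_eq] at hσ
        obtain ⟨h1, h2, -, h3⟩ := hσ
        refine ⟨maskSet (2 ^ o + mask σ), by rwa [mask_maskSet h2], hS.trans ?_⟩
        have := subset_of_testBit_two_pow_add rfl h3
        rwa [maskSet_mask] at this
  exact key 12 0 c le_rfl h

theorem weight_eq_sum (w P : ℕ) :
    (weight w P : ℝ) = ∑ v ∈ maskSet P, (digit w (code v) : ℝ) := by
  rw [weight_eq, Nat.cast_sum]

instance nonempty_label : Nonempty Label := ⟨⟨0, 1, by decide⟩⟩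

theorem isRegularTriangulation_of_check {w : ℕ}
    (h : regularCheck hasTable (treeCode hasTable) w = true) :
    IsRegularTriangulation cayleyColumns (family (regularCode hasTable (treeCode hasTable) w)) := by
  rw [regularCheck, force_eq, force_eq] at h
  rw [regularCode]
  set c := diff (treeCode hasTable) (reducible hasTable w) with hc
  cases h1 : heightCheck hasTable c w
  · rw [h1, cond_false] at h
    exact absurd h (by simp)
  rw [h1, cond_true] at h
  have hlt : ∀ σ ∈ family c, ∀ z ∈ circuits, maskSet z.2 ⊆ σ → weight w z.2 < weight w z.1 := by
    intro σ hσ z hz hN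
    have h2 := allR_eq_true.mp h1 z hz
    cases h3 : Nat.beq (Nat.land c (supersets hasTable z.2)) 0
    · rw [h3, cond_false] at h2
      simpa using h2
    · have h4 : (Nat.land c (supersets hasTable z.2)).testBit (mask σ) = true := by
        rw [testBit_land, (mem_family.mp hσ).2, (testBit_supersets _ _).mpr hN]; rfl
      rw [Nat.eq_of_beq_eq_true h3] at h4
      simp at h4
  have hT : IsTriangulation cayleyColumns (family c) := by
    refine isCircuitSystem.isTriangulation (fun σ hσ => (mem_family.mp hσ).1.2)
      (fun σ hσ => (mem_family.mp hσ).1.affineSpan_eq) ?_ ?_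
    -- The list of circuits contains both orientations, so such a circuit would give strict
    -- inequalities in both directions.
    · rintro σ hσ τ hτ _ _ ⟨z, hz, rfl, rfl⟩ ⟨hP, hN⟩
      exact lt_asymm (hlt τ hτ z hz hN) (hlt σ hσ z.swap (swap_mem_circuits hz) hP)
    · intro x hx
      obtain ⟨S, hxS, hS⟩ := isCircuitSystem.exists_minimal
        (fun v => (digit w (code v) : ℝ)) hx
      have h2 : (Nat.lor (downset hasTable c) (reducible hasTable w)).testBit (mask S) = true := by
        rw [Nat.eq_of_beq_eq_true h, testBit_allMasks]
      rw [testBit_lor, Bool.or_eq_true] at h2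
      rcases h2 with h2 | h2
      · obtain ⟨σ, hσ, hSσ⟩ := testBit_downset h2
        have ht : IsTree σ := by
          rw [hc, testBit_diff, Bool.and_eq_true] at hσ
          exact (testBit_treeCode_mask σ).mp hσ.1
        exact ⟨σ, mem_family.mpr ⟨ht, hσ⟩,
          convexHull_mono (Set.image_mono (Finset.coe_subset.mpr hSσ)) hxS⟩
      · obtain ⟨z, hz, hlt, hsub⟩ := testBit_reducible h2
        refine absurd hsub (hS _ _ ⟨z, hz, rfl, rfl⟩ ?_)
        rw [← weight_eq_sum, ← weight_eq_sum]
        exact_mod_cast hlt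
  refine ⟨hT, fun v => (digit w (code v) : ℝ), isCircuitSystem.regularCells_eq hT _ ?_⟩
  rintro σ hσ _ _ ⟨z, hz, rfl, rfl⟩ hN
  rw [← weight_eq_sum, ← weight_eq_sum]
  exact_mod_cast hlt σ hσ z hz hN

def bits {α : Type} (c : ℕ) (f : List ℕ → α) : α :=
  forceList (ones 12 (clearLow c) 0 []) f

/-- the members of the family of trees `c` -/
def memberList (c : ℕ) : List ℕ := ones 12 (clearLow c) 0 []

theorem bits_eq {α : Type} (c : ℕ) (f : List ℕ → α) : bits c f = f (memberList c) :=
  forceList_eq _ _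

theorem mem_memberList {c m : ℕ} : m ∈ memberList c ↔ ∃ σ, m = mask σ ∧ (clearLow c).testBit (mask σ) = true := by
  rw [memberList, mem_ones]
  constructor
  · rintro (h | ⟨i, hi, h, rfl⟩)
    · simp at h
    · exact ⟨maskSet i, by rw [mask_maskSet hi]; omega, by rwa [mask_maskSet hi]⟩
  · rintro ⟨σ, rfl, h⟩
    exact Or.inr ⟨mask σ, mask_lt σ, h, by omega⟩

def codeList (l : List ℕ) : ℕ := foldR (fun m acc => Nat.lor (Nat.shiftLeft 1 m) acc) 0 l

theorem testBit_codeList (l : List ℕ) (m : ℕ) : (codeList l).testBit m = true ↔ m ∈ l := by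
  unfold codeList
  induction l with
  | nil => simp
  | cons a l ih =>
    rw [foldR_cons, testBit_lor, testBit_one_shiftLeft, Bool.or_eq_true, decide_eq_true_eq, ih,
      List.mem_cons]

/-- the trees that may replace the tree `m` in the flip along the circuit `z` -/
def exchanges (z : ℕ × ℕ) (m : ℕ) : List ℕ :=
  bif Nat.beq (Nat.land z.1 m) z.1 then
    foldR (fun k acc => bif bit z.1 k then diff (Nat.lor m z.2) (Nat.shiftLeft 1 k) :: acc else acc)
      [] indices
  else [m]

/-- Whether z supports a flip is not built in; `flipCheck` tests afterwards that the resulting sets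
are trees and compatible. -/
def flipCode (c : ℕ) (z : ℕ × ℕ) : ℕ := bits c fun l => codeList (l.flatMap (exchanges z))

theorem lt_of_mem_circuits : ∀ z ∈ circuits, z.1 < 2 ^ 12 ∧ z.2 < 2 ^ 12 := by decide

theorem lt_two_pow_twelve {m : ℕ} (h : ∀ k, 12 ≤ k → m.testBit k = false) : m < 2 ^ 12 :=
  Nat.lt_pow_two_of_testBit m h

theorem testBit_of_le {m k : ℕ} (hm : m < 2 ^ 12) (hk : 12 ≤ k) : m.testBit k = false :=
  Nat.testBit_lt_two_pow (hm.trans_le (Nat.pow_le_pow_right (by norm_num) hk))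

theorem diff_lor_mask {N : ℕ} (hN : N < 2 ^ 12) (σ : Finset Label) (v : Label) :
    diff (Nat.lor (mask σ) N) (Nat.shiftLeft 1 (code v)) = mask ((σ ∪ maskSet N).erase v) := by
  rw [← mask_maskSet (m := diff _ _) (lt_two_pow_twelve fun k hk => by
    rw [testBit_diff, testBit_lor, testBit_of_le (mask_lt σ) hk, testBit_of_le hN hk]; rfl)]
  congr 1
  ext w
  rw [mem_maskSet, testBit_diff, testBit_lor, testBit_one_shiftLeft, Bool.and_eq_true,
    Bool.or_eq_true, testBit_mask, Finset.mem_erase, Finset.mem_union, mem_maskSet, and_comm,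
    Bool.not_eq_true', decide_eq_false_iff_not, code_injective.eq_iff]

theorem mem_exchanges {z : ℕ × ℕ} (hz : z ∈ circuits) {σ : Finset Label} {v : Label}
    (hP : maskSet z.1 ⊆ σ) (hv : v ∈ maskSet z.1) :
    mask ((σ ∪ maskSet z.2).erase v) ∈ exchanges z (mask σ) := by
  have h : Nat.beq (Nat.land z.1 (mask σ)) z.1 = true := by
    rw [← mask_maskSet (lt_of_mem_circuits z hz).1]
    have : Nat.land (mask (maskSet z.1)) (mask σ) = mask (maskSet z.1) := by
      apply Nat.eq_of_testBit_eq
      intro k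
      rw [testBit_land]
      by_cases hk : k < 12
      · obtain ⟨w, rfl⟩ := exists_code_eq hk
        rw [Bool.eq_iff_iff, Bool.and_eq_true, testBit_mask, testBit_mask]
        exact and_iff_left_of_imp fun h => hP h
      · rw [testBit_of_le (mask_lt _) (not_lt.mp hk)]; rfl
    rw [this]; simp
  rw [exchanges, h, cond_true, ← diff_lor_mask (lt_of_mem_circuits z hz).2]
  have key : ∀ l : List ℕ, code v ∈ l → diff (Nat.lor (mask σ) z.2) (Nat.shiftLeft 1 (code v)) ∈
      foldR (fun k acc => bif bit z.1 k then
        diff (Nat.lor (mask σ) z.2) (Nat.shiftLeft 1 k) :: acc else acc) [] l := by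
    intro l
    induction l with
    | nil => intro h; simp at h
    | cons a l ih =>
      intro h
      rw [foldR_cons]
      rcases List.mem_cons.mp h with rfl | h
      · rw [bit_eq, mem_maskSet.mp hv, cond_true]
        exact List.mem_cons_self
      · cases bit z.1 a
        · exact ih h
        · exact List.mem_cons_of_mem _ (ih h)
  exact key _ (code_mem_indices v)

theorem mem_exchanges_self {z : ℕ × ℕ} {σ : Finset Label} (hP : ¬ maskSet z.1 ⊆ σ) :
    mask σ ∈ exchanges z (mask σ) := by
  have h : Nat.beq (Nat.land z.1 (mask σ)) z.1 = false := by
    rw [Bool.eq_false_iff]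
    intro h
    have := maskSet_subset_of_land h
    rw [maskSet_mask] at this
    exact hP this
  rw [exchanges, h]
  exact List.mem_cons_self

theorem testBit_flipCode {c : ℕ} {z : ℕ × ℕ} {σ : Finset Label} (hσ : σ ∈ family c) {m : ℕ}
    (hm : m ∈ exchanges z (mask σ)) : (flipCode c z).testBit m = true := by
  rw [flipCode, bits_eq, testBit_codeList, List.mem_flatMap]
  refine ⟨mask σ, mem_memberList.mpr ⟨σ, rfl, ?_⟩, hm⟩
  rw [← family_clearLow] at hσ
  exact (mem_family.mp hσ).2

def compatCheck (hs : List ℕ) (c : ℕ) : Bool :=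
  allR (fun z => bif Nat.beq (Nat.land c (supersets hs z.2)) 0 then true
    else Nat.beq (Nat.land c (supersets hs z.1)) 0) circuits

/-- every circuit in `l` has its negative part in some member of `c` -/
def farkasCheck (hs : List ℕ) (c : ℕ) (l : List (ℕ × ℕ)) : Bool :=
  allR (fun z => bif Nat.beq (Nat.land c (supersets hs z.2)) 0 then false else true) l

def countBit (l : List ℕ) (k : ℕ) : ℕ := foldR (fun m acc => bif bit m k then acc + 1 else acc) 0 l

def flipCheck (hs : List ℕ) (trees w : ℕ) (z : ℕ × ℕ) (l : List (ℕ × ℕ)) : Bool :=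
  force (regularCode hs trees w) fun c => force (flipCode c z) fun c' =>
    (Nat.beq (Nat.land c' trees) c' && compatCheck hs c') && (farkasCheck hs c' l &&
    allR (fun k => Nat.beq (countBit (l.map Prod.fst) k) (countBit (l.map Prod.snd) k)) indices)

theorem land_supersets_ne {c P : ℕ} (h : Nat.land c (treeCode hasTable) = c) :
    Nat.beq (Nat.land c (supersets hasTable P)) 0 = false ↔ ∃ σ ∈ family c, maskSet P ⊆ σ := by
  constructor
  · intro h1
    have h2 : Nat.land c (supersets hasTable P) ≠ 0 := by
      intro h2; rw [h2] at h1; simp at h1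
    obtain ⟨m, hm⟩ := Nat.exists_testBit_of_ne_zero h2
    rw [testBit_land, Bool.and_eq_true] at hm
    have h3 := hm.1
    rw [← h, testBit_land, Bool.and_eq_true] at h3
    have h4 : m < 2 ^ 12 := by
      by_contra h5
      rw [testBit_treeCode_of_le (not_lt.mp h5)] at h3
      simp at h3
    rw [← mask_maskSet h4] at hm h3
    exact ⟨maskSet m, mem_family.mpr ⟨(testBit_treeCode_mask _).mp h3.2, hm.1⟩,
      (testBit_supersets _ _).mp hm.2⟩
  · rintro ⟨σ, hσ, hP⟩
    rw [Bool.eq_false_iff]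
    intro h1
    have h2 : (Nat.land c (supersets hasTable P)).testBit (mask σ) = true := by
      rw [testBit_land, (mem_family.mp hσ).2, (testBit_supersets _ _).mpr hP]; rfl
    rw [Nat.eq_of_beq_eq_true h1] at h2
    simp at h2

/-- Covering is inherited: a point of a cell that contains the positive part is pushed along the
circuit into one of the exchanged cells, and the other cells are kept. -/
theorem isTriangulation_flip {c : ℕ} (hc : IsTriangulation cayleyColumns (family c)) {z : ℕ × ℕ}
    (hz : z ∈ circuits)
    (h1 : Nat.land (flipCode c z) (treeCode hasTable) = flipCode c z)
    (h2 : compatCheck hasTable (flipCode c z) = true) :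
    IsTriangulation cayleyColumns (family (flipCode c z)) := by
  have hmem : ∀ {σ τ : Finset Label}, σ ∈ family c → mask τ ∈ exchanges z (mask σ) →
      τ ∈ family (flipCode c z) := by
    intro σ τ hσ hτ
    have h3 := testBit_flipCode hσ hτ
    have h4 := h3
    rw [← h1, testBit_land, Bool.and_eq_true] at h4
    exact mem_family.mpr ⟨(testBit_treeCode_mask τ).mp h4.2, h3⟩
  refine isCircuitSystem.isTriangulation (fun σ hσ => (mem_family.mp hσ).1.2)
    (fun σ hσ => (mem_family.mp hσ).1.affineSpan_eq) ?_ ?_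
  · rintro σ hσ τ hτ _ _ ⟨y, hy, rfl, rfl⟩ ⟨hP, hN⟩
    have h3 := allR_eq_true.mp h2 y hy
    rw [(land_supersets_ne h1).mpr ⟨τ, hτ, hN⟩, (land_supersets_ne h1).mpr ⟨σ, hσ, hP⟩] at h3
    simp at h3
  · intro x hx
    rw [← hc.cover] at hx
    obtain ⟨σ, hσ, hx⟩ := Set.mem_iUnion₂.mp hx
    by_cases hP : maskSet z.1 ⊆ σ
    · obtain ⟨v, hv, hx⟩ := isCircuitSystem.exists_exchange ⟨z, hz, rfl, rfl⟩ hx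
      exact ⟨_, hmem hσ (mem_exchanges hz hP hv), hx⟩
    · exact ⟨σ, hmem hσ (mem_exchanges_self hP), hx⟩

theorem countBit_eq (l : List ℕ) (v : Label) (ω : ℝ) :
    (countBit l (code v) : ℝ) * ω = (l.map fun m => if v ∈ maskSet m then ω else 0).sum := by
  unfold countBit
  induction l with
  | nil => simp
  | cons m l ih =>
    rw [foldR_cons, List.map_cons, List.sum_cons, ← ih, bit_eq]
    cases h : m.testBit (code v)
    · rw [if_neg (by rw [mem_maskSet, h]; simp)]; simp
    · rw [if_pos (mem_maskSet.mpr h), cond_true]; push_cast; ring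

theorem sum_countBit (l : List ℕ) (ω : Label → ℝ) :
    ∑ v, (countBit l (code v) : ℝ) * ω v = (l.map fun m => ∑ v ∈ maskSet m, ω v).sum := by
  simp only [countBit_eq]
  induction l with
  | nil => simp
  | cons m l ih => simp [Finset.sum_add_distrib, ih]

/-- A Farkas certificate. Heights inducing the family satisfy ω(N) < ω(P) for each listed circuit,
because N lies in a member. But the parts P and the parts N contain every label equally often, so
the two total heights agree. -/
theorem not_isRegularTriangulation {c : ℕ} {l : List (ℕ × ℕ)} (hl : l ≠ [])
    (hlc : ∀ z ∈ l, z ∈ circuits) (h1 : Nat.land c (treeCode hasTable) = c)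
    (h2 : farkasCheck hasTable c l = true)
    (h3 : ∀ v : Label, countBit (l.map Prod.fst) (code v) = countBit (l.map Prod.snd) (code v)) :
    ¬ IsRegularTriangulation cayleyColumns (family c) := by
  rintro ⟨-, ω, hω⟩
  have hlt : ∀ z ∈ l, ∑ v ∈ maskSet z.2, ω v < ∑ v ∈ maskSet z.1, ω v := by
    intro z hz
    have h4 := allR_eq_true.mp h2 z hz
    have h5 : Nat.beq (Nat.land c (supersets hasTable z.2)) 0 = false := by
      cases h6 : Nat.beq (Nat.land c (supersets hasTable z.2)) 0
      · rfl
      · rw [h6] at h4; simp at h4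
    obtain ⟨σ, hσ, hN⟩ := (land_supersets_ne h1).mp h5
    refine isCircuitSystem.lt_of_regularCells (mem_family.mp hσ).1.2 ?_ ⟨z, hlc z hz, rfl, rfl⟩ hN
    rw [← hω]
    exact hσ
  have h4 : (l.map fun z => ∑ v ∈ maskSet z.2, ω v).sum <
      (l.map fun z => ∑ v ∈ maskSet z.1, ω v).sum := List.sum_lt_sum_of_ne_nil hl _ _ hlt
  have h5 := sum_countBit (l.map Prod.fst) ω
  have h6 := sum_countBit (l.map Prod.snd) ω
  rw [List.map_map] at h5 h6
  have h7 : ∑ v, (countBit (l.map Prod.fst) (code v) : ℝ) * ω v =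
      ∑ v, (countBit (l.map Prod.snd) (code v) : ℝ) * ω v := by simp only [h3]
  rw [h5, h6] at h7
  exact h4.ne' h7

theorem flip_of_check {w : ℕ} {z : ℕ × ℕ} {l : List (ℕ × ℕ)}
    (hw : regularCheck hasTable (treeCode hasTable) w = true) (hz : z ∈ circuits) (hl : l ≠ [])
    (hlc : ∀ z ∈ l, z ∈ circuits)
    (h : flipCheck hasTable (treeCode hasTable) w z l = true) :
    IsTriangulation cayleyColumns
      (family (flipCode (regularCode hasTable (treeCode hasTable) w) z)) ∧
    ¬ IsRegularTriangulation cayleyColumns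
      (family (flipCode (regularCode hasTable (treeCode hasTable) w) z)) := by
  rw [flipCheck, force_eq, force_eq] at h
  simp only [Bool.and_eq_true] at h
  obtain ⟨⟨h1, h2⟩, h3, h4⟩ := h
  have h1 := Nat.eq_of_beq_eq_true h1
  refine ⟨isTriangulation_flip (isRegularTriangulation_of_check hw).1 hz h1 h2,
    not_isRegularTriangulation hl hlc h1 h3 fun v => ?_⟩
  exact Nat.eq_of_beq_eq_true (allR_eq_true.mp h4 _ (code_mem_indices v))

/-! ### The list of triangulations -/

/-- weights that induce the regular triangulations, one for each symmetry class -/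
def heights : List ℕ :=
  [0x340432410041, 0x144214344440, 0x021130320300, 0x044050442421, 0x344340033214, 0x044030340220,
    0x023013200230, 0x420401024044, 0x353054510130, 0x155524440520, 0x024000503550, 0x440103304114,
    0x324411042413, 0x023032131331, 0x340204433342, 0x042313431330, 0x003120030313, 0x201330012301,
    0x203200010203, 0x204210131104, 0x613342106514, 0x300221123300, 0x104451040220, 0x421320033430,
    0x413400204134, 0x404214342304, 0x202110003013, 0x033210323330, 0x311301133013, 0x503053230542,
    0x202050450532, 0x200303032003, 0x031213210031, 0x142512420043, 0x422341212400, 0x003120300020,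
    0x003320024034, 0x043420140312, 0x310012300100, 0x330123031321, 0x341043313400, 0x103320203030,
    0x441042140404, 0x222310012221, 0x320030012130, 0x403032403230, 0x023330301123, 0x112303330203]

/-- For each symmetry class of non-regular triangulations: the weights of a regular triangulation,
a flip that leads to a non-regular one, and circuits which certify that it is not regular. -/
def flips : List (ℕ × (ℕ × ℕ) × List (ℕ × ℕ)) :=
  [(0x044050442421, (1088, 640), [(20, 34), (770, 2116), (1088, 640), (2208, 1296)]),
    (0x023013200230, (20, 34), [(20, 34), (545, 1036), (138, 81), (1088, 640)]),
    (0x044050442421, (81, 138), [(81, 138), (770, 2116), (1036, 545), (2208, 1296)]),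
    (0x440103304114, (770, 2116), [(81, 138), (770, 2116), (1036, 545), (2208, 1296)]),
    (0x044030340220, (2116, 770), [(545, 1036), (1296, 2208), (138, 81), (2116, 770)]),
    (0x413400204134, (2180, 1282), [(97, 140), (784, 2144), (1034, 529), (2180, 1282)]),
    (0x142512420043, (84, 266), [(84, 266), (642, 2113), (1288, 672), (2081, 1044)])]

def regularCodes (hs : List ℕ) (trees : ℕ) : List ℕ := heights.map (regularCode hs trees)

def nonregularCodes (hs : List ℕ) (trees : ℕ) : List ℕ :=
  flips.map fun x => flipCode (regularCode hs trees x.1) x.2.1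

/-- the transpositions `(0 1)`, `(1 2)` and `(2 3)` of rows and columns, as permutations of
the labels -/
def generators : List (List (ℕ × ℕ)) :=
  [[(0, 3), (1, 4), (2, 5), (3, 0), (4, 1), (5, 2), (6, 7), (7, 6), (8, 8), (9, 10), (10, 9),
      (11, 11)],
    [(0, 1), (1, 0), (2, 2), (3, 6), (4, 7), (5, 8), (6, 3), (7, 4), (8, 5), (9, 9), (10, 11),
      (11, 10)],
    [(0, 0), (1, 2), (2, 1), (3, 3), (4, 5), (5, 4), (6, 9), (7, 10), (8, 11), (9, 6), (10, 7),
      (11, 8)]]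

/-- a Hamiltonian path in the Cayley graph of the symmetric group -/
def path : List (List (ℕ × ℕ)) :=
  [0, 1, 0, 1, 0, 2, 0, 1, 0, 1, 0, 2, 0, 1, 2, 1, 0, 1, 0, 1, 2, 1, 0].map
    fun k => generators.getD k []

def permute (g : List (ℕ × ℕ)) (m : ℕ) : ℕ :=
  foldR (fun p acc => bif bit m p.1 then Nat.lor (Nat.shiftLeft 1 p.2) acc else acc) 0 g

inductive SearchTree where
  | leaf : SearchTree
  | node : SearchTree → ℕ → SearchTree → SearchTree

namespace SearchTree

/-- A code that is already present is not stored again, so an orbit with nontrivial stabilizer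
contributes each family once. -/
noncomputable def insert {α : Type} (x : ℕ) (t : SearchTree) : (SearchTree → α) → α :=
  SearchTree.rec (fun K => K (.node .leaf x .leaf)) (fun l y r il ir K =>
    bif Nat.blt x y then il fun l' => K (.node l' y r) else
    bif Nat.blt y x then ir fun r' => K (.node l y r') else K (.node l y r)) t

noncomputable def mem (x : ℕ) (t : SearchTree) : Bool :=
  SearchTree.rec false (fun _ y _ il ir =>
    bif Nat.blt x y then il else bif Nat.blt y x then ir else true) t

noncomputable def toList (t : SearchTree) : List ℕ → List ℕ :=
  SearchTree.rec (fun acc => acc) (fun _ y _ il ir acc => il (y :: ir acc)) t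

end SearchTree

/-- Insert the code of the family `l` and of its images along the path `gs`. -/
noncomputable def orbitInsert {α : Type} (gs : List (List (ℕ × ℕ))) (f : SearchTree → α) :
    List ℕ → SearchTree → α :=
  foldR (fun g K l t => mark (codeList l) fun c => SearchTree.insert c t fun t' =>
    forceList (l.map (permute g)) fun l' => K l' t')
    (fun l t => mark (codeList l) fun c => SearchTree.insert c t f) gs

noncomputable def orbitTree {α : Type} (gs : List (List (ℕ × ℕ))) (cs : List ℕ)
    (f : SearchTree → α) : α :=
  foldR (fun c K t => bits c fun l => orbitInsert gs K l t) f cs SearchTree.leaf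

def increasing (l : List ℕ) : Bool :=
  foldR (fun x K y => force x fun x' => bif Nat.blt y x' then K x' else false) (fun _ => true) l 0

def distinct (l : List ℕ) : Bool :=
  List.rec true (fun a l ih => bif allR (fun b => !Nat.beq a b) l then ih else false) l

/-- the number of members of `l` that contain both `v` and `w` -/
def common (l : List ℕ) (v w : ℕ) : ℕ :=
  foldR (fun m acc => bif bit m v then bif bit m w then acc + 1 else acc else acc) 0 l

def invariantCode (l : List ℕ) : ℕ :=
  foldR (fun v acc =>
    foldR (fun w a => bif Nat.beq (rowOf v) (rowOf w) then common l v w ^ 2 + a else a) 0 indices *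
    foldR (fun w a => common l v w ^ 2 + a) 0 indices + acc) 0 indices

theorem regularCheck_heights : (forceList hasTable fun hs => force (treeCode hs) fun trees =>
    allR (regularCheck hs trees) heights) = true := by
  decide +kernel

theorem flipCheck_flips : (forceList hasTable fun hs => force (treeCode hs) fun trees =>
    allR (fun x => flipCheck hs trees x.1 x.2.1 x.2.2) flips) = true := by
  decide +kernel

/-- Increasing member lists have no repetitions, which makes `common` a count of members. -/
theorem invariant_check : (forceList hasTable fun hs => force (treeCode hs) fun trees =>
    forceList (regularCodes hs trees ++ nonregularCodes hs trees) fun cs =>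
    allR (fun c => bits c increasing) cs &&
    forceList (cs.map fun c => bits c invariantCode) distinct) = true := by
  decide +kernel

/-- The lengths and the strict monotonicity give the numbers of distinct families in the orbits; the
search gives completeness. Intersecting with `trees` removes the fingerprints in the low digits. -/
noncomputable def listCheck (hs : List ℕ) (trees : ℕ) : Bool :=
  orbitTree path (regularCodes hs trees) fun t =>
    orbitTree path (nonregularCodes hs trees) fun u =>
      ((increasing ((t.toList []).map (Nat.land trees)) &&
      Nat.beq (t.toList []).length 1002) &&
      (increasing ((u.toList []).map (Nat.land trees)) &&
      Nat.beq (u.toList []).length 66)) &&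
      searchCheck hs trees sampleFlows fun x => mark (clearLow x) fun y => t.mem y || u.mem y

theorem listCheck_hasTable : (forceList hasTable fun hs => force (treeCode hs) fun trees =>
    listCheck hs trees) = true := by
  decide +kernel

/-! ### Symmetries -/

theorem label_ext {v w : Label} (h1 : v.1 = w.1) (h2 : v.2.1 = w.2.1) : v = w := by
  obtain ⟨i, j, hj⟩ := v
  obtain ⟨i', j', hj'⟩ := w
  obtain rfl : i = i' := h1
  obtain rfl : j = j' := h2
  rfl

/-- the action of the permutations of the vertices of the tetrahedron on the labels -/
def relabel (π : Equiv.Perm (Fin 4)) : Equiv.Perm Label where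
  toFun v := ⟨π v.1, π v.2.1, fun h => v.2.2 (π.injective h)⟩
  invFun v := ⟨π.symm v.1, π.symm v.2.1, fun h => v.2.2 (π.symm.injective h)⟩
  left_inv _ := label_ext (π.symm_apply_apply _) (π.symm_apply_apply _)
  right_inv _ := label_ext (π.apply_symm_apply _) (π.apply_symm_apply _)

theorem relabel_mem (π : Equiv.Perm (Fin 4)) : relabel π ∈ blockPerms :=
  fun _ _ => π.apply_eq_iff_eq

/-- the permutation of coordinates that induces `relabel π` -/
noncomputable def coordinateEquiv (π : Equiv.Perm (Fin 4)) :
    ((Fin 4 → ℝ) × (Fin 4 → ℝ)) ≃ₗ[ℝ] ((Fin 4 → ℝ) × (Fin 4 → ℝ)) :=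
  (LinearEquiv.funCongrLeft ℝ ℝ π.symm).prodCongr (LinearEquiv.funCongrLeft ℝ ℝ π.symm)

theorem cayleyColumns_relabel (π : Equiv.Perm (Fin 4)) (v : Label) :
    cayleyColumns (relabel π v) = coordinateEquiv π (cayleyColumns v) := by
  have h : ∀ j : Fin 4, (Pi.single (π j) 1 : Fin 4 → ℝ) =
      LinearEquiv.funCongrLeft ℝ ℝ π.symm (Pi.single j 1) := by
    intro j
    ext k
    simp [LinearEquiv.funCongrLeft_apply, LinearMap.funLeft_apply, Pi.single_apply,
      Equiv.symm_apply_eq]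
  exact Prod.ext (h v.2.1) (h v.1)

/-- the image of a family of sets -/
def move (g : Equiv.Perm Label) (T : Finset (Finset Label)) : Finset (Finset Label) :=
  T.image fun σ => σ.image g

theorem move_mul (g h : Equiv.Perm Label) (T : Finset (Finset Label)) :
    move (g * h) T = move g (move h T) := by
  simp only [move, Finset.image_image]
  refine Finset.image_congr fun σ _ => ?_
  simp [Finset.image_image]

theorem move_one (T : Finset (Finset Label)) : move 1 T = T := by
  simp [move]

/-- `T'` is the image of `T` under a symmetry of the tetrahedron -/
def Moved (T T' : Finset (Finset Label)) : Prop := ∃ π, T' = move (relabel π) T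

theorem Moved.refl (T : Finset (Finset Label)) : Moved T T :=
  ⟨1, (move_one T).symm⟩

theorem Moved.trans {T T' T'' : Finset (Finset Label)} (h : Moved T T') (h' : Moved T' T'') :
    Moved T T'' := by
  obtain ⟨π, rfl⟩ := h
  obtain ⟨ρ, rfl⟩ := h'
  exact ⟨ρ * π, (move_mul _ _ T).symm⟩

theorem Moved.symm {T T' : Finset (Finset Label)} (h : Moved T T') : Moved T' T := by
  obtain ⟨π, rfl⟩ := h
  refine ⟨π⁻¹, ?_⟩
  rw [← move_mul, show relabel π⁻¹ * relabel π = 1 from Equiv.ext fun v => (relabel π).left_inv v,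
    move_one]

theorem Moved.isTriangulation {T T' : Finset (Finset Label)} (h : Moved T T')
    (hT : IsTriangulation cayleyColumns T) : IsTriangulation cayleyColumns T' := by
  obtain ⟨π, rfl⟩ := h
  exact hT.relabel (relabel π) (coordinateEquiv π) (cayleyColumns_relabel π)

theorem Moved.isRegularTriangulation {T T' : Finset (Finset Label)} (h : Moved T T')
    (hT : IsRegularTriangulation cayleyColumns T) : IsRegularTriangulation cayleyColumns T' := by
  obtain ⟨π, rfl⟩ := h
  exact hT.relabel (relabel π) (coordinateEquiv π) (cayleyColumns_relabel π)

theorem Moved.symmetryEquivalent {T T' : Finset (Finset Label)} (h : Moved T T') :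
    SymmetryEquivalent T T' := by
  obtain ⟨π, rfl⟩ := h
  exact ⟨relabel π, relabel_mem π, rfl⟩

theorem _root_.SymmetryEquivalent.refl (T : Finset (Finset Label)) : SymmetryEquivalent T T :=
  ⟨1, one_mem _, (move_one T).symm⟩

theorem _root_.SymmetryEquivalent.symm {T T' : Finset (Finset Label)} (h : SymmetryEquivalent T T') :
    SymmetryEquivalent T' T := by
  obtain ⟨g, hg, rfl⟩ := h
  refine ⟨g⁻¹, inv_mem hg, ?_⟩
  have := move_mul g⁻¹ g T
  rw [inv_mul_cancel, move_one] at this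
  exact this

theorem _root_.SymmetryEquivalent.trans {T T' T'' : Finset (Finset Label)} (h : SymmetryEquivalent T T')
    (h' : SymmetryEquivalent T' T'') : SymmetryEquivalent T T'' := by
  obtain ⟨g, hg, rfl⟩ := h
  obtain ⟨g', hg', rfl⟩ := h'
  exact ⟨g' * g, mul_mem hg' hg, (move_mul g' g T).symm⟩

theorem symmetryClass_eq_iff {T T' : Finset (Finset Label)}
    (hT' : IsTriangulation cayleyColumns T') :
    symmetryClass T = symmetryClass T' ↔ SymmetryEquivalent T T' := by
  constructor
  · intro h
    have : T' ∈ symmetryClass T := h ▸ ⟨hT', SymmetryEquivalent.refl T'⟩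
    exact this.2
  · intro h
    ext S
    exact and_congr_right fun _ => ⟨h.symm.trans, h.trans⟩

/-! ### An invariant of the symmetry classes -/

/-- the number of members of `T` that contain both `v` and `w` -/
def incidence (T : Finset (Finset Label)) (v w : Label) : ℕ :=
  (T.filter fun σ => v ∈ σ ∧ w ∈ σ).card

/-- It depends only on incidence numbers and on the partition into blocks, so every block-preserving
permutation leaves it unchanged. This particular expression is fine enough to separate all 55
representatives (`nodup_invariants`). -/
def invariant (T : Finset (Finset Label)) : ℕ :=
  ∑ v, (∑ w, if v.1 = w.1 then incidence T v w ^ 2 else 0) * ∑ w, incidence T v w ^ 2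

theorem incidence_move (g : Equiv.Perm Label) (T : Finset (Finset Label)) (v w : Label) :
    incidence (move g T) (g v) (g w) = incidence T v w := by
  rw [incidence, move, Finset.filter_image, Finset.card_image_of_injective _
    (Finset.image_injective g.injective), incidence]
  simp only [g.injective.mem_finset_image]

theorem invariant_move {g : Equiv.Perm Label} (hg : g ∈ blockPerms) (T : Finset (Finset Label)) :
    invariant (move g T) = invariant T := by
  rw [invariant, ← Equiv.sum_comp g, invariant]
  refine Finset.sum_congr rfl fun v _ => ?_
  rw [← Equiv.sum_comp g, ← Equiv.sum_comp g fun w => incidence (move g T) (g v) w ^ 2]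
  simp only [incidence_move, hg v _]

theorem _root_.SymmetryEquivalent.invariant_eq {T T' : Finset (Finset Label)}
    (h : SymmetryEquivalent T T') : invariant T' = invariant T := by
  obtain ⟨g, hg, rfl⟩ := h
  exact invariant_move hg T

/-- `l` lists the codes of the members of `T` -/
def Enumerates (l : List ℕ) (T : Finset (Finset Label)) : Prop :=
  ∀ m, m ∈ l ↔ ∃ σ ∈ T, mask σ = m

theorem common_eq {l : List ℕ} {T : Finset (Finset Label)} (h : Enumerates l T) (hl : l.Nodup)
    (v w : Label) : common l (code v) (code w) = incidence T v w := by
  have h1 : common l (code v) (code w) =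
      (l.filter fun m => m.testBit (code v) && m.testBit (code w)).length := by
    unfold common
    clear h hl
    induction l with
    | nil => rfl
    | cons m l ih =>
      rw [foldR_cons, ih, bit_eq, bit_eq, List.filter_cons]
      cases m.testBit (code v) <;> cases m.testBit (code w) <;> simp
  have h2 : (l.filter fun m => m.testBit (code v) && m.testBit (code w)).toFinset =
      (T.filter fun σ => v ∈ σ ∧ w ∈ σ).image mask := by
    ext m
    simp only [List.mem_toFinset, List.mem_filter, Finset.mem_image, Finset.mem_filter,
      Bool.and_eq_true, h m]
    constructor
    · rintro ⟨⟨σ, hσ, rfl⟩, h3, h4⟩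
      exact ⟨σ, ⟨hσ, (testBit_mask σ v).mp h3, (testBit_mask σ w).mp h4⟩, rfl⟩
    · rintro ⟨σ, ⟨hσ, h3, h4⟩, rfl⟩
      exact ⟨⟨σ, hσ, rfl⟩, (testBit_mask σ v).mpr h3, (testBit_mask σ w).mpr h4⟩
  rw [h1, ← List.toFinset_card_of_nodup (hl.filter _), h2,
    Finset.card_image_of_injective _ mask_injective, incidence]

theorem foldR_add_indices (G : ℕ → ℕ) :
    foldR (fun k acc => G k + acc) 0 indices = ∑ v : Label, G (code v) := by
  simpa using foldR_indices (fun _ => true) G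

theorem invariantCode_eq {l : List ℕ} {T : Finset (Finset Label)} (h : Enumerates l T)
    (hl : l.Nodup) : invariantCode l = invariant T := by
  have h1 := foldR_add_indices fun v =>
    foldR (fun w a => bif Nat.beq (rowOf v) (rowOf w) then common l v w ^ 2 + a else a) 0 indices *
    foldR (fun w a => common l v w ^ 2 + a) 0 indices
  rw [invariantCode, h1, invariant]
  refine Finset.sum_congr rfl fun v _ => ?_
  have h2 := foldR_indices (fun w => Nat.beq (rowOf (code v)) (rowOf w))
    fun w => common l (code v) w ^ 2
  have h3 := foldR_add_indices fun w => common l (code v) w ^ 2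
  rw [h2, h3]
  simp only [common_eq h hl, rowOf_code, Nat.beq_eq, Fin.val_inj]

theorem lt_of_increasing {l : List ℕ} (h : increasing l = true) : l.Pairwise (· < ·) := by
  have key : ∀ (l : List ℕ) (y : ℕ), foldR (fun x K y => force x fun x' =>
      bif Nat.blt y x' then K x' else false) (fun _ => true) l y = true →
      l.Pairwise (· < ·) ∧ ∀ x ∈ l, y < x := by
    intro l
    induction l with
    | nil => simp
    | cons x l ih =>
      intro y h
      rw [foldR_cons, force_eq] at h
      cases h1 : Nat.blt y x
      · rw [h1] at h; simp at h
      · rw [h1, cond_true] at h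
        obtain ⟨h2, h3⟩ := ih x h
        have hyx : y < x := by simpa using h1
        refine ⟨List.pairwise_cons.mpr ⟨h3, h2⟩, fun z hz => ?_⟩
        rcases List.mem_cons.mp hz with rfl | hz
        · exact hyx
        · exact hyx.trans (h3 z hz)
  exact (key l 0 h).1

theorem nodup_of_increasing {l : List ℕ} (h : increasing l = true) : l.Nodup :=
  (lt_of_increasing h).imp fun h => h.ne

theorem nodup_of_distinct {l : List ℕ} (h : distinct l = true) : l.Nodup := by
  induction l with
  | nil => exact List.nodup_nil
  | cons a l ih =>
    have h' : (bif allR (fun b => !Nat.beq a b) l then distinct l else false) = true := h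
    cases h1 : allR (fun b => !Nat.beq a b) l
    · rw [h1] at h'; simp at h'
    · rw [h1, cond_true] at h'
      refine List.nodup_cons.mpr ⟨fun ha => ?_, ih h'⟩
      have := allR_eq_true.mp h1 a ha
      simp at this

/-! ### Orbits -/

theorem enumerates_memberList {c : ℕ} (hc : Nat.land c (treeCode hasTable) = c) :
    Enumerates (memberList c) (family c) := by
  intro m
  rw [mem_memberList]
  constructor
  · rintro ⟨σ, rfl, h⟩
    rw [testBit_clearLow, Bool.and_eq_true, ← hc, testBit_land, Bool.and_eq_true] at h
    exact ⟨σ, mem_family.mpr ⟨(testBit_treeCode_mask σ).mp h.2.2, h.2.1⟩, rfl⟩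
  · rintro ⟨σ, hσ, rfl⟩
    rw [← family_clearLow] at hσ
    exact ⟨σ, rfl, (mem_family.mp hσ).2⟩

theorem family_codeList {l : List ℕ} {T : Finset (Finset Label)} (h : Enumerates l T)
    (hT : ∀ σ ∈ T, IsTree σ) : family (codeList l) = T := by
  ext σ
  rw [mem_family, testBit_codeList, h]
  constructor
  · rintro ⟨-, τ, hτ, e⟩
    exact mask_injective e ▸ hτ
  · exact fun hσ => ⟨hT σ hσ, σ, hσ, rfl⟩

/-- `g` lists the pairs of codes of `v` and `relabel π v` -/
def Represents (g : List (ℕ × ℕ)) (π : Equiv.Perm (Fin 4)) : Prop :=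
  (∀ p ∈ g, ∃ v, p = (code v, code (relabel π v))) ∧ ∀ v, (code v, code (relabel π v)) ∈ g

instance (g : List (ℕ × ℕ)) (π : Equiv.Perm (Fin 4)) : Decidable (Represents g π) :=
  inferInstanceAs (Decidable (_ ∧ _))

/-- It is enough that each step is a symmetry. That the path reaches the whole group enters only
through the numerical outcome of `listCheck`. -/
theorem exists_represents : ∀ g ∈ path, ∃ π, Represents g π := by
  have h : ∀ k < 3, Represents (generators.getD k [])
      (([Equiv.swap 0 1, Equiv.swap 1 2, Equiv.swap 2 3] : List (Equiv.Perm (Fin 4))).getD k 1) := by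
    decide +kernel
  intro g hg
  obtain ⟨k, hk, rfl⟩ := List.mem_map.mp hg
  refine ⟨_, h k ?_⟩
  revert k
  decide

theorem testBit_permute (g : List (ℕ × ℕ)) (m k : ℕ) :
    (permute g m).testBit k = true ↔ ∃ p ∈ g, m.testBit p.1 = true ∧ k = p.2 := by
  unfold permute
  induction g with
  | nil => simp
  | cons p g ih =>
    rw [foldR_cons, bit_eq]
    simp only [List.exists_mem_cons_iff, ← ih]
    cases m.testBit p.1
    · simp
    · rw [cond_true, testBit_lor, testBit_one_shiftLeft, Bool.or_eq_true, decide_eq_true_eq]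
      simp

theorem permute_mask {g : List (ℕ × ℕ)} {π : Equiv.Perm (Fin 4)} (h : Represents g π)
    (σ : Finset Label) : permute g (mask σ) = mask (σ.image (relabel π)) := by
  rw [← mask_maskSet (m := permute g (mask σ)) (lt_two_pow_twelve fun k hk => by
    rw [← Bool.not_eq_true, testBit_permute]
    rintro ⟨p, hp, -, rfl⟩
    obtain ⟨v, rfl⟩ := h.1 p hp
    exact absurd (code_lt (relabel π v)) (not_lt.mpr hk))]
  congr 1
  ext w
  rw [mem_maskSet, testBit_permute, Finset.mem_image]
  constructor
  · rintro ⟨p, hp, h1, h2⟩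
    obtain ⟨v, rfl⟩ := h.1 p hp
    exact ⟨v, (testBit_mask σ v).mp h1, code_injective h2.symm⟩
  · rintro ⟨v, hv, rfl⟩
    exact ⟨_, h.2 v, (testBit_mask σ v).mpr hv, rfl⟩

theorem Enumerates.permute {g : List (ℕ × ℕ)} {π : Equiv.Perm (Fin 4)} (h : Represents g π)
    {l : List ℕ} {T : Finset (Finset Label)} (hl : Enumerates l T) :
    Enumerates (l.map (permute g)) (move (relabel π) T) := by
  intro m
  simp only [List.mem_map, move, Finset.mem_image, hl _]
  constructor
  · rintro ⟨_, ⟨σ, hσ, rfl⟩, rfl⟩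
    exact ⟨_, ⟨σ, hσ, rfl⟩, (permute_mask h σ).symm⟩
  · rintro ⟨_, ⟨σ, hσ, rfl⟩, rfl⟩
    exact ⟨_, ⟨σ, hσ, rfl⟩, permute_mask h σ⟩

namespace SearchTree

theorem insert_eq {α : Type} (x : ℕ) (t : SearchTree) (K : SearchTree → α) :
    insert x t K = K (insert x t id) := by
  induction t generalizing α K with
  | leaf => rfl
  | node l y r ihl ihr =>
    have e : ∀ {β : Type} (K : SearchTree → β), insert x (.node l y r) K =
        bif Nat.blt x y then insert x l fun l' => K (.node l' y r) else
        bif Nat.blt y x then insert x r fun r' => K (.node l y r') else K (.node l y r) :=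
      fun _ => rfl
    rw [e, e, ihl, ihr, ihl (fun l' => id (node l' y r)), ihr (fun r' => id (node l y r'))]
    cases Nat.blt x y <;> cases Nat.blt y x <;> rfl

theorem mem_toList_node {l r : SearchTree} {y z : ℕ} :
    z ∈ (node l y r).toList [] ↔ z ∈ l.toList [] ∨ z = y ∨ z ∈ r.toList [] := by
  have key : ∀ (t : SearchTree) (acc : List ℕ), z ∈ t.toList acc ↔ z ∈ t.toList [] ∨ z ∈ acc := by
    intro t
    induction t with
    | leaf => intro acc; exact (or_iff_right (by simp [toList])).symm
    | node l y r ihl ihr =>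
      intro acc
      have e : ∀ acc, (node l y r).toList acc = l.toList (y :: r.toList acc) := fun _ => rfl
      rw [e, e, ihl, ihl (y :: r.toList []), List.mem_cons, List.mem_cons, ihr acc]
      tauto
  have e : (node l y r).toList [] = l.toList (y :: r.toList []) := rfl
  rw [e, key, List.mem_cons]

theorem mem_toList_of_insert {x z : ℕ} {t : SearchTree} (h : z ∈ (insert x t id).toList []) :
    z = x ∨ z ∈ t.toList [] := by
  induction t with
  | leaf =>
    have h' : z ∈ (node leaf x leaf).toList [] := h
    rw [mem_toList_node] at h'
    simp only [toList, List.not_mem_nil, or_false, false_or] at h'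
    exact Or.inl h'
  | node l y r ihl ihr =>
    have e : insert x (.node l y r) id =
        bif Nat.blt x y then insert x l fun l' => node l' y r else
        bif Nat.blt y x then insert x r fun r' => node l y r' else node l y r := rfl
    rw [e, insert_eq x l, insert_eq x r] at h
    rw [mem_toList_node]
    cases h1 : Nat.blt x y
    · rw [h1, cond_false] at h
      cases h2 : Nat.blt y x
      · rw [h2, cond_false, mem_toList_node] at h
        exact Or.inr h
      · rw [h2, cond_true, mem_toList_node] at h
        tauto
    · rw [h1, cond_true, mem_toList_node] at h
      tauto

/-- Only positive answers are used, and these are correct even without an ordering of the tree. -/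
theorem mem_toList_of_mem {x : ℕ} {t : SearchTree} (h : mem x t = true) : x ∈ t.toList [] := by
  induction t with
  | leaf => exact absurd h (by simp [mem])
  | node l y r ihl ihr =>
    have h' : (bif Nat.blt x y then mem x l else bif Nat.blt y x then mem x r else true) = true := h
    rw [mem_toList_node]
    cases h1 : Nat.blt x y
    · rw [h1, cond_false] at h'
      cases h2 : Nat.blt y x
      · have h3 : ¬ x < y := by rw [← Nat.blt_eq, h1]; simp
        have h4 : ¬ y < x := by rw [← Nat.blt_eq, h2]; simp
        exact Or.inr (Or.inl (by omega))
      · rw [h2, cond_true] at h'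
        exact Or.inr (Or.inr (ihr h'))
    · rw [h1, cond_true] at h'
      exact Or.inl (ihl h')

end SearchTree

theorem exists_of_orbitInsert {α : Type} {gs : List (List (ℕ × ℕ))}
    (hgs : ∀ g ∈ gs, ∃ π, Represents g π) (f : SearchTree → α) {l : List ℕ} {t : SearchTree}
    {T : Finset (Finset Label)} (hT : IsTriangulation cayleyColumns T) (hl : Enumerates l T) :
    ∃ u, orbitInsert gs f l t = f u ∧
      ∀ y ∈ u.toList [], y ∈ t.toList [] ∨ Moved T (family y) := by
  induction gs generalizing l t T with
  | nil =>
    have e : orbitInsert [] f l t = mark (codeList l) fun c => SearchTree.insert c t f := rfl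
    refine ⟨SearchTree.insert (marked (codeList l)) t id, ?_, fun y hy => ?_⟩
    · rw [e, mark_eq, SearchTree.insert_eq]
    · rcases SearchTree.mem_toList_of_insert hy with rfl | hy
      · rw [family_marked, family_codeList hl fun σ hσ => isTree_of_mem hT hσ]
        exact Or.inr (Moved.refl T)
      · exact Or.inl hy
  | cons g gs ih =>
    have e : orbitInsert (g :: gs) f l t = mark (codeList l) fun c => SearchTree.insert c t fun t' =>
      forceList (l.map (permute g)) fun l' => orbitInsert gs f l' t' := rfl
    rw [e, mark_eq, SearchTree.insert_eq, forceList_eq]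
    obtain ⟨π, hπ⟩ := hgs g List.mem_cons_self
    have hm : Moved T (move (relabel π) T) := ⟨π, rfl⟩
    obtain ⟨u, hu, h⟩ := ih (fun g hg => hgs g (List.mem_cons_of_mem _ hg))
      (t := SearchTree.insert (marked (codeList l)) t id) (hm.isTriangulation hT) (hl.permute hπ)
    refine ⟨u, hu, fun y hy => ?_⟩
    rcases h y hy with hy | hy
    · rcases SearchTree.mem_toList_of_insert hy with rfl | hy
      · rw [family_marked, family_codeList hl fun σ hσ => isTree_of_mem hT hσ]
        exact Or.inr (Moved.refl T)
      · exact Or.inl hy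
    · exact Or.inr (hm.trans hy)

theorem exists_of_orbitTree {α : Type} {cs : List ℕ} (f : SearchTree → α)
    (hcs : ∀ c ∈ cs, IsTriangulation cayleyColumns (family c) ∧
      Nat.land c (treeCode hasTable) = c) :
    ∃ u, orbitTree path cs f = f u ∧
      ∀ y ∈ u.toList [], ∃ c ∈ cs, Moved (family c) (family y) := by
  have key : ∀ (cs : List ℕ), (∀ c ∈ cs, IsTriangulation cayleyColumns (family c) ∧
      Nat.land c (treeCode hasTable) = c) → ∀ t, ∃ u,
      foldR (fun c K t => bits c fun l => orbitInsert path K l t) f cs t = f u ∧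
      ∀ y ∈ u.toList [], y ∈ t.toList [] ∨ ∃ c ∈ cs, Moved (family c) (family y) := by
    intro cs
    induction cs with
    | nil => exact fun _ t => ⟨t, rfl, fun y hy => Or.inl hy⟩
    | cons c cs ih =>
      intro hcs t
      obtain ⟨hc, hc'⟩ := hcs c List.mem_cons_self
      rw [foldR_cons, bits_eq]
      obtain ⟨u, hu, h⟩ := exists_of_orbitInsert exists_represents
        (foldR (fun c K t => bits c fun l => orbitInsert path K l t) f cs) (t := t) hc
        (enumerates_memberList hc')
      obtain ⟨u', hu', h'⟩ := ih (fun c hc => hcs c (List.mem_cons_of_mem _ hc)) u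
      refine ⟨u', hu.trans hu', fun y hy => ?_⟩
      rcases h' y hy with hy | ⟨d, hd, hy⟩
      · rcases h y hy with hy | hy
        · exact Or.inl hy
        · exact Or.inr ⟨c, List.mem_cons_self, hy⟩
      · exact Or.inr ⟨d, List.mem_cons_of_mem _ hd, hy⟩
  obtain ⟨u, hu, h⟩ := key cs hcs SearchTree.leaf
  exact ⟨u, hu, fun y hy => (h y hy).resolve_left (by simp [SearchTree.toList])⟩

/-! ### The count -/

theorem regularCheck_of_mem {w : ℕ} (hw : w ∈ heights) :
    regularCheck hasTable (treeCode hasTable) w = true := by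
  have h := regularCheck_heights
  rw [forceList_eq, force_eq] at h
  exact allR_eq_true.mp h w hw

theorem regularCodes_spec {c : ℕ} (hc : c ∈ regularCodes hasTable (treeCode hasTable)) :
    IsRegularTriangulation cayleyColumns (family c) ∧ Nat.land c (treeCode hasTable) = c := by
  obtain ⟨w, hw, rfl⟩ := List.mem_map.mp hc
  refine ⟨isRegularTriangulation_of_check (regularCheck_of_mem hw), ?_⟩
  apply Nat.eq_of_testBit_eq
  intro k
  rw [testBit_land, regularCode, testBit_diff]
  cases (treeCode hasTable).testBit k <;> simp

theorem flips_spec : ∀ x ∈ flips,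
    x.1 ∈ heights ∧ x.2.1 ∈ circuits ∧ x.2.2 ≠ [] ∧ ∀ z ∈ x.2.2, z ∈ circuits := by
  decide +kernel

theorem nonregularCodes_spec {c : ℕ} (hc : c ∈ nonregularCodes hasTable (treeCode hasTable)) :
    (IsTriangulation cayleyColumns (family c) ∧ ¬ IsRegularTriangulation cayleyColumns (family c)) ∧
      Nat.land c (treeCode hasTable) = c := by
  obtain ⟨x, hx, rfl⟩ := List.mem_map.mp hc
  obtain ⟨h1, h2, h3, h4⟩ := flips_spec x hx
  have h := flipCheck_flips
  rw [forceList_eq, force_eq] at h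
  have h := allR_eq_true.mp h x hx
  refine ⟨flip_of_check (regularCheck_of_mem h1) h2 h3 h4 h, ?_⟩
  rw [flipCheck, force_eq, force_eq] at h
  simp only [Bool.and_eq_true] at h
  exact Nat.eq_of_beq_eq_true h.1.1

/-- the codes of representatives of all symmetry classes -/
def representatives : List ℕ :=
  regularCodes hasTable (treeCode hasTable) ++ nonregularCodes hasTable (treeCode hasTable)

theorem representatives_spec {c : ℕ} (hc : c ∈ representatives) :
    IsTriangulation cayleyColumns (family c) ∧ Nat.land c (treeCode hasTable) = c := by
  rcases List.mem_append.mp hc with hc | hc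
  · exact ⟨(regularCodes_spec hc).1.1, (regularCodes_spec hc).2⟩
  · exact ⟨(nonregularCodes_spec hc).1.1, (nonregularCodes_spec hc).2⟩

theorem nodup_invariants : (representatives.map fun c => invariant (family c)).Nodup := by
  have h := invariant_check
  rw [forceList_eq, force_eq, forceList_eq, Bool.and_eq_true, forceList_eq] at h
  have h1 := allR_eq_true.mp h.1
  have h2 := nodup_of_distinct h.2
  change (representatives.map _).Nodup at h2
  rwa [List.map_congr_left fun c hc => ?_] at h2
  have h3 := h1 c hc
  rw [bits_eq] at h3 ⊢
  exact invariantCode_eq (enumerates_memberList (representatives_spec hc).2)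
    (nodup_of_increasing h3)

theorem eq_of_symmetryEquivalent {c d : ℕ} (hc : c ∈ representatives) (hd : d ∈ representatives)
    (h : SymmetryEquivalent (family c) (family d)) : c = d :=
  List.inj_on_of_nodup_map nodup_invariants hc hd h.invariant_eq.symm

theorem disjoint_codes {c : ℕ} (hc : c ∈ regularCodes hasTable (treeCode hasTable))
    (hc' : c ∈ nonregularCodes hasTable (treeCode hasTable)) : False :=
  (nonregularCodes_spec hc').1.2 (regularCodes_spec hc).1

theorem exists_lists : ∃ R N : List ℕ, (R.map family).Nodup ∧ R.length = 1002 ∧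
    (N.map family).Nodup ∧ N.length = 66 ∧
    (∀ y ∈ R, ∃ c ∈ regularCodes hasTable (treeCode hasTable), Moved (family c) (family y)) ∧
    (∀ y ∈ N, ∃ c ∈ nonregularCodes hasTable (treeCode hasTable), Moved (family c) (family y)) ∧
    ∀ M, IsFineMixedSubdivision facetTriangle M →
      ∃ y, (y ∈ R ∨ y ∈ N) ∧ M = cayleyTrick (family y) := by
  have h := listCheck_hasTable
  rw [forceList_eq, force_eq, listCheck] at h
  obtain ⟨t, ht, htR⟩ := exists_of_orbitTree
    (cs := regularCodes hasTable (treeCode hasTable)) (fun t =>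
    orbitTree path (nonregularCodes hasTable (treeCode hasTable)) fun u =>
      ((increasing ((t.toList []).map (Nat.land (treeCode hasTable))) &&
      Nat.beq (t.toList []).length 1002) &&
      (increasing ((u.toList []).map (Nat.land (treeCode hasTable))) &&
      Nat.beq (u.toList []).length 66)) &&
      searchCheck hasTable (treeCode hasTable) sampleFlows
        fun x => mark (clearLow x) fun y => t.mem y || u.mem y)
    fun c hc => ⟨(regularCodes_spec hc).1.1, (regularCodes_spec hc).2⟩
  rw [ht] at h
  obtain ⟨u, hu, huN⟩ := exists_of_orbitTree
    (cs := nonregularCodes hasTable (treeCode hasTable)) (fun u =>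
      ((increasing ((t.toList []).map (Nat.land (treeCode hasTable))) &&
      Nat.beq (t.toList []).length 1002) &&
      (increasing ((u.toList []).map (Nat.land (treeCode hasTable))) &&
      Nat.beq (u.toList []).length 66)) &&
      searchCheck hasTable (treeCode hasTable) sampleFlows
        fun x => mark (clearLow x) fun y => t.mem y || u.mem y)
    fun c hc => ⟨(nonregularCodes_spec hc).1.1, (nonregularCodes_spec hc).2⟩
  rw [hu] at h
  rw [Bool.and_eq_true, Bool.and_eq_true, Bool.and_eq_true, Bool.and_eq_true] at h
  obtain ⟨⟨⟨h1, h2⟩, h3, h4⟩, h5⟩ := h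
  -- Different codes could denote the same family; after intersection with the code of all trees,
  -- different numbers mean different families.
  have hnd : ∀ l : List ℕ, increasing (l.map (Nat.land (treeCode hasTable))) = true →
      (l.map family).Nodup := by
    intro l hl
    refine (List.pairwise_map.mp (nodup_of_increasing hl)).map _ fun a b hab h => ?_
    exact hab (family_eq_iff.mp h)
  refine ⟨t.toList [], u.toList [], hnd _ h1, Nat.eq_of_beq_eq_true h2, hnd _ h3,
    Nat.eq_of_beq_eq_true h4, htR, huN, fun M hM => ?_⟩
  have hmem : ∀ x, (mark (clearLow x) fun y => t.mem y || u.mem y) = true →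
      ∃ y, (y ∈ t.toList [] ∨ y ∈ u.toList []) ∧ family y = family x := by
    intro x hx
    rw [mark_eq, Bool.or_eq_true] at hx
    exact ⟨_, hx.imp SearchTree.mem_toList_of_mem SearchTree.mem_toList_of_mem, by
      rw [family_marked, family_clearLow]⟩
  have htri : ∀ y, (y ∈ t.toList [] ∨ y ∈ u.toList []) →
      IsTriangulation cayleyColumns (family y) := by
    rintro y (hy | hy)
    · obtain ⟨c, hc, hm⟩ := htR y hy
      exact hm.isTriangulation (regularCodes_spec hc).1.1
    · obtain ⟨c, hc, hm⟩ := huN y hy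
      exact hm.isTriangulation (nonregularCodes_spec hc).1.1
  obtain ⟨x, hx, rfl⟩ := exists_eq_cayleyTrick hM h5 fun x hx => by
    obtain ⟨y, hy, hxy⟩ := hmem x hx
    exact hxy ▸ htri y hy
  obtain ⟨y, hy, hxy⟩ := hmem x hx
  exact ⟨y, hy, by rw [hxy]⟩

theorem cayleyTrick_injective :
    Function.Injective (cayleyTrick : Finset (Finset Label) → _) :=
  Finset.image_injective cayleyCell_injective

theorem ncard_map_family {l : List ℕ} (hl : (l.map family).Nodup) :
    {T | ∃ y ∈ l, T = family y}.ncard = l.length := by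
  have : {T | ∃ y ∈ l, T = family y} = ((l.map family).toFinset : Set (Finset (Finset Label))) := by
    ext T
    simp [eq_comm]
  rw [this, Set.ncard_coe_finset, List.toFinset_card_of_nodup hl, List.length_map]

/-- The codes in l meet every class of S and are pairwise inequivalent by their invariants, so they
count the classes. -/
theorem ncard_image_symmetryClass {l : List ℕ} (hl : l ⊆ representatives) (hnd : l.Nodup)
    {S : Set (Finset (Finset Label))}
    (hS : ∀ T ∈ S, ∃ c ∈ l, SymmetryEquivalent (family c) T) (hlS : ∀ c ∈ l, family c ∈ S)
    (hST : ∀ T ∈ S, IsTriangulation cayleyColumns T) :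
    (symmetryClass '' S).ncard = l.length := by
  have h1 : symmetryClass '' S = (fun c => symmetryClass (family c)) '' (l.toFinset : Set ℕ) := by
    apply Set.Subset.antisymm
    · rintro _ ⟨T, hT, rfl⟩
      obtain ⟨c, hc, h⟩ := hS T hT
      exact ⟨c, by simpa using hc, (symmetryClass_eq_iff (hST T hT)).mpr h⟩
    · rintro _ ⟨c, hc, rfl⟩
      exact ⟨family c, hlS c (by simpa using hc), rfl⟩
  rw [h1, Set.InjOn.ncard_image, Set.ncard_coe_finset, List.toFinset_card_of_nodup hnd]
  intro c hc d hd h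
  have hc' : c ∈ l := by simpa using hc
  have hd' : d ∈ l := by simpa using hd
  exact eq_of_symmetryEquivalent (hl hc') (hl hd')
    ((symmetryClass_eq_iff (hST _ (hlS d hd'))).mp h)

end TruncatedTetrahedron

/-! ### The main theorem -/

open TruncatedTetrahedron in
theorem theorem4p3 :
    -- the truncated tetrahedron has exactly 1068 mixed subdivisions
    {M | IsFineMixedSubdivision facetTriangle M}.ncard = 1068 ∧
    -- one for each triangulation of the Cayley polytope
    Set.BijOn cayleyTrick {T | IsTriangulation cayleyColumns T}
      {M | IsFineMixedSubdivision facetTriangle M} ∧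
    {T | IsTriangulation cayleyColumns T}.ncard = 1068 ∧
    -- exactly 1002 of them are regular
    {T | IsRegularTriangulation cayleyColumns T}.ncard = 1002 ∧
    -- regularity is a property of the symmetry class
    (∀ T T', IsTriangulation cayleyColumns T → IsTriangulation cayleyColumns T' →
      SymmetryEquivalent T T' →
      (IsRegularTriangulation cayleyColumns T ↔ IsRegularTriangulation cayleyColumns T')) ∧
    -- the symmetry classes of the regular and of the non-regular triangulations
    (symmetryClass '' {T | IsRegularTriangulation cayleyColumns T}).ncard = 48 ∧
    (symmetryClass '' {T | IsTriangulation cayleyColumns T ∧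
      ¬ IsRegularTriangulation cayleyColumns T}).ncard = 7 := by
  obtain ⟨R, N, hR, hR1002, hN, hN66, hRc, hNc, hall⟩ := exists_lists
  have hRreg : ∀ y ∈ R, IsRegularTriangulation cayleyColumns (family y) := by
    intro y hy
    obtain ⟨c, hc, hm⟩ := hRc y hy
    exact hm.isRegularTriangulation (regularCodes_spec hc).1
  have hNnon : ∀ y ∈ N, IsTriangulation cayleyColumns (family y) ∧
      ¬ IsRegularTriangulation cayleyColumns (family y) := by
    intro y hy
    obtain ⟨c, hc, hm⟩ := hNc y hy
    obtain ⟨h1, h2⟩ := (nonregularCodes_spec hc).1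
    exact ⟨hm.isTriangulation h1, fun h => h2 (hm.symm.isRegularTriangulation h)⟩
  -- Completeness for triangulations comes from that for mixed subdivisions, since the Cayley
  -- correspondence is injective.
  have hcases : ∀ T, IsTriangulation cayleyColumns T →
      (∃ y ∈ R, T = family y) ∨ ∃ y ∈ N, T = family y := by
    intro T hT
    obtain ⟨y, hy, h⟩ := hall _ (isFineMixedSubdivision_cayleyTrick hT)
    have := cayleyTrick_injective h
    exact hy.imp (fun hy => ⟨y, hy, this⟩) fun hy => ⟨y, hy, this⟩
  have hreg : {T | IsRegularTriangulation cayleyColumns T} = {T | ∃ y ∈ R, T = family y} := by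
    ext T
    constructor
    · intro hT
      rcases hcases T hT.1 with h | ⟨y, hy, rfl⟩
      · exact h
      · exact absurd hT (hNnon y hy).2
    · rintro ⟨y, hy, rfl⟩
      exact hRreg y hy
  have hnon : {T | IsTriangulation cayleyColumns T ∧ ¬ IsRegularTriangulation cayleyColumns T} =
      {T | ∃ y ∈ N, T = family y} := by
    ext T
    constructor
    · rintro ⟨hT, hT'⟩
      rcases hcases T hT with ⟨y, hy, rfl⟩ | h
      · exact absurd (hRreg y hy) hT'
      · exact h
    · rintro ⟨y, hy, rfl⟩
      exact hNnon y hy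
  have hcard : {T | IsTriangulation cayleyColumns T}.ncard = 1068 := by
    have h1 : {T | IsTriangulation cayleyColumns T} =
        {T | IsRegularTriangulation cayleyColumns T} ∪
        {T | IsTriangulation cayleyColumns T ∧ ¬ IsRegularTriangulation cayleyColumns T} := by
      ext T
      by_cases h : IsRegularTriangulation cayleyColumns T
      · exact ⟨fun _ => Or.inl h, fun _ => h.1⟩
      · exact ⟨fun hT => Or.inr ⟨hT, h⟩, fun hT => hT.elim (fun h => h.1) fun h => h.1⟩
    rw [h1, Set.ncard_union_eq (Set.disjoint_left.mpr fun T h h' => h'.2 h) (Set.toFinite _)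
      (Set.toFinite _), hreg, hnon, ncard_map_family hR, ncard_map_family hN, hR1002, hN66]
  -- Surjectivity is a result of the search: every mixed subdivision comes from a listed family, and
  -- these are triangulations.
  have hbij : Set.BijOn cayleyTrick {T | IsTriangulation cayleyColumns T}
      {M | IsFineMixedSubdivision facetTriangle M} := by
    refine ⟨fun T hT => isFineMixedSubdivision_cayleyTrick hT,
      cayleyTrick_injective.injOn, fun M hM => ?_⟩
    obtain ⟨y, hy, rfl⟩ := hall M hM
    exact ⟨family y, hy.elim (fun hy => (hRreg y hy).1) fun hy => (hNnon y hy).1, rfl⟩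
  have hregular : ∀ T, IsRegularTriangulation cayleyColumns T →
      ∃ c ∈ regularCodes hasTable (treeCode hasTable), SymmetryEquivalent (family c) T := by
    intro T hT
    obtain ⟨y, hy, rfl⟩ := (Set.ext_iff.mp hreg T).mp hT
    obtain ⟨c, hc, hm⟩ := hRc y hy
    exact ⟨c, hc, hm.symmetryEquivalent⟩
  have hnonregular : ∀ T, IsTriangulation cayleyColumns T ∧
      ¬ IsRegularTriangulation cayleyColumns T →
      ∃ c ∈ nonregularCodes hasTable (treeCode hasTable), SymmetryEquivalent (family c) T := by
    intro T hT
    obtain ⟨y, hy, rfl⟩ := (Set.ext_iff.mp hnon T).mp hT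
    obtain ⟨c, hc, hm⟩ := hNc y hy
    exact ⟨c, hc, hm.symmetryEquivalent⟩
  -- Heights cannot be transported, as the symmetry need not be induced by a linear map. Instead, a
  -- regular and a non-regular triangulation in one class would have equivalent representatives,
  -- hence the same one, and no code is of both kinds.
  have hinv : ∀ T T', IsTriangulation cayleyColumns T' → SymmetryEquivalent T T' →
      IsRegularTriangulation cayleyColumns T → IsRegularTriangulation cayleyColumns T' := by
    intro T T' hT' h hT
    by_contra hT''
    obtain ⟨c, hc, hcT⟩ := hregular T hT
    obtain ⟨d, hd, hdT⟩ := hnonregular T' ⟨hT', hT''⟩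
    have : c = d := eq_of_symmetryEquivalent (List.mem_append_left _ hc)
      (List.mem_append_right _ hd) ((hcT.trans h).trans hdT.symm)
    exact disjoint_codes hc (this ▸ hd)
  have hnd := nodup_invariants.of_map
  refine ⟨?_, hbij, hcard, ?_, fun T T' hT hT' h => ⟨hinv T T' hT' h, hinv T' T hT h.symm⟩, ?_, ?_⟩
  · rw [← hbij.image_eq, hbij.injOn.ncard_image, hcard]
  · rw [hreg, ncard_map_family hR, hR1002]
  · rw [ncard_image_symmetryClass (List.subset_append_left _ _) (List.Nodup.of_append_left hnd)
      (S := {T | IsRegularTriangulation cayleyColumns T})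
      hregular (fun c hc => (regularCodes_spec hc).1) fun T hT => hT.1, regularCodes,
      List.length_map]
    rfl
  · rw [ncard_image_symmetryClass (List.subset_append_right _ _) (List.Nodup.of_append_right hnd)
      (S := {T | IsTriangulation cayleyColumns T ∧ ¬ IsRegularTriangulation cayleyColumns T})
      hnonregular (fun c hc => (nonregularCodes_spec hc).1) fun T hT => hT.1, nonregularCodes,
      List.length_map]
    rfl
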